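/- **Conventions.** Let $n\ge 2$, let $B_n$ be the braid group on $n$ strands with Artin generators $\sigma_1,\dots,\sigma_{n-1}$, and let $\Delta=\Delta_n=(\sigma_1\cdots\sigma_{n-1})(\sigma_1\cdots\sigma_{n-2})\cdots(\sigma_1\sigma_2)\sigma_1$ be the fundamental element. A subgroup of $B_n$ is called parabolic with a connected associated Coxeter graph if it is conjugate in $B_n$ to $B_{[k,m]}=\langle\sigma_k,\dots,\sigma_{m-1}\rangle$ for some $1\le k<m\le n$. Write $C(H)$ for the centralizer of $H$ in $B_n$. For subgroups $A,B\le B_n$, the double coset problem (DCP) for $(A,B)$ in $B_n$ is: given $(g,g')\in B_n^2$, decide whether $g'\in AgB$, and if so find $a\in A$, $b\in B$ with $g'=agb$. A simultaneous conjugacy problem in $B_n$ is: given finitely many pairs $(u_i,v_i)\in B_n^2$, find $x\in B_n$ with $v_i=xu_ix^{-1}$ for all $i$. Braids are given as words in the $\sigma_i^{\pm1}$. **Theorem.** Let $A,B$ be parabolic subgroups of $B_n$ with a connected associated Coxeter graph. Then $C(A)$ and $C(B)$ are finitely generated. Let $c_1,\dots,c_p$ generate $C(A)$ and let $d_1,\dots,d_q$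 generate $C(B)$. For $g,g'\in B_n$ consider the system $$(*)\qquad x c_i x^{-1}=c_i\quad(1\le i\le p),\qquad x(g d_j g^{-1})x^{-1}=g' d_j g'^{-1}\quad(1\le j\le q).$$ 1. If $g'=agb$ with $a\in A$, $b\in B$, then $x=a$ solves $(*)$; in particular $(*)$ is solvable whenever $g'\in AgB$. More precisely, $(*)$ is solvable if and only if $\Delta^{2k}g'\in AgB$ for some $k\in\mathbb Z$. 2. Every solution $x$ of $(*)$ can be written as $x=\Delta^{2k}\hat a$ with $k\in\mathbb Z$ and $\hat a\in A$, uniquely if $A\ne B_n$. Moreover, for every solution $x$ of $(*)$, one has $g'\in AgB$ if and only if there is such a decomposition $x=\Delta^{2k}\hat a$ with $g^{-1}\hat a^{-1}g'\in B$ (in this case $(\hat a,\ g^{-1}\hat a^{-1}g')$ solves the DCP instance). 3. Consequently the DCP for $(A,B)$ in $B_n$ reduces in polynomial time to the simultaneous conjugacy problem $(*)$. For fixed $n,A,B$ and fixed words for the $c_i,d_j$: the list of pairs $(c_i,c_i)$, $(gd_jg^{-1},g'd_jg'^{-1})$ is computable by a Turing machine from words for $g,g'$ in time polynomial in their lengths;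 if it has no solution, then $g'\notin AgB$; and there is a Turing machine which, given words for $g,g'$ and for an arbitrary solution $x$ of $(*)$, in time polynomial in the lengths of these words either outputs words for $\hat a\in A$ and $\hat b\in B$ with $g'=\hat a g\hat b$ and $x\in\langle\Delta^2\rangle\hat a$, or correctly reports that $g'\notin AgB$. -/

import Mathlib

/-! ### Braid groups -/

/-- Artin's relations; the index `i : Fin (n - 1)` stands for the generator `σ_{i+1}`. -/
def braidRels (n : ℕ) : Set (FreeGroup (Fin (n - 1))) :=
  {r | ∃ i j : Fin (n - 1), (i : ℕ) + 1 = j ∧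
      r = FreeGroup.of i * FreeGroup.of j * FreeGroup.of i *
        (FreeGroup.of j * FreeGroup.of i * FreeGroup.of j)⁻¹} ∪
  {r | ∃ i j : Fin (n - 1), (i : ℕ) + 2 ≤ j ∧
      r = FreeGroup.of i * FreeGroup.of j * (FreeGroup.of j * FreeGroup.of i)⁻¹}

/-- The braid group `B_n` on `n` strands. -/
abbrev BraidGroup (n : ℕ) : Type := PresentedGroup (braidRels n)

/-- The Artin generator `σ_{i+1}` of `B_n`. -/
def braidGen {n : ℕ} (i : Fin (n - 1)) : BraidGroup n := PresentedGroup.of i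

/-- The fundamental element
`Δ_n = (σ_1 σ_2 ⋯ σ_{n-1}) (σ_1 σ_2 ⋯ σ_{n-2}) ⋯ (σ_1 σ_2) σ_1`. -/
def garsideElement (n : ℕ) : BraidGroup n :=
  ((List.finRange (n - 1)).reverse.map fun j =>
    (((List.finRange (n - 1)).filter fun i => i ≤ j).map braidGen).prod).prod

/-- The subgroup `B_{[k,m]} = ⟨σ_k, …, σ_{m-1}⟩` of `B_n`. -/
def standardParabolic (n k m : ℕ) : Subgroup (BraidGroup n) :=
  Subgroup.closure {x | ∃ i : Fin (n - 1), k ≤ (i : ℕ) + 1 ∧ (i : ℕ) + 1 < m ∧ x = braidGen i}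

/-- `H` is a parabolic subgroup of `B_n` with a connected associated Coxeter graph: it is conjugate
to `B_{[k,m]}` for some `1 ≤ k < m ≤ n`. -/
def IsConnectedParabolic {n : ℕ} (H : Subgroup (BraidGroup n)) : Prop :=
  ∃ k m : ℕ, 1 ≤ k ∧ k < m ∧ m ≤ n ∧ ∃ α : BraidGroup n,
    H = (standardParabolic n k m).map (MulAut.conj α).toMonoidHom

/-- `x` solves the system `x c_i x⁻¹ = c_i`, `x (g d_j g⁻¹) x⁻¹ = g' d_j g'⁻¹`. -/
def SolvesSystem {G : Type*} [Group G] {p q : ℕ} (c : Fin p → G) (d : Fin q → G) (g g' x : G) :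
    Prop :=
  (∀ i, x * c i * x⁻¹ = c i) ∧ ∀ j, x * (g * d j * g⁻¹) * x⁻¹ = g' * d j * g'⁻¹

/-! ### Words -/

/-- Words in the letters `σ_i^{±1}`; `(i, true)` is `σ_{i+1}` and `(i, false)` its inverse. -/
abbrev BraidWord (n : ℕ) : Type := List (Fin (n - 1) × Bool)

/-- The braid represented by a word. -/
def BraidWord.eval {n : ℕ} (w : BraidWord n) : BraidGroup n :=
  PresentedGroup.mk (braidRels n) (FreeGroup.mk w)

/-! ### Encodings over finite alphabets -/

/-- Encoding of lists: every entry is followed by the separator `none`. -/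
def encodeSep {α Γ : Type} (e : Computability.Encoding α Γ) (l : List α) : List (Option Γ) :=
  l.flatMap fun a => (e.encode a).map some ++ [none]

/-- Splits a string at the separators; `acc` is the reversed current block. -/
def splitSep {Γ : Type} : List Γ → List (Option Γ) → List (List Γ)
  | _, [] => []
  | acc, none :: l => acc.reverse :: splitSep [] l
  | acc, some x :: l => splitSep (x :: acc) l

theorem splitSep_append {Γ : Type} (u acc : List Γ) (l : List (Option Γ)) :
    splitSep acc (u.map some ++ none :: l) = (acc.reverse ++ u) :: splitSep [] l := by
  induction u generalizing acc with
  | nil => simp [splitSep]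
  | cons x u ih => simp [splitSep, ih]

/-- Encoding of lists: every entry is followed by the separator `none`. -/
def sepEncoding {α Γ : Type} (e : Computability.Encoding α Γ) :
    Computability.Encoding (List α) (Option Γ) where
  encode := encodeSep e
  decode l := (splitSep [] l).mapM e.decode
  decode_encode l := by
    have h : splitSep [] (encodeSep e l) = l.map e.encode := by
      induction l with
      | nil => simp [encodeSep, splitSep]
      | cons a l ih =>
        have h2 : encodeSep e (a :: l) = (e.encode a).map some ++ none :: encodeSep e l := by
          simp [encodeSep]
        rw [h2, splitSep_append, ih]
        simp
    rw [h]
    clear h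
    induction l with
    | nil => rfl
    | cons a l ih => simp [ih]

/-- Encoding of `Option α`: `none` is the empty string, and `some a` is the code of `a` preceded by
a marker. -/
def optionEncoding {α Γ : Type} (e : Computability.Encoding α Γ) :
    Computability.Encoding (Option α) (Option Γ) where
  encode o := o.elim [] fun a => none :: (e.encode a).map some
  decode l := match l with
    | [] => some none
    | _ :: l => (e.decode (l.filterMap id)).map some
  decode_encode o := by
    cases o with
    | none => rfl
    | some a => simp [List.filterMap_map]

/-! ### Search problems and polynomial-time reductions -/

/-- A search problem, with instances and candidate solutions encoded over alphabets `Γ`, `Γ'`. -/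
structure SearchProblem (Γ Γ' : Type) where
  /-- instances -/
  Inst : Type
  /-- candidate solutions -/
  Sol : Type
  /-- encoding of instances -/
  encInst : Computability.Encoding Inst Γ
  /-- encoding of candidate solutions -/
  encSol : Computability.Encoding Sol Γ'
  /-- the candidate solves the instance -/
  IsSol : Inst → Sol → Prop

/-- The pair `(f, h)` is a polynomial-time reduction of the search problem `P` to the search problem
`Q` with one query: an instance `p` of `P` is turned into the instance `f p` of `Q`. If `f p` has no
solution, then neither has `p`. From `p` and an arbitrary solution `s` of `f p`, the
function `h` computes a solution of `p`, or reports correctly that `p` has none. Both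
functions are computed by Turing machines in time polynomial in the length of their input. -/
structure IsPolyTimeReduction {Γ₁ Γ₂ Γ₃ Γ₄ : Type} (P : SearchProblem Γ₁ Γ₂)
    (Q : SearchProblem Γ₃ Γ₄) (f : P.Inst → Q.Inst) (h : P.Inst × Q.Sol → Option P.Sol) : Prop where
  polyTime_query : Nonempty (Turing.TM2ComputableInPolyTime P.encInst.encode Q.encInst.encode f)
  polyTime_answer : Nonempty (Turing.TM2ComputableInPolyTime
    (Computability.encodingProd P.encInst Q.encSol).encode (optionEncoding P.encSol).encode h)
  query_solvable : ∀ p, (∃ t, P.IsSol p t) → ∃ s, Q.IsSol (f p) s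
  answer_some : ∀ p s, Q.IsSol (f p) s → ∀ t, h (p, s) = some t → P.IsSol p t
  answer_none : ∀ p s, Q.IsSol (f p) s → h (p, s) = none → ¬ ∃ t, P.IsSol p t

/-- Encoding of words by themselves. -/
def wordEncoding (n : ℕ) : Computability.Encoding (BraidWord n) (Fin (n - 1) × Bool) :=
  Computability.encodingList _

/-- Encoding of pairs of words. -/
def wordPairEncoding (n : ℕ) : Computability.Encoding (BraidWord n × BraidWord n)
    ((Fin (n - 1) × Bool) ⊕ (Fin (n - 1) × Bool)) :=
  Computability.encodingProd (wordEncoding n) (wordEncoding n)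

/-- The double coset problem for `(A, B)` in `B_n`: an instance is a pair `(g, g')`, a solution is a
pair `(a, b)` with `a ∈ A`, `b ∈ B` and `g' = a g b`; braids are given by words. -/
def doubleCosetProblem {n : ℕ} (A B : Subgroup (BraidGroup n)) :
    SearchProblem ((Fin (n - 1) × Bool) ⊕ (Fin (n - 1) × Bool))
      ((Fin (n - 1) × Bool) ⊕ (Fin (n - 1) × Bool)) where
  Inst := BraidWord n × BraidWord n
  Sol := BraidWord n × BraidWord n
  encInst := wordPairEncoding n
  encSol := wordPairEncoding n
  IsSol p t := t.1.eval ∈ A ∧ t.2.eval ∈ B ∧ p.2.eval = t.1.eval * p.1.eval * t.2.eval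

/-- The simultaneous conjugacy problem in `B_n`: an instance is a finite list of pairs `(u, v)`, a
solution is a braid `x` with `v = x u x⁻¹` for all pairs of the list; braids are given by words. -/
def simultaneousConjugacyProblem (n : ℕ) :
    SearchProblem (Option ((Fin (n - 1) × Bool) ⊕ (Fin (n - 1) × Bool))) (Fin (n - 1) × Bool) where
  Inst := List (BraidWord n × BraidWord n)
  Sol := BraidWord n
  encInst := sepEncoding (wordPairEncoding n)
  encSol := wordEncoding n
  IsSol l x := ∀ u ∈ l, u.2.eval = x.eval * u.1.eval * x.eval⁻¹

/-- The simultaneous conjugacy instance with the pairs `(c_i, c_i)` and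
`(g d_j g⁻¹, g' d_j g'⁻¹)`. -/
def systemInstance {n p q : ℕ} (c : Fin p → BraidWord n) (d : Fin q → BraidWord n)
    (gg : BraidWord n × BraidWord n) : List (BraidWord n × BraidWord n) :=
  List.ofFn (fun i => (c i, c i)) ++
    List.ofFn fun j => (gg.1 ++ d j ++ FreeGroup.invRev gg.1, gg.2 ++ d j ++ FreeGroup.invRev gg.2)

/-! The core is a double centralizer theorem: a braid that commutes with all of C(A) lies in ⟨Δ²⟩A.
The system (*) says that x commutes with C(A) and g'⁻¹xg with C(B). Hence x = Δ^{2k}a and g'⁻¹xg =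
Δ^{2l}b, so that Δ^{2(l-k)}g' = a g b⁻¹, and the double coset problem becomes the question whether k
= l can be arranged.

Conjugation by powers of σ_1⋯σ_{n-1} and by the given braid reduces A to B_r on the first r strands
(`exists_isConj`). The double centralizer is then found by induction on the number of strands
(`exists_of_commute_centralizer`). A braid x in B_{m+1} that commutes with Δ_m² must fix the last
strand, because conjugation permutes the pairwise crossing numbers of a pure braid. So x = f·c,
where c is in B_m and f is in the free group of pure braids in which only the last strand moves.
This factorization is unique: B_{m+1} acts on the cosets of the stabilizer of the last strand with
values in F ⋊ B_m, and the pair (f, c) can be read off from the image of a base point. Uniqueness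
turns the commutation into a fixed-point equation for f under Artin's action of Δ_m². That action
conjugates the letters x_0, …, x_{m-1} by the loop x_{m-1}⋯x_0, and Fox calculus
(`mem_closure_of_fixed`) shows that f is a power of the loop. As the loop is Δ_{m+1}²Δ_m⁻², x lies
in ⟨Δ_{m+1}²⟩B_m. For r < m the induction hypothesis leaves a power of Δ_m², and commutation with
σ_m kills it. The same fixed-point theorem for Δ_r² gives generators of C(A) (`centralizer_fg`).

If A and B are both proper, k and l are determined and g' ∈ AgB forces k = l. Otherwise a conjugate
of an element of a proper parabolic subgroup would be a nontrivial power of Δ² times an element of a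
proper parabolic subgroup, which crossing numbers exclude (`eq_zero_of_conj`). If A or B is all of
B_n, its exponent may be chosen freely.

For the algorithm, if A = αB_rα⁻¹ is proper, the first and the last strand of α⁻¹xα cross 2k times
with signs (`IsConj.lk_eq`), and similarly for l. A machine follows two strands through the words,
compares the two counts and prints Δ^{-2k}x and g⁻¹x⁻¹Δ^{2k}g'. It is a fixed sequence of loops,
each consuming one stack, so its running time is linear. -/

namespace Braid

/-! ### Generators with natural number indices -/

/-- The Artin generator `σ_{i+1}` of `B_n` for a natural number `i`, trivial out of range. -/
def gen (n i : ℕ) : BraidGroup n := if h : i < n - 1 then braidGen ⟨i, h⟩ else 1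

theorem gen_of_lt {n i : ℕ} (h : i < n - 1) : gen n i = braidGen ⟨i, h⟩ := dif_pos h

theorem gen_val {n : ℕ} (i : Fin (n - 1)) : gen n i = braidGen i := gen_of_lt i.2

theorem gen_braid {n i : ℕ} (h : i + 2 < n) :
    gen n i * gen n (i + 1) * gen n i = gen n (i + 1) * gen n i * gen n (i + 1) := by
  rw [gen_of_lt (show i < n - 1 by omega), gen_of_lt (show i + 1 < n - 1 by omega)]
  exact PresentedGroup.mk_eq_mk_of_mul_inv_mem (Or.inl ⟨_, _, rfl, rfl⟩)

theorem gen_comm {n i j : ℕ} (h : i + 2 ≤ j) : Commute (gen n i) (gen n j) := by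
  by_cases hj : j < n - 1
  · rw [gen_of_lt (show i < n - 1 by omega), gen_of_lt hj]
    exact PresentedGroup.mk_eq_mk_of_mul_inv_mem (Or.inr ⟨_, _, h, rfl⟩)
  · rw [gen, gen, dif_neg hj]
    exact Commute.one_right _

section lift

variable {G : Type*} [Group G] {n : ℕ} (f : ℕ → G)
  (hb : ∀ i, i + 2 < n → f i * f (i + 1) * f i = f (i + 1) * f i * f (i + 1))
  (hc : ∀ i j, i + 2 ≤ j → j + 1 < n → f i * f j = f j * f i)

theorem lift_rels {G : Type*} [Group G] {n : ℕ} (f : ℕ → G)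
    (hb : ∀ i, i + 2 < n → f i * f (i + 1) * f i = f (i + 1) * f i * f (i + 1))
    (hc : ∀ i j, i + 2 ≤ j → j + 1 < n → f i * f j = f j * f i) :
    ∀ r ∈ braidRels n, FreeGroup.lift (fun i : Fin (n - 1) => f i) r = 1 := by
  rintro r (⟨i, j, h, rfl⟩ | ⟨i, j, h, rfl⟩)
  · have := hb i (by omega)
    simp only [map_mul, map_inv, FreeGroup.lift_apply_of, ← h]
    rw [this, mul_inv_cancel]
  · have := hc i j h (by omega)
    simp only [map_mul, map_inv, FreeGroup.lift_apply_of]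
    rw [this, mul_inv_cancel]

/-- The universal property of the braid group. -/
def lift : BraidGroup n →* G := PresentedGroup.toGroup (lift_rels f hb hc)

theorem lift_gen {i : ℕ} (h : i + 1 < n) : lift f hb hc (gen n i) = f i := by
  rw [gen_of_lt (show i < n - 1 by omega)]
  exact PresentedGroup.toGroup.of _

end lift

theorem closure_gen (n : ℕ) : Subgroup.closure {x | ∃ i, i + 1 < n ∧ x = gen n i} = ⊤ := by
  rw [eq_top_iff, ← PresentedGroup.closure_range_of]
  apply Subgroup.closure_mono
  rintro _ ⟨i, rfl⟩
  exact ⟨i, by omega, (gen_val i).symm⟩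

/-- Every property of braids that is stable under multiplication by generators and their inverses
on the left and holds for `1` holds for all braids. -/
theorem induction_left {n : ℕ} {p : BraidGroup n → Prop} (one : p 1)
    (mul : ∀ i x, i + 1 < n → p x → p (gen n i * x))
    (inv_mul : ∀ i x, i + 1 < n → p x → p ((gen n i)⁻¹ * x)) (x : BraidGroup n) : p x := by
  have hx : x ∈ Subgroup.closure {x | ∃ i, i + 1 < n ∧ x = gen n i} := by
    rw [closure_gen]; trivial
  induction hx using Subgroup.closure_induction_left with
  | one => exact one
  | mul_left y hy z _ ih => obtain ⟨i, hi, rfl⟩ := hy; exact mul i z hi ih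
  | inv_mul_cancel y hy z _ ih => obtain ⟨i, hi, rfl⟩ := hy; exact inv_mul i z hi ih

theorem hom_ext {G : Type*} [Group G] {n : ℕ} {f g : BraidGroup n →* G}
    (h : ∀ i, i + 1 < n → f (gen n i) = g (gen n i)) : f = g := by
  apply MonoidHom.eq_of_eqOn_dense (closure_gen n)
  rintro _ ⟨i, hi, rfl⟩
  exact h i hi

theorem mem_centralizer_range {G : Type*} [Group G] {n : ℕ} {f : BraidGroup n →* G} {x : G}
    (h : ∀ i, i + 1 < n → Commute (f (gen n i)) x) (b : BraidGroup n) : Commute (f b) x := by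
  have : f.range ≤ Subgroup.centralizer {x} := by
    rw [MonoidHom.range_eq_map, ← closure_gen, MonoidHom.map_closure, Subgroup.closure_le]
    rintro _ ⟨_, ⟨i, hi, rfl⟩, rfl⟩
    exact Subgroup.mem_centralizer_singleton_iff.2 (h i hi)
  exact Subgroup.mem_centralizer_singleton_iff.1 (this ⟨b, rfl⟩)

/-- The homomorphism `B_m → B_n` for `m ≤ n` that adds `n - m` strands on the right. -/
def incl {m n : ℕ} (h : m ≤ n) : BraidGroup m →* BraidGroup n :=
  lift (gen n) (fun _ hi => gen_braid (by omega)) fun _ _ hij _ => gen_comm hij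

@[simp]
theorem incl_gen {m n : ℕ} (h : m ≤ n) {i : ℕ} (hi : i + 1 < m) :
    incl h (gen m i) = gen n i := lift_gen _ _ _ hi

theorem incl_incl {l m n : ℕ} (h : l ≤ m) (h' : m ≤ n) (x : BraidGroup l) :
    incl h' (incl h x) = incl (h.trans h') x := by
  have : (incl h').comp (incl h) = incl (h.trans h') :=
    hom_ext fun i hi => by
      rw [MonoidHom.comp_apply, incl_gen _ hi, incl_gen _ (by omega), incl_gen _ hi]
  exact DFunLike.congr_fun this x

theorem incl_self {n : ℕ} (x : BraidGroup n) : incl le_rfl x = x := by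
  have : incl le_rfl = MonoidHom.id (BraidGroup n) := hom_ext fun i hi => by simp [incl_gen _ hi]
  exact DFunLike.congr_fun this x

theorem range_incl {m n : ℕ} (h : m ≤ n) :
    (incl h).range = Subgroup.closure {x | ∃ i, i + 1 < m ∧ x = gen n i} := by
  rw [MonoidHom.range_eq_map, ← closure_gen, MonoidHom.map_closure]
  congr 1
  ext x
  constructor
  · rintro ⟨_, ⟨i, hi, rfl⟩, rfl⟩; exact ⟨i, hi, incl_gen _ hi⟩
  · rintro ⟨i, hi, rfl⟩; exact ⟨_, ⟨i, hi, rfl⟩, incl_gen _ hi⟩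

theorem incl_comm_gen {m n : ℕ} (h : m ≤ n) (b : BraidGroup m) {j : ℕ} (hj : m ≤ j) :
    Commute (incl h b) (gen n j) :=
  mem_centralizer_range (fun i hi => by rw [incl_gen _ hi]; exact gen_comm (by omega)) b

/-! ### The braids `σ_1 ⋯ σ_k` and the fundamental element -/

/-- The braid `σ_1 ⋯ σ_k`. -/
def up (n : ℕ) : ℕ → BraidGroup n
  | 0 => 1
  | k + 1 => up n k * gen n k

/-- The braid `σ_k ⋯ σ_1`. -/
def down (n : ℕ) : ℕ → BraidGroup n
  | 0 => 1
  | k + 1 => gen n k * down n k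

theorem up_comm_gen {n k j : ℕ} (h : k < j) : Commute (up n k) (gen n j) := by
  induction k with
  | zero => exact Commute.one_left _
  | succ k ih => exact (ih (by omega)).mul_left (gen_comm (by omega))

theorem down_comm_gen {n k j : ℕ} (h : k < j) : Commute (down n k) (gen n j) := by
  induction k with
  | zero => exact Commute.one_left _
  | succ k ih => exact (gen_comm (by omega)).mul_left (ih (by omega))

theorem up_mul_gen {n k i : ℕ} (h : i + 1 < k) (hk : k < n) :
    up n k * gen n i = gen n (i + 1) * up n k := by
  induction k with
  | zero => omega
  | succ k ih =>
    rcases Nat.lt_or_ge (i + 1) k with h' | h'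
    · rw [up, mul_assoc, ← (gen_comm (show i + 2 ≤ k by omega)).eq, ← mul_assoc,
        ih h' (by omega), mul_assoc]
    · obtain rfl : k = i + 1 := by omega
      have h1 := gen_braid (n := n) (i := i) (by omega)
      have h2 := (up_comm_gen (n := n) (show i < i + 1 by omega)).eq
      simp only [up]
      calc up n i * gen n i * gen n (i + 1) * gen n i
          = up n i * (gen n i * gen n (i + 1) * gen n i) := by simp only [mul_assoc]
        _ = up n i * gen n (i + 1) * gen n i * gen n (i + 1) := by
            rw [h1]; simp only [mul_assoc]
        _ = _ := by rw [h2]; simp only [mul_assoc]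

theorem down_mul_gen {n k i : ℕ} (h : i + 1 < k) (hk : k < n) :
    down n k * gen n (i + 1) = gen n i * down n k := by
  induction k with
  | zero => omega
  | succ k ih =>
    rcases Nat.lt_or_ge (i + 1) k with h' | h'
    · rw [down, mul_assoc, ih h' (by omega), ← mul_assoc,
        ← (gen_comm (show i + 2 ≤ k by omega)).eq, mul_assoc]
    · obtain rfl : k = i + 1 := by omega
      have h1 := gen_braid (n := n) (i := i) (by omega)
      have h2 := (down_comm_gen (n := n) (show i < i + 1 by omega)).eq
      simp only [down]
      calc gen n (i + 1) * (gen n i * down n i) * gen n (i + 1)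
          = gen n (i + 1) * gen n i * (down n i * gen n (i + 1)) := by simp only [mul_assoc]
        _ = (gen n (i + 1) * gen n i * gen n (i + 1)) * down n i := by
            rw [h2]; simp only [mul_assoc]
        _ = _ := by rw [← h1]; simp only [mul_assoc]

/-- The fundamental element of the braid group on the first `k` strands. -/
def delta (n : ℕ) : ℕ → BraidGroup n
  | 0 => 1
  | k + 1 => up n k * delta n k

theorem incl_up {m n : ℕ} (h : m ≤ n) {k : ℕ} (hk : k < m) : incl h (up m k) = up n k := by
  induction k with
  | zero => exact map_one _
  | succ k ih => rw [up, map_mul, ih (by omega), incl_gen _ hk, up]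

theorem incl_delta {m n : ℕ} (h : m ≤ n) {k : ℕ} (hk : k ≤ m) :
    incl h (delta m k) = delta n k := by
  induction k with
  | zero => exact map_one _
  | succ k ih => rw [delta, map_mul, ih (by omega), incl_up _ (by omega), delta]

theorem delta_comm_gen {n k j : ℕ} (h : k ≤ j) : Commute (delta n k) (gen n j) := by
  induction k with
  | zero => exact Commute.one_left _
  | succ k ih => exact (up_comm_gen (by omega)).mul_left (ih (by omega))

theorem delta_succ' (n k : ℕ) : delta n (k + 1) = delta n k * down n k := by
  induction k with
  | zero => rfl
  | succ k ih =>
    calc delta n (k + 2) = up n k * gen n k * delta n (k + 1) := rfl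
      _ = up n k * gen n k * (delta n k * down n k) := by rw [ih]
      _ = up n k * (delta n k * gen n k) * down n k := by
        rw [(delta_comm_gen le_rfl).eq]; simp only [mul_assoc]
      _ = _ := by simp only [delta, down, mul_assoc]

/-- There are two factorizations of Δ_{k+1}: `up n k * delta n k` settles all generators but the
last by induction, and `delta n k * down n k` settles the last one. -/
theorem delta_mul_gen {n k i : ℕ} (h : i + 1 < k) (hk : k ≤ n) :
    delta n k * gen n i = gen n (k - 2 - i) * delta n k := by
  induction k generalizing i with
  | zero => omega
  | succ k ih =>
    rcases Nat.lt_or_ge (i + 1) k with h' | h'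
    · rw [delta, mul_assoc, ih h' (by omega), ← mul_assoc, up_mul_gen (by omega) (by omega),
        mul_assoc]
      congr 3; omega
    · obtain rfl : k = i + 1 := by omega
      rcases i with - | i
      · simp [delta, up]
      · rw [delta_succ', mul_assoc, down_mul_gen (by omega) (by omega), ← mul_assoc,
          ih (by omega) (by omega), mul_assoc]
        congr 2; omega

theorem delta_sq_comm_gen {n k i : ℕ} (h : i + 1 < k) (hk : k ≤ n) :
    Commute (delta n k ^ 2) (gen n i) := by
  rw [commute_iff_eq, pow_two, mul_assoc, delta_mul_gen h hk, ← mul_assoc,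
    delta_mul_gen (by omega) hk, mul_assoc]
  congr 2; omega

theorem delta_sq_comm_incl {m n : ℕ} (h : m ≤ n) (b : BraidGroup m) {k : ℕ} (hm : m ≤ k)
    (hk : k ≤ n) : Commute (incl h b) (delta n k ^ 2) :=
  mem_centralizer_range
    (fun i hi => by rw [incl_gen _ hi]; exact (delta_sq_comm_gen (by omega) hk).symm) b

theorem delta_sq_central {n : ℕ} (b : BraidGroup n) : Commute (delta n n ^ 2) b := by
  have := delta_sq_comm_incl le_rfl b le_rfl le_rfl
  rw [incl_self] at this
  exact this.symm

/-- Moving a generator of B_k past `up` raises its index by one, and moving it past `down` lowers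
the index again. So the product commutes with all of B_k. -/
theorem down_mul_up_comm_delta {n k : ℕ} (hk : k < n) :
    Commute (down n k * up n k) (delta n k) := by
  have : ∀ b : BraidGroup k, Commute (incl hk.le b) (down n k * up n k) :=
    mem_centralizer_range fun i hi => by
      rw [incl_gen _ hi, commute_iff_eq, mul_assoc, up_mul_gen hi hk, ← mul_assoc,
        ← down_mul_gen hi hk]
      simp only [mul_assoc]
  have h := this (delta k k)
  rw [incl_delta _ le_rfl] at h
  exact h.symm

/-- The factor `down n k * up n k` is the strand at position `k` encircling all strands before it.
This identity is what later identifies the loop in the free group with a quotient of two full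
twists. -/
theorem delta_succ_sq {n k : ℕ} (hk : k < n) :
    delta n (k + 1) ^ 2 = down n k * up n k * delta n k ^ 2 := by
  calc delta n (k + 1) ^ 2 = delta n (k + 1) * delta n (k + 1) := pow_two _
    _ = delta n k * down n k * (up n k * delta n k) := by
        nth_rewrite 1 [delta_succ']; rfl
    _ = delta n k * (down n k * up n k) * delta n k := by simp only [mul_assoc]
    _ = _ := by rw [← (down_mul_up_comm_delta hk).eq, pow_two, mul_assoc]

/-! ### Permutations and crossing numbers -/

/-- The transposition of `i` and `i + 1`. -/
def sw (i p : ℕ) : ℕ := if p = i then i + 1 else if p = i + 1 then i else p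

/-- The indicator of the pairs `(i, i + 1)` and `(i + 1, i)`. -/
def adj (i p q : ℕ) : ℤ := if (p = i ∧ q = i + 1) ∨ (p = i + 1 ∧ q = i) then 1 else 0

theorem sw_sw (i p : ℕ) : sw i (sw i p) = p := by grind [sw]

theorem sw_eq_iff {i p q : ℕ} : sw i p = q ↔ p = sw i q := by grind [sw]

theorem adj_sw (i p q : ℕ) : adj i (sw i p) (sw i q) = adj i p q := by grind [sw, adj]

theorem sw_lt {n i p : ℕ} (hi : i + 1 < n) (hp : p < n) : sw i p < n := by grind [sw]

/-- The action of the generators on pairs of strands, which counts the crossings of the pair. -/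
def crossGen (i : ℕ) : Equiv.Perm (ℕ × ℕ × ℤ) where
  toFun x := (sw i x.1, sw i x.2.1, x.2.2 + adj i x.1 x.2.1)
  invFun x := (sw i x.1, sw i x.2.1, x.2.2 - adj i x.1 x.2.1)
  left_inv x := by simp [sw_sw, adj_sw]
  right_inv x := by simp [sw_sw, adj_sw]

theorem sw_braid (i p : ℕ) : sw i (sw (i + 1) (sw i p)) = sw (i + 1) (sw i (sw (i + 1) p)) := by
  grind [sw]

theorem sw_comm {i j : ℕ} (h : i + 2 ≤ j) (p : ℕ) : sw i (sw j p) = sw j (sw i p) := by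
  grind [sw]

/-- On either side of the braid relation each pair among the three strands crosses exactly once. -/
theorem adj_braid (i p q : ℕ) :
    adj i p q + adj (i + 1) (sw i p) (sw i q) + adj i (sw (i + 1) (sw i p)) (sw (i + 1) (sw i q)) =
    adj (i + 1) p q + adj i (sw (i + 1) p) (sw (i + 1) q) +
      adj (i + 1) (sw i (sw (i + 1) p)) (sw i (sw (i + 1) q)) := by
  have h1 : sw i i = i + 1 := by grind [sw]
  have h2 : sw i (i + 1) = i := by grind [sw]
  have h3 : sw (i + 1) (i + 1) = i + 2 := by grind [sw]
  have h4 : sw (i + 1) (i + 2) = i + 1 := by grind [sw]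
  have h5 : sw i (i + 2) = i + 2 := by grind [sw]
  have h6 : sw (i + 1) i = i := by grind [sw]
  simp only [adj, sw_eq_iff, h1, h2, h3, h4, h5, h6]
  ring

theorem adj_sw_of_ne {i j : ℕ} (h : i + 2 ≤ j ∨ j + 2 ≤ i) (p q : ℕ) :
    adj j (sw i p) (sw i q) = adj j p q := by
  have h1 : sw i j = j := by grind [sw]
  have h2 : sw i (j + 1) = j + 1 := by grind [sw]
  simp only [adj, sw_eq_iff, h1, h2]

theorem adj_comm {i j : ℕ} (h : i + 2 ≤ j) (p q : ℕ) :
    adj j p q + adj i (sw j p) (sw j q) = adj i p q + adj j (sw i p) (sw i q) := by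
  rw [adj_sw_of_ne (Or.inl h), adj_sw_of_ne (Or.inr h), add_comm]

/-- The action of the braid group on pairs of strands, which counts the crossings of the pair. -/
def cross (n : ℕ) : BraidGroup n →* Equiv.Perm (ℕ × ℕ × ℤ) :=
  lift crossGen
    (fun i _ => by
      ext1 ⟨p, q, t⟩
      simp only [crossGen, Equiv.Perm.mul_apply, Equiv.coe_fn_mk, Prod.mk.injEq, sw_braid, true_and]
      linarith [adj_braid i p q])
    (fun i j h _ => by
      ext1 ⟨p, q, t⟩
      simp only [crossGen, Equiv.Perm.mul_apply, Equiv.coe_fn_mk, Prod.mk.injEq, sw_comm h,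
        true_and]
      linarith [adj_comm h p q])

/-- The permutation of a braid. -/
def perm (n : ℕ) : BraidGroup n →* Equiv.Perm ℕ :=
  lift (fun i => ⟨sw i, sw i, sw_sw i, sw_sw i⟩)
    (fun i _ => Equiv.ext (sw_braid i)) (fun _ _ h _ => Equiv.ext (sw_comm h))

/-- The number of crossings, counted with signs, of the strands at the positions `p` and `q`. -/
def lk {n : ℕ} (x : BraidGroup n) (p q : ℕ) : ℤ := (cross n x (p, q, 0)).2.2

theorem perm_gen {n i : ℕ} (h : i + 1 < n) (p : ℕ) : perm n (gen n i) p = sw i p := by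
  rw [perm, lift_gen _ _ _ h]; rfl

theorem perm_gen_inv {n i : ℕ} (h : i + 1 < n) (p : ℕ) : perm n (gen n i)⁻¹ p = sw i p := by
  rw [map_inv, Equiv.Perm.inv_eq_iff_eq, perm_gen h, sw_sw]

theorem cross_gen {n i : ℕ} (h : i + 1 < n) : cross n (gen n i) = crossGen i :=
  lift_gen _ _ _ h

theorem cross_apply {n : ℕ} (x : BraidGroup n) (p q : ℕ) (t : ℤ) :
    cross n x (p, q, t) = (perm n x p, perm n x q, t + lk x p q) := by
  have key : ∀ p q t, (cross n x (p, q, t)).1 = perm n x p ∧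
      (cross n x (p, q, t)).2.1 = perm n x q ∧
      (cross n x (p, q, t)).2.2 = t + lk x p q := by
    unfold lk
    induction x using induction_left with
    | one => intro p q t; simp
    | mul i x hi ih =>
      intro p q t
      obtain ⟨h1, h2, h3⟩ := ih p q t
      obtain ⟨h4, h5, h6⟩ := ih p q 0
      simp only [map_mul, Equiv.Perm.mul_apply, cross_gen hi, perm_gen hi, crossGen,
        Equiv.coe_fn_mk, h1, h2, h3, h4, h5, true_and]
      ring
    | inv_mul i x hi ih =>
      intro p q t
      obtain ⟨h1, h2, h3⟩ := ih p q t
      obtain ⟨h4, h5, h6⟩ := ih p q 0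
      rw [map_mul, map_mul, Equiv.Perm.mul_apply, Equiv.Perm.mul_apply, Equiv.Perm.mul_apply,
        Equiv.Perm.mul_apply, perm_gen_inv hi, perm_gen_inv hi, map_inv, cross_gen hi]
      simp only [crossGen, Equiv.Perm.inv_def, Equiv.coe_fn_symm_mk, h1, h2, h3, h4, h5, true_and]
      ring
  obtain ⟨h1, h2, h3⟩ := key p q t
  exact Prod.ext h1 (Prod.ext h2 h3)

theorem lk_mul {n : ℕ} (x y : BraidGroup n) (p q : ℕ) :
    lk (x * y) p q = lk y p q + lk x (perm n y p) (perm n y q) := by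
  rw [lk, map_mul, Equiv.Perm.mul_apply, cross_apply, cross_apply]
  simp

@[simp]
theorem lk_one {n : ℕ} (p q : ℕ) : lk (1 : BraidGroup n) p q = 0 := by
  simp [lk]

theorem lk_gen {n i : ℕ} (h : i + 1 < n) (p q : ℕ) : lk (gen n i) p q = adj i p q := by
  simp [lk, cross_gen h, crossGen]

theorem lk_gen_inv {n i : ℕ} (h : i + 1 < n) (p q : ℕ) : lk (gen n i)⁻¹ p q = -adj i p q := by
  have := lk_mul (gen n i) (gen n i)⁻¹ p q
  rw [mul_inv_cancel, lk_one, lk_gen h, perm_gen_inv h, perm_gen_inv h, adj_sw] at this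
  linarith

theorem lk_inv {n : ℕ} (x : BraidGroup n) (p q : ℕ) :
    lk x⁻¹ (perm n x p) (perm n x q) = -lk x p q := by
  have := lk_mul x⁻¹ x p q
  rw [inv_mul_cancel, lk_one] at this
  linarith

theorem perm_lt {n : ℕ} (x : BraidGroup n) {p : ℕ} (hp : p < n) : perm n x p < n := by
  induction x using induction_left generalizing p with
  | one => simpa using hp
  | mul i x hi ih => rw [map_mul, Equiv.Perm.mul_apply, perm_gen hi]; exact sw_lt hi (ih hp)
  | inv_mul i x hi ih =>
    rw [map_mul, Equiv.Perm.mul_apply, perm_gen_inv hi]; exact sw_lt hi (ih hp)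

theorem perm_apply_inv (σ : Equiv.Perm ℕ) (p : ℕ) : σ (σ⁻¹ p) = p := σ.apply_symm_apply p

theorem perm_inv_apply (σ : Equiv.Perm ℕ) (p : ℕ) : σ⁻¹ (σ p) = p := σ.symm_apply_apply p

/-- Conjugation permutes the crossing numbers of a pure braid. -/
theorem lk_conj {n : ℕ} (x z : BraidGroup n) {p q : ℕ} (hp : perm n z p = p)
    (hq : perm n z q = q) : lk (x * z * x⁻¹) (perm n x p) (perm n x q) = lk z p q := by
  rw [lk_mul, lk_mul, lk_inv, ← Equiv.Perm.mul_apply, ← Equiv.Perm.mul_apply, ← map_mul,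
    inv_mul_cancel, map_one, Equiv.Perm.one_apply, Equiv.Perm.one_apply, hp, hq]
  ring

/-- Braids with permutation fixing `p` and `q` have additive crossing numbers. -/
theorem lk_zpow {n : ℕ} (z : BraidGroup n) {p q : ℕ} (hp : perm n z p = p)
    (hq : perm n z q = q) (k : ℤ) : lk (z ^ k) p q = k * lk z p q := by
  have h0 : ∀ k : ℕ, lk (z ^ k) p q = k * lk z p q := by
    intro k
    induction k with
    | zero => simp
    | succ k ih => rw [pow_succ, lk_mul, hp, hq, ih]; push_cast; ring
  obtain ⟨k, rfl | rfl⟩ := k.eq_nat_or_neg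
  · rw [zpow_natCast, h0]
  · have hp' : perm n (z ^ k) p = p := by
      rw [map_pow]; exact Function.IsFixedPt.perm_pow hp k
    have hq' : perm n (z ^ k) q = q := by
      rw [map_pow]; exact Function.IsFixedPt.perm_pow hq k
    have := lk_inv (z ^ k) p q
    rw [hp', hq', h0] at this
    rw [zpow_neg, zpow_natCast, this]; simp

theorem perm_up {n k : ℕ} (hk : k < n) (p : ℕ) :
    perm n (up n k) p = if p < k then p + 1 else if p = k then 0 else p := by
  induction k generalizing p with
  | zero => simp [up]
  | succ k ih =>
    rw [up, map_mul, Equiv.Perm.mul_apply, perm_gen hk, ih (by omega)]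
    grind [sw]

theorem lk_up {n k : ℕ} (hk : k < n) (p q : ℕ) :
    lk (up n k) p q = if (p = k ∧ q < k) ∨ (q = k ∧ p < k) then 1 else 0 := by
  induction k generalizing p q with
  | zero => simp [up]
  | succ k ih =>
    rw [up, lk_mul, perm_gen hk, perm_gen hk, lk_gen hk, ih (by omega)]
    grind [sw, adj]

theorem perm_delta {n k : ℕ} (hk : k ≤ n) (p : ℕ) :
    perm n (delta n k) p = if p < k then k - 1 - p else p := by
  induction k generalizing p with
  | zero => simp [delta]
  | succ k ih =>
    rw [delta, map_mul, Equiv.Perm.mul_apply, ih (by omega), perm_up (by omega)]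
    grind

theorem lk_delta {n k : ℕ} (hk : k ≤ n) (p q : ℕ) :
    lk (delta n k) p q = if p < k ∧ q < k ∧ p ≠ q then 1 else 0 := by
  induction k generalizing p q with
  | zero => simp [delta]
  | succ k ih =>
    rw [delta, lk_mul, ih (by omega), perm_delta (by omega), perm_delta (by omega),
      lk_up (by omega)]
    grind

theorem perm_delta_sq {n k : ℕ} (hk : k ≤ n) (p : ℕ) : perm n (delta n k ^ 2) p = p := by
  rw [pow_two, map_mul, Equiv.Perm.mul_apply, perm_delta hk, perm_delta hk]
  grind

theorem lk_delta_sq {n k : ℕ} (hk : k ≤ n) (p q : ℕ) :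
    lk (delta n k ^ 2) p q = if p < k ∧ q < k ∧ p ≠ q then 2 else 0 := by
  rw [pow_two, lk_mul, lk_delta hk, lk_delta hk, perm_delta hk, perm_delta hk]
  grind

theorem perm_delta_sq_zpow {n k : ℕ} (hk : k ≤ n) (l : ℤ) (p : ℕ) :
    perm n ((delta n k ^ 2) ^ l) p = p := by
  rw [map_zpow]; exact Function.IsFixedPt.perm_zpow (perm_delta_sq hk p) l

theorem lk_delta_sq_zpow {n k : ℕ} (hk : k ≤ n) (l : ℤ) (p q : ℕ) :
    lk ((delta n k ^ 2) ^ l) p q = if p < k ∧ q < k ∧ p ≠ q then 2 * l else 0 := by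
  rw [lk_zpow _ (perm_delta_sq hk p) (perm_delta_sq hk q), lk_delta_sq hk]
  split_ifs <;> ring

/-- A braid that commutes with the full twist on the first `m ≥ 2` of `m + 1` strands fixes the
last strand. -/
theorem perm_last_of_commute {m : ℕ} (hm : 2 ≤ m) {x : BraidGroup (m + 1)}
    (h : Commute x (delta (m + 1) m ^ 2)) : perm (m + 1) x m = m := by
  by_contra hne
  have hlt : perm (m + 1) x m < m := by
    have := perm_lt x (Nat.lt_succ_self m); omega
  -- A second strand among the first `m`, available because `m ≥ 2`. The full twist links it with
  -- the image of the last strand, while the last strand itself is linked with nothing.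
  obtain ⟨p', hp', hne'⟩ : ∃ p', p' < m ∧ p' ≠ perm (m + 1) x m := by
    rcases Nat.eq_zero_or_pos (perm (m + 1) x m) with h0 | h0
    · exact ⟨1, by omega, by omega⟩
    · exact ⟨0, by omega, by omega⟩
  have h1 := lk_conj x (delta (m + 1) m ^ 2) (p := (perm (m + 1) x)⁻¹ p') (q := m)
    (perm_delta_sq (by omega) _) (perm_delta_sq (by omega) _)
  rw [h.eq, mul_inv_cancel_right, perm_apply_inv, lk_delta_sq (by omega),
    lk_delta_sq (by omega), if_pos ⟨hp', hlt, hne'⟩, if_neg (by omega)] at h1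
  omega

/-- In a proper standard parabolic subgroup the last strand does not cross any other. -/
theorem lk_incl_last {r m : ℕ} (hr : r ≤ m) (b : BraidGroup r) :
    perm (m + 1) (incl (by omega) b) m = m ∧
    ∀ p, lk (incl (show r ≤ m + 1 by omega) b) p m = 0 ∧ lk (incl (show r ≤ m + 1 by omega) b) m p = 0 := by
  have hsw : ∀ i, i + 1 < r → sw i m = m := fun i hi => by grind [sw]
  have hadj : ∀ i, i + 1 < r → ∀ p, adj i p m = 0 ∧ adj i m p = 0 := fun i hi p => by grind [adj]
  induction b using induction_left with
  | one => simp
  | mul i x hi ih =>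
    refine ⟨?_, fun p => ?_⟩
    · rw [map_mul, map_mul, Equiv.Perm.mul_apply, ih.1, incl_gen _ hi, perm_gen (by omega),
        hsw i hi]
    · rw [map_mul, lk_mul, lk_mul, (ih.2 p).1, (ih.2 p).2, ih.1, incl_gen _ hi,
        lk_gen (by omega), lk_gen (by omega), (hadj i hi _).1, (hadj i hi _).2]
      simp
  | inv_mul i x hi ih =>
    refine ⟨?_, fun p => ?_⟩
    · rw [map_mul, map_mul, Equiv.Perm.mul_apply, ih.1, map_inv, incl_gen _ hi,
        perm_gen_inv (by omega), hsw i hi]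
    · rw [map_mul, lk_mul, lk_mul, (ih.2 p).1, (ih.2 p).2, ih.1, map_inv, incl_gen _ hi,
        lk_gen_inv (by omega), lk_gen_inv (by omega), (hadj i hi _).1, (hadj i hi _).2]
      simp

/-- Some positive power of a braid is pure. -/
theorem exists_pow_perm {n : ℕ} (x : BraidGroup n) :
    ∃ N, 0 < N ∧ ∀ p < n, perm n (x ^ N) p = p := by
  let σ : Equiv.Perm {p // p < n} := (perm n x).subtypePerm fun p => ⟨fun h => by
    have := perm_lt x⁻¹ h
    rwa [map_inv, perm_inv_apply] at this, fun h => perm_lt x h⟩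
  refine ⟨orderOf σ, orderOf_pos σ, fun p hp => ?_⟩
  have h := DFunLike.congr_fun (pow_orderOf_eq_one σ) ⟨p, hp⟩
  rw [Equiv.Perm.subtypePerm_pow] at h
  rw [map_pow]
  exact congrArg Subtype.val h

/-- A conjugate of an element of a proper standard parabolic subgroup is in no nontrivial
coset of a proper standard parabolic subgroup by a power of the full twist. -/
theorem eq_zero_of_conj {r s m : ℕ} (hm : 1 ≤ m) (hr : r ≤ m) (hs : s ≤ m) (a : BraidGroup r) (b : BraidGroup s)
    (c : BraidGroup (m + 1)) (j : ℤ)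
    (h : c * incl (show r ≤ m + 1 by omega) a * c⁻¹ =
      (delta (m + 1) (m + 1) ^ 2) ^ j * incl (show s ≤ m + 1 by omega) b) : j = 0 := by
  -- Conjugation merely permutes crossing numbers when the braid is pure, so a pure power is used;
  -- this multiplies `j` by `N`.
  obtain ⟨N, hN, hp⟩ := exists_pow_perm (incl (show r ≤ m + 1 by omega) a)
  have hpow : c * incl (show r ≤ m + 1 by omega) (a ^ N) * c⁻¹ =
      (delta (m + 1) (m + 1) ^ 2) ^ (j * N) * incl (show s ≤ m + 1 by omega) (b ^ N) := by
    rw [map_pow, map_pow, ← conj_pow, h, ((delta_sq_central _).zpow_left j).mul_pow,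
      zpow_mul, zpow_natCast]
  rw [← map_pow] at hp
  have hlk : ∀ p, p < m → lk ((delta (m + 1) (m + 1) ^ 2) ^ (j * N) *
      incl (show s ≤ m + 1 by omega) (b ^ N)) p m = 2 * (j * N) := by
    intro p hpm
    have hlt := perm_lt (incl (show s ≤ m + 1 by omega) (b ^ N)) (show p < m + 1 by omega)
    have hne : perm (m + 1) (incl (show s ≤ m + 1 by omega) (b ^ N)) p ≠ m := fun h' => by
      have := (perm (m + 1) (incl (show s ≤ m + 1 by omega) (b ^ N))).injective
        (h'.trans (lk_incl_last hs (b ^ N)).1.symm)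
      omega
    rw [lk_mul, ((lk_incl_last hs (b ^ N)).2 p).1, (lk_incl_last hs (b ^ N)).1,
      lk_delta_sq_zpow le_rfl, if_pos ⟨hlt, by omega, hne⟩, zero_add]
  have hlk' : ∀ p q, p < m + 1 → q < m + 1 → p = m ∨ q = m →
      lk (c * incl (show r ≤ m + 1 by omega) (a ^ N) * c⁻¹) (perm (m + 1) c p)
        (perm (m + 1) c q) = 0 := by
    intro p q hpm hqm hpq
    rw [lk_conj _ _ (hp p hpm) (hp q hqm)]
    rcases hpq with rfl | rfl
    · exact ((lk_incl_last hr _).2 _).2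
    · exact ((lk_incl_last hr _).2 _).1
  have hfin : 2 * (j * (N : ℤ)) = 0 := by
    have hinv : ∀ p, perm (m + 1) c ((perm (m + 1) c)⁻¹ p) = p :=
      fun p => perm_apply_inv _ _
    have hinvlt : ∀ p, p < m + 1 → (perm (m + 1) c)⁻¹ p < m + 1 := fun p h => by
      rw [← map_inv]; exact perm_lt _ h
    -- On the left the strand `perm c m` has crossing number zero with every strand; on the right
    -- the strand `m` has crossing number `2jN` with every other strand. A pair containing both
    -- gives the contradiction unless `j = 0`; if the two strands coincide, strand `0` serves as the
    -- partner.
    by_cases hq : perm (m + 1) c m = m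
    · rw [← hlk 0 (by omega), ← hpow, ← hlk' ((perm (m + 1) c)⁻¹ 0) m (hinvlt _ (by omega))
        (by omega) (Or.inr rfl), hinv, hq]
    · rw [← hlk (perm (m + 1) c m) (by have := perm_lt c (Nat.lt_succ_self m); omega), ← hpow,
        ← hlk' m ((perm (m + 1) c)⁻¹ m) (by omega) (hinvlt _ (by omega)) (Or.inl rfl), hinv]
  simpa [hN.ne'] using hfin

/-- Powers of the full twist on the first `m` strands that commute with `σ_m` are trivial. -/
theorem eq_zero_of_commute_gen {m : ℕ} (hm : 2 ≤ m) (l : ℤ)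
    (h : Commute ((delta (m + 1) m ^ 2) ^ l) (gen (m + 1) (m - 1))) : l = 0 := by
  have h1 := lk_conj (gen (m + 1) (m - 1)) ((delta (m + 1) m ^ 2) ^ l) (p := 0) (q := m)
    (perm_delta_sq_zpow (by omega) _ _) (perm_delta_sq_zpow (by omega) _ _)
  -- Conjugation by σ_m carries the unlinked pair `(0, m)` to the pair `(0, m - 1)`, whose crossing
  -- number is `2l`.
  have h2 : sw (m - 1) 0 = 0 ∨ m = 1 := by grind [sw]
  have h3 : sw (m - 1) m = m - 1 := by grind [sw]
  rw [← h.eq, mul_inv_cancel_right, perm_gen (by omega), perm_gen (by omega),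
    lk_delta_sq_zpow (by omega), lk_delta_sq_zpow (by omega), h3,
    h2.resolve_right (by omega)] at h1
  rw [if_pos (by omega), if_neg (by omega)] at h1
  omega

/-! ### Artin's action on the free group -/

/-- The action of the generators on the free group. -/
def artinFun (i j : ℕ) : FreeGroup ℕ :=
  if j = i then (FreeGroup.of i)⁻¹ * FreeGroup.of (i + 1) * FreeGroup.of i
  else if j = i + 1 then FreeGroup.of i else FreeGroup.of j

/-- The action of the inverses of the generators on the free group. -/
def artinInvFun (i j : ℕ) : FreeGroup ℕ :=
  if j = i then FreeGroup.of (i + 1)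
  else if j = i + 1 then FreeGroup.of (i + 1) * FreeGroup.of i * (FreeGroup.of (i + 1))⁻¹
  else FreeGroup.of j

/-- The action of the generators on the free group. -/
def artinGen (i : ℕ) : MulAut (FreeGroup ℕ) :=
  MonoidHom.toMulEquiv (FreeGroup.lift (artinFun i)) (FreeGroup.lift (artinInvFun i))
    (by
      ext j
      by_cases h : j = i
      · subst h; simp [artinFun, artinInvFun, mul_assoc]
      by_cases h' : j = i + 1
      · subst h'; simp [artinFun, artinInvFun]
      · simp [artinFun, artinInvFun, h, h'])
    (by
      ext j
      by_cases h : j = i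
      · subst h; simp [artinFun, artinInvFun]
      by_cases h' : j = i + 1
      · subst h'; simp [artinFun, artinInvFun, mul_assoc]
      · simp [artinFun, artinInvFun, h, h'])

theorem artinGen_of_self (i : ℕ) : artinGen i (FreeGroup.of i) =
    (FreeGroup.of i)⁻¹ * FreeGroup.of (i + 1) * FreeGroup.of i := by
  simp [artinGen, artinFun]

theorem artinGen_of_succ (i : ℕ) : artinGen i (FreeGroup.of (i + 1)) = FreeGroup.of i := by
  simp [artinGen, artinFun]

theorem artinGen_of_ne {i j : ℕ} (h : j ≠ i) (h' : j ≠ i + 1) :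
    artinGen i (FreeGroup.of j) = FreeGroup.of j := by
  simp [artinGen, artinFun, h, h']

theorem artinGen_inv_of (i j : ℕ) : (artinGen i)⁻¹ (FreeGroup.of j) = artinInvFun i j := by
  change (artinGen i).symm (FreeGroup.of j) = _
  simp [artinGen]

theorem mulAut_ext {f g : MulAut (FreeGroup ℕ)}
    (h : ∀ j, f (FreeGroup.of j) = g (FreeGroup.of j)) : f = g := by
  have : f.toMonoidHom = g.toMonoidHom := FreeGroup.ext_hom _ _ h
  exact MulEquiv.ext fun x => DFunLike.congr_fun this x

theorem artinGen_braid (i : ℕ) :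
    artinGen i * artinGen (i + 1) * artinGen i =
      artinGen (i + 1) * artinGen i * artinGen (i + 1) := by
  refine mulAut_ext fun j => ?_
  simp only [MulAut.mul_apply]
  have h1 := artinGen_of_self i
  have h2 := artinGen_of_succ i
  have h3 := artinGen_of_ne (i := i) (j := i + 1 + 1) (by omega) (by omega)
  have h4 := artinGen_of_ne (i := i + 1) (j := i) (by omega) (by omega)
  have h5 := artinGen_of_self (i + 1)
  have h6 := artinGen_of_succ (i + 1)
  by_cases hj : j = i
  · subst hj; simp only [h1, h2, h3, h4, h5, map_mul, map_inv]; group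
  by_cases hj1 : j = i + 1
  · subst hj1; simp only [h1, h2, h3, h4, h5, h6, map_mul, map_inv]
  by_cases hj2 : j = i + 1 + 1
  · subst hj2; simp only [h2, h3, h4, h6]
  · have h7 := artinGen_of_ne hj hj1
    have h8 := artinGen_of_ne hj1 hj2
    rw [h7, h8, h7, h8]

theorem artinGen_comm {i j : ℕ} (h : i + 2 ≤ j) :
    artinGen i * artinGen j = artinGen j * artinGen i := by
  refine mulAut_ext fun k => ?_
  simp only [MulAut.mul_apply]
  have h1 := artinGen_of_self i
  have h2 := artinGen_of_succ i
  have h3 := artinGen_of_self j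
  have h4 := artinGen_of_succ j
  have h5 : ∀ k, k ≤ i + 1 → artinGen j (FreeGroup.of k) = FreeGroup.of k :=
    fun k hk => artinGen_of_ne (by omega) (by omega)
  have h6 : ∀ k, j ≤ k → artinGen i (FreeGroup.of k) = FreeGroup.of k :=
    fun k hk => artinGen_of_ne (by omega) (by omega)
  have h7 := h5 i (by omega)
  have h8 := h5 (i + 1) (by omega)
  have h9 := h6 j (by omega)
  have h10 := h6 (j + 1) (by omega)
  by_cases hk : k = i
  · subst hk; simp only [h1, h7, h8, map_mul, map_inv]
  by_cases hk1 : k = i + 1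
  · subst hk1; simp only [h2, h7, h8]
  by_cases hk2 : k = j
  · subst hk2; simp only [h3, h9, h10, map_mul, map_inv]
  by_cases hk3 : k = j + 1
  · subst hk3; simp only [h4, h9, h10]
  · rw [artinGen_of_ne hk hk1, artinGen_of_ne hk2 hk3, artinGen_of_ne hk hk1]

/-- Artin's action of the braid group on the free group; the generators `x_j` with `j ≥ m` are
fixed. -/
def artin (m : ℕ) : BraidGroup m →* MulAut (FreeGroup ℕ) :=
  lift artinGen (fun i _ => artinGen_braid i) fun _ _ h _ => artinGen_comm h

theorem artin_gen {m i : ℕ} (h : i + 1 < m) : artin m (gen m i) = artinGen i := lift_gen _ _ _ h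

/-- The subgroup of the free group generated by `x_0, …, x_{m-1}`. -/
def initialFree (m : ℕ) : Subgroup (FreeGroup ℕ) :=
  Subgroup.closure {f | ∃ i, i < m ∧ f = FreeGroup.of i}

theorem of_mem_initialFree {m i : ℕ} (h : i < m) : FreeGroup.of i ∈ initialFree m :=
  Subgroup.subset_closure ⟨i, h, rfl⟩

theorem artin_mem_initialFree {m : ℕ} (c : BraidGroup m) {f : FreeGroup ℕ}
    (hf : f ∈ initialFree m) : artin m c f ∈ initialFree m := by
  induction c using induction_left generalizing f with
  | one => simpa using hf
  | mul i x hi ih =>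
    rw [map_mul, MulAut.mul_apply, artin_gen hi]
    refine Subgroup.closure_le (K := (initialFree m).comap (artinGen i).toMonoidHom) |>.2 ?_
      (ih hf)
    rintro _ ⟨j, hj, rfl⟩
    change artinGen i (FreeGroup.of j) ∈ initialFree m
    have h0 := of_mem_initialFree (show i < m by omega)
    have h1 := of_mem_initialFree hi
    by_cases h : j = i
    · rw [h, artinGen_of_self]; exact mul_mem (mul_mem (inv_mem h0) h1) h0
    by_cases h' : j = i + 1
    · rwa [h', artinGen_of_succ]
    · rw [artinGen_of_ne h h']; exact of_mem_initialFree hj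
  | inv_mul i x hi ih =>
    rw [map_mul, MulAut.mul_apply, map_inv, artin_gen hi]
    refine Subgroup.closure_le (K := (initialFree m).comap (artinGen i)⁻¹.toMonoidHom) |>.2 ?_
      (ih hf)
    rintro _ ⟨j, hj, rfl⟩
    change (artinGen i)⁻¹ (FreeGroup.of j) ∈ initialFree m
    have h0 := of_mem_initialFree (show i < m by omega)
    have h1 := of_mem_initialFree hi
    rw [artinGen_inv_of, artinInvFun]
    split_ifs
    · exact h1
    · exact mul_mem (mul_mem h1 h0) (inv_mem h1)
    · exact of_mem_initialFree hj

/-! ### The pure braids of the last strand -/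

/-- The braid `σ_{i+1} ⋯ σ_m` in `B_{m+1}`. -/
def tail (m i : ℕ) : BraidGroup (m + 1) := (up (m + 1) i)⁻¹ * up (m + 1) m

theorem tail_self (m : ℕ) : tail m m = 1 := inv_mul_cancel _

theorem gen_mul_tail (m i : ℕ) : gen (m + 1) i * tail m (i + 1) = tail m i := by
  simp [tail, up, mul_assoc]

theorem tail_comm_gen {m i j : ℕ} (h : j + 1 < i) (hi : i ≤ m) :
    gen (m + 1) j * tail m i = tail m i * gen (m + 1) j := by
  have h1 := up_mul_gen (n := m + 1) h (by omega)
  have h2 := up_mul_gen (n := m + 1) (show j + 1 < m by omega) (by omega)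
  rw [tail, mul_assoc, h2, ← mul_assoc, ← mul_assoc]
  congr 1
  rw [eq_inv_mul_iff_mul_eq, ← mul_assoc, h1, mul_inv_cancel_right]

theorem gen_succ_mul_tail {m i j : ℕ} (h : i ≤ j) (hj : j + 1 < m) :
    gen (m + 1) (j + 1) * tail m i = tail m i * gen (m + 1) j := by
  have h1 := (up_comm_gen (n := m + 1) (show i < j + 1 by omega)).inv_left.eq
  have h2 := up_mul_gen (n := m + 1) (show j + 1 < m by omega) (by omega)
  rw [tail, mul_assoc, h2, ← mul_assoc, ← mul_assoc, h1]

/-- The pure braid in which the last strand runs once around the strand at the position `i`;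
trivial for `i ≥ m`. -/
def pureGen (m i : ℕ) : BraidGroup (m + 1) :=
  if i < m then (tail m (i + 1))⁻¹ * gen (m + 1) i ^ 2 * tail m (i + 1) else 1

theorem pureGen_of_lt {m i : ℕ} (h : i < m) :
    pureGen m i = (tail m (i + 1))⁻¹ * gen (m + 1) i ^ 2 * tail m (i + 1) := if_pos h

theorem gen_mul_pureGen_of_ne {m i j : ℕ} (hj : j + 1 < m) (h : i ≠ j) (h' : i ≠ j + 1) :
    Commute (gen (m + 1) j) (pureGen m i) := by
  by_cases hi : i < m
  · rw [pureGen_of_lt hi]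
    rcases Nat.lt_or_ge i j with hij | hij
    · have h1 := gen_succ_mul_tail (show i + 1 ≤ j by omega) hj
      have h2 := (gen_comm (n := m + 1) (show i + 2 ≤ j + 1 by omega)).symm.pow_right 2
      have h3 : gen (m + 1) j =
          (tail m (i + 1))⁻¹ * gen (m + 1) (j + 1) * ((tail m (i + 1))⁻¹)⁻¹ := by
        rw [mul_assoc, inv_inv, h1, inv_mul_cancel_left]
      have h4 := (Commute.conj_iff (tail m (i + 1))⁻¹).2 h2
      rwa [← h3, inv_inv] at h4
    · have h1 : Commute _ _ := tail_comm_gen (show j + 1 < i + 1 by omega) hi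
      exact (h1.inv_right.mul_right ((gen_comm (by omega)).pow_right 2)).mul_right h1
  · rw [pureGen, if_neg hi]; exact Commute.one_right _

theorem gen_mul_pureGen_succ {m j : ℕ} (hj : j + 1 < m) :
    gen (m + 1) j * pureGen m (j + 1) = pureGen m j * gen (m + 1) j := by
  rw [pureGen_of_lt hj, pureGen_of_lt (show j < m by omega), ← gen_mul_tail m (j + 1)]
  have h1 : Commute _ _ := tail_comm_gen (show j + 1 < j + 2 by omega) hj
  have h2 := gen_braid (n := m + 1) (i := j) (by omega)
  set s := gen (m + 1) j
  set t := gen (m + 1) (j + 1)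
  set u := tail m (j + 2)
  have h3 : s * t ^ 2 = t⁻¹ * s ^ 2 * t * s := by
    rw [mul_assoc, mul_assoc, eq_inv_mul_iff_mul_eq, pow_two, pow_two]
    calc t * (s * (t * t)) = (t * s * t) * t := by simp only [mul_assoc]
      _ = (s * t * s) * t := by rw [h2]
      _ = s * (t * s * t) := by simp only [mul_assoc]
      _ = s * (s * t * s) := by rw [h2]
      _ = _ := by simp only [mul_assoc]
  calc s * (u⁻¹ * t ^ 2 * u) = u⁻¹ * (s * t ^ 2) * u := by
        rw [← mul_assoc, ← mul_assoc, h1.inv_right.eq]; simp only [mul_assoc]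
    _ = u⁻¹ * t⁻¹ * s ^ 2 * t * (s * u) := by rw [h3]; simp only [mul_assoc]
    _ = _ := by rw [h1.eq, mul_inv_rev]; simp only [mul_assoc]

theorem gen_mul_pureGen_self {m j : ℕ} (hj : j + 1 < m) :
    gen (m + 1) j * pureGen m j =
      (pureGen m j)⁻¹ * pureGen m (j + 1) * pureGen m j * gen (m + 1) j := by
  have h1 := gen_mul_pureGen_succ hj
  have h2 := gen_braid (n := m + 1) (i := j) (by omega)
  have h4 : Commute _ _ := tail_comm_gen (show j + 1 < j + 2 by omega) hj
  rw [mul_assoc, mul_assoc, eq_inv_mul_iff_mul_eq, ← h1, ← mul_assoc, ← h1]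
  rw [← mul_left_inj (gen (m + 1) j), mul_assoc _ (pureGen m j), ← h1, pureGen_of_lt hj]
  set s := gen (m + 1) j
  set t := gen (m + 1) (j + 1)
  set u := tail m (j + 2)
  have h3 : s * t ^ 2 * s * t ^ 2 = t ^ 2 * s * t ^ 2 * s := by
    calc s * t ^ 2 * s * t ^ 2 = s * t * (t * s * t) * t := by simp only [pow_two, mul_assoc]
      _ = s * t * (s * t * s) * t := by rw [h2]
      _ = (s * t * s) * (t * s * t) := by simp only [mul_assoc]
      _ = (t * s * t) * (s * t * s) := by rw [h2]
      _ = t * (s * t * s) * t * s := by simp only [mul_assoc]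
      _ = t * (t * s * t) * t * s := by rw [h2]
      _ = _ := by simp only [pow_two, mul_assoc]
  have h5 : s = u⁻¹ * s * u := by rw [mul_assoc, h4.eq, inv_mul_cancel_left]
  calc s * (u⁻¹ * t ^ 2 * u) * (s * (u⁻¹ * t ^ 2 * u))
      = u⁻¹ * (s * t ^ 2 * s * t ^ 2) * u := by
        conv_lhs => rw [h5]
        group
    _ = u⁻¹ * (t ^ 2 * s * t ^ 2 * s) * u := by rw [h3]
    _ = _ := by
        conv_rhs => rw [h5]
        group

/-- The homomorphism from the free group to the pure braids of the last strand. -/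
def pureHom (m : ℕ) : FreeGroup ℕ →* BraidGroup (m + 1) := FreeGroup.lift (pureGen m)

@[simp]
theorem pureHom_of (m i : ℕ) : pureHom m (FreeGroup.of i) = pureGen m i := by simp [pureHom]

/-- The three conjugation formulas for `pureGen` are exactly Artin's formulas for the letters;
`artinFun` is chosen to match them. -/
theorem pureHom_artinGen {m j : ℕ} (hj : j + 1 < m) (f : FreeGroup ℕ) :
    pureHom m (artinGen j f) = gen (m + 1) j * pureHom m f * (gen (m + 1) j)⁻¹ := by
  have : (pureHom m).comp (artinGen j).toMonoidHom =
      (MulAut.conj (gen (m + 1) j)).toMonoidHom.comp (pureHom m) := by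
    ext i
    change pureHom m (artinGen j (FreeGroup.of i)) =
      gen (m + 1) j * pureHom m (FreeGroup.of i) * (gen (m + 1) j)⁻¹
    rw [eq_mul_inv_iff_mul_eq, pureHom_of]
    by_cases h : i = j
    · rw [h, gen_mul_pureGen_self hj, artinGen_of_self]; simp
    by_cases h' : i = j + 1
    · rw [h', gen_mul_pureGen_succ hj, artinGen_of_succ, pureHom_of]
    · rw [artinGen_of_ne h h', (gen_mul_pureGen_of_ne hj h h').eq, pureHom_of]
  exact DFunLike.congr_fun this f

theorem pureHom_artin {m : ℕ} (c : BraidGroup m) (f : FreeGroup ℕ) :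
    pureHom m (artin m c f) =
      incl (Nat.le_succ m) c * pureHom m f * (incl (Nat.le_succ m) c)⁻¹ := by
  induction c using induction_left generalizing f with
  | one => simp
  | mul i x hi ih =>
    rw [map_mul, MulAut.mul_apply, artin_gen hi, pureHom_artinGen hi, ih, map_mul, incl_gen _ hi]
    group
  | inv_mul i x hi ih =>
    have h := pureHom_artinGen hi ((artinGen i)⁻¹ (artin m x f))
    rw [MulAut.apply_inv_self, ih] at h
    rw [map_mul, MulAut.mul_apply, map_inv, artin_gen hi, map_mul, map_inv, incl_gen _ hi]
    set y := (artinGen i)⁻¹ (artin m x f)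
    calc pureHom m y = (gen (m + 1) i)⁻¹ * (gen (m + 1) i * pureHom m y * (gen (m + 1) i)⁻¹) *
          gen (m + 1) i := by group
      _ = _ := by rw [← h]; group

/-! ### The stabilizer of the last strand -/

/-- The semidirect product of the free group with the braid group on `m` strands. -/
abbrev ArtinProduct (m : ℕ) : Type := FreeGroup ℕ ⋊[artin m] BraidGroup m

open SemidirectProduct

theorem inr_gen_mul_inl {m i : ℕ} (h : i + 1 < m) (f : FreeGroup ℕ) :
    (inr (gen m i) * inl f : ArtinProduct m) = inl (artinGen i f) * inr (gen m i) := by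
  rw [← artin_gen h, inl_aut, map_inv, inv_mul_cancel_right]

/-- The action of a generator on the cosets of the stabilizer of the last strand. -/
def cosetFun (m j : ℕ) (y : ℕ × ArtinProduct m) : ℕ × ArtinProduct m :=
  if y.1 = j then (j + 1, inl (FreeGroup.of j) * y.2)
  else if y.1 = j + 1 then (j, y.2)
  else if y.1 < j then (y.1, inr (gen m (j - 1)) * y.2)
  else if y.1 ≤ m then (y.1, inr (gen m j) * y.2)
  else y

/-- The inverse of `cosetFun`. -/
def cosetInvFun (m j : ℕ) (y : ℕ × ArtinProduct m) : ℕ × ArtinProduct m :=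
  if y.1 = j + 1 then (j, (inl (FreeGroup.of j))⁻¹ * y.2)
  else if y.1 = j then (j + 1, y.2)
  else if y.1 < j then (y.1, (inr (gen m (j - 1)))⁻¹ * y.2)
  else if y.1 ≤ m then (y.1, (inr (gen m j))⁻¹ * y.2)
  else y

section cosetFun

variable {m j i : ℕ} (g : ArtinProduct m)

theorem cosetFun_self : cosetFun m j (j, g) = (j + 1, inl (FreeGroup.of j) * g) := if_pos rfl

theorem cosetFun_succ : cosetFun m j (j + 1, g) = (j, g) := by simp [cosetFun]

theorem cosetFun_lt (h : i < j) : cosetFun m j (i, g) = (i, inr (gen m (j - 1)) * g) := by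
  simp [cosetFun, h, h.ne, (show i ≠ j + 1 by omega)]

theorem cosetFun_gt (h : j + 1 < i) (hi : i ≤ m) :
    cosetFun m j (i, g) = (i, inr (gen m j) * g) := by
  simp [cosetFun, h.ne', hi, (show i ≠ j by omega), (show ¬ i < j by omega)]

theorem cosetFun_of_lt (h : j + 1 < i) (hi : m < i) : cosetFun m j (i, g) = (i, g) := by
  simp [cosetFun, h.ne', (show i ≠ j by omega), (show ¬ i < j by omega),
    (show ¬ i ≤ m by omega)]

end cosetFun

theorem cosetInvFun_cosetFun (m j : ℕ) (y : ℕ × ArtinProduct m) :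
    cosetInvFun m j (cosetFun m j y) = y := by
  obtain ⟨i, g⟩ := y
  by_cases h : i = j
  · subst h; simp [cosetFun, cosetInvFun]
  by_cases h1 : i = j + 1
  · subst h1; simp [cosetFun, cosetInvFun]
  by_cases h2 : i < j
  · simp [cosetFun, cosetInvFun, h, h1, h2]
  by_cases h3 : i ≤ m <;> simp [cosetFun, cosetInvFun, h, h1, h2, h3]

theorem cosetFun_cosetInvFun (m j : ℕ) (y : ℕ × ArtinProduct m) :
    cosetFun m j (cosetInvFun m j y) = y := by
  obtain ⟨i, g⟩ := y
  by_cases h : i = j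
  · subst h; simp [cosetFun, cosetInvFun]
  by_cases h1 : i = j + 1
  · subst h1; simp [cosetFun, cosetInvFun]
  by_cases h2 : i < j
  · simp [cosetFun, cosetInvFun, h, h1, h2]
  by_cases h3 : i ≤ m <;> simp [cosetFun, cosetInvFun, h, h1, h2, h3]

/-- The rules of `cosetFun` record left multiplication by σ_{j+1} on products `tail m i * y` with
`y` in the stabilizer of the last strand: the index `i` moves only if `i = j` or `i = j + 1`, and a
factor `pureGen m j` appears when it moves up. Here the relations must be verified by hand, since
they are what makes the uniqueness of such products provable. -/
theorem cosetFun_braid {m j : ℕ} (hj : j + 2 < m + 1) (y : ℕ × ArtinProduct m) :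
    cosetFun m j (cosetFun m (j + 1) (cosetFun m j y)) =
      cosetFun m (j + 1) (cosetFun m j (cosetFun m (j + 1) y)) := by
  obtain ⟨i, g⟩ := y
  have hs := inr_gen_mul_inl (show j + 1 < m by omega)
  have hj1 : j + 1 - 1 = j := rfl
  rcases lt_trichotomy i j with h | rfl | h
  · obtain ⟨k, rfl⟩ : ∃ k, j = k + 1 := ⟨j - 1, by omega⟩
    simp (disch := omega) only [cosetFun_lt, ← mul_assoc, ← map_mul, hj1, Nat.add_sub_cancel]
    rw [gen_braid (show k + 2 < m by omega)]
  · have h1 := hs (FreeGroup.of (i + 1) * FreeGroup.of i)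
    rw [map_mul (artinGen i), artinGen_of_self, artinGen_of_succ, ← mul_assoc, ← mul_assoc,
      mul_inv_cancel, one_mul] at h1
    simp (disch := omega) only [cosetFun_self, cosetFun_lt, cosetFun_gt, hj1, ← mul_assoc]
    rw [mul_assoc (inr _), ← map_mul, h1, map_mul, mul_assoc]
  rcases Nat.lt_or_ge (j + 2) i with h1 | h1
  · by_cases hi : i ≤ m
    · simp (disch := omega) only [cosetFun_gt, ← mul_assoc, ← map_mul]
      rw [gen_braid (show j + 2 < m by omega)]
    · simp (disch := omega) only [cosetFun_of_lt]
  rcases (show i = j + 1 ∨ i = j + 1 + 1 by omega) with rfl | rfl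
  · simp (disch := omega) only [cosetFun_self, cosetFun_lt, cosetFun_gt, cosetFun_succ, hj1,
      ← mul_assoc, hs, artinGen_of_succ]
  · simp (disch := omega) only [cosetFun_lt, cosetFun_gt, cosetFun_succ, hj1]

theorem cosetFun_comm {m j k : ℕ} (h : j + 2 ≤ k) (hk : k + 1 < m + 1) (y : ℕ × ArtinProduct m) :
    cosetFun m j (cosetFun m k y) = cosetFun m k (cosetFun m j y) := by
  obtain ⟨i, g⟩ := y
  have hj := inr_gen_mul_inl (show j + 1 < m by omega)
  have hk' := inr_gen_mul_inl (show (k - 1) + 1 < m by omega)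
  rcases lt_trichotomy i j with h1 | rfl | h1
  · simp (disch := omega) only [cosetFun_lt, ← mul_assoc, ← map_mul]
    rw [(gen_comm (show j - 1 + 2 ≤ k - 1 by omega)).eq]
  · simp (disch := omega) only [cosetFun_lt, cosetFun_self, ← mul_assoc, hk']
    rw [artinGen_of_ne (by omega) (by omega)]
  rcases Nat.eq_or_lt_of_le (Nat.succ_le_of_lt h1) with rfl | h1
  · simp (disch := omega) only [Nat.succ_eq_add_one, cosetFun_lt, cosetFun_succ]
  rcases lt_trichotomy i k with h2 | rfl | h2
  · simp (disch := omega) only [cosetFun_lt, cosetFun_gt, ← mul_assoc, ← map_mul]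
    rw [(gen_comm (show j + 2 ≤ k - 1 by omega)).eq]
  · simp (disch := omega) only [cosetFun_gt, cosetFun_self, ← mul_assoc, hj]
    rw [artinGen_of_ne (by omega) (by omega)]
  rcases Nat.eq_or_lt_of_le (Nat.succ_le_of_lt h2) with rfl | h2
  · simp (disch := omega) only [Nat.succ_eq_add_one, cosetFun_gt, cosetFun_succ]
  by_cases hi : i ≤ m
  · simp (disch := omega) only [cosetFun_gt, ← mul_assoc, ← map_mul]
    rw [(gen_comm h).eq]
  · simp (disch := omega) only [cosetFun_of_lt]

/-- The action of the braid group on the cosets of the stabilizer of the last strand, with values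
in the semidirect product. -/
def cosetAction (m : ℕ) : BraidGroup (m + 1) →* Equiv.Perm (ℕ × ArtinProduct m) :=
  lift (fun j => ⟨cosetFun m j, cosetInvFun m j, cosetInvFun_cosetFun m j, cosetFun_cosetInvFun m j⟩)
    (fun _ hi => Equiv.ext (cosetFun_braid hi)) (fun _ _ h hk => Equiv.ext (cosetFun_comm h hk))

theorem cosetAction_gen {m j : ℕ} (h : j < m) (y : ℕ × ArtinProduct m) :
    cosetAction m (gen (m + 1) j) y = cosetFun m j y := by
  rw [cosetAction, lift_gen _ _ _ (by omega)]; rfl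

theorem cosetAction_tail {m i : ℕ} (hi : i ≤ m) (g : ArtinProduct m) :
    cosetAction m (tail m i) (m, g) = (i, g) := by
  induction hi using Nat.decreasingInduction with
  | self => rw [tail_self, map_one]; rfl
  | of_succ i hi ih =>
    rw [← gen_mul_tail, map_mul, Equiv.Perm.mul_apply, ih, cosetAction_gen hi, cosetFun_succ]

theorem cosetAction_pureGen {m i : ℕ} (hi : i < m) (g : ArtinProduct m) :
    cosetAction m (pureGen m i) (m, g) = (m, inl (FreeGroup.of i) * g) := by
  rw [pureGen_of_lt hi, mul_assoc, map_mul, map_inv, Equiv.Perm.mul_apply,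
    Equiv.Perm.inv_eq_iff_eq, cosetAction_tail hi, map_mul, Equiv.Perm.mul_apply,
    cosetAction_tail hi, pow_two, map_mul, Equiv.Perm.mul_apply, cosetAction_gen hi,
    cosetAction_gen hi, Nat.succ_eq_add_one, cosetFun_succ, cosetFun_self]

theorem cosetAction_pureHom {m : ℕ} {f : FreeGroup ℕ} (hf : f ∈ initialFree m)
    (g : ArtinProduct m) : cosetAction m (pureHom m f) (m, g) = (m, inl f * g) := by
  induction hf using Subgroup.closure_induction generalizing g with
  | mem x hx => obtain ⟨i, hi, rfl⟩ := hx; rw [pureHom_of, cosetAction_pureGen hi]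
  | one => simp
  | mul x y _ _ ihx ihy =>
    rw [map_mul, map_mul, Equiv.Perm.mul_apply, ihy, ihx, map_mul, mul_assoc]
  | inv x _ ih =>
    rw [map_inv, map_inv, Equiv.Perm.inv_eq_iff_eq, ih, map_inv, mul_inv_cancel_left]

theorem cosetAction_incl {m : ℕ} (c : BraidGroup m) (g : ArtinProduct m) :
    cosetAction m (incl (Nat.le_succ m) c) (m, g) = (m, inr c * g) := by
  induction c using induction_left generalizing g with
  | one => simp
  | mul i x hi ih =>
    rw [map_mul, map_mul, Equiv.Perm.mul_apply, ih, incl_gen _ hi, cosetAction_gen (by omega),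
      cosetFun_gt _ hi le_rfl, map_mul, mul_assoc]
  | inv_mul i x hi ih =>
    rw [map_mul, map_mul, Equiv.Perm.mul_apply, ih, map_inv, map_inv, incl_gen _ hi,
      Equiv.Perm.inv_eq_iff_eq, cosetAction_gen (by omega), cosetFun_gt _ hi le_rfl, map_mul,
      map_inv, mul_assoc, mul_inv_cancel_left]

/-- Both braids are applied to the base point `(m, 1)` of the coset action; the image has second
component `inl f * inr c`, from which `f` and `c` are recovered. -/
theorem pureHom_mul_incl_inj {m : ℕ} {f f' : FreeGroup ℕ} (hf : f ∈ initialFree m)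
    (hf' : f' ∈ initialFree m) {c c' : BraidGroup m}
    (h : pureHom m f * incl (Nat.le_succ m) c = pureHom m f' * incl (Nat.le_succ m) c') :
    f = f' ∧ c = c' := by
  have h1 := congrArg (fun x => (cosetAction m x (m, 1)).2) h
  simp only [map_mul, Equiv.Perm.mul_apply, cosetAction_incl, cosetAction_pureHom hf,
    cosetAction_pureHom hf', mul_one] at h1
  exact ⟨by simpa using congrArg SemidirectProduct.left h1,
    by simpa using congrArg SemidirectProduct.right h1⟩

theorem pureHom_injOn {m : ℕ} {f f' : FreeGroup ℕ} (hf : f ∈ initialFree m)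
    (hf' : f' ∈ initialFree m) (h : pureHom m f = pureHom m f') : f = f' :=
  (pureHom_mul_incl_inj hf hf' (c := 1) (c' := 1) (by rw [h])).1

theorem incl_succ_injective (m : ℕ) : Function.Injective (incl (Nat.le_succ m)) := fun c c' h =>
  (pureHom_mul_incl_inj (one_mem _) (one_mem _) (by rw [h])).2

theorem gen_mul_pureHom {m j : ℕ} (hj : j + 1 < m) {f : FreeGroup ℕ} (hf : f ∈ initialFree m) :
    ∃ f' ∈ initialFree m, gen (m + 1) j * pureHom m f = pureHom m f' * gen (m + 1) j :=
  ⟨_, artin_mem_initialFree (gen m j) hf, by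
    rw [pureHom_artin, incl_gen _ hj, inv_mul_cancel_right]⟩

theorem gen_inv_mul_pureHom {m j : ℕ} (hj : j + 1 < m) {f : FreeGroup ℕ}
    (hf : f ∈ initialFree m) :
    ∃ f' ∈ initialFree m, (gen (m + 1) j)⁻¹ * pureHom m f = pureHom m f' * (gen (m + 1) j)⁻¹ :=
  ⟨_, artin_mem_initialFree (gen m j)⁻¹ hf, by
    rw [pureHom_artin, map_inv, incl_gen _ hj, inv_mul_cancel_right]⟩

/-- The braids `tail m i` represent the cosets of the stabilizer of the last strand. The set of all
such products contains 1 and is stable under left multiplication by generators and their inverses,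
by the same rules as in `cosetFun`. -/
theorem exists_tail_mul {m : ℕ} (b : BraidGroup (m + 1)) :
    ∃ i ≤ m, ∃ f ∈ initialFree m, ∃ c : BraidGroup m,
      b = tail m i * (pureHom m f * incl (Nat.le_succ m) c) := by
  induction b using induction_left with
  | one => exact ⟨m, le_rfl, 1, one_mem _, 1, by simp [tail_self]⟩
  | mul j x hj ih =>
    obtain ⟨i, hi, f, hf, c, rfl⟩ := ih
    rcases lt_trichotomy i j with h | rfl | h
    · obtain ⟨k, rfl⟩ : ∃ k, j = k + 1 := ⟨j - 1, by omega⟩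
      obtain ⟨f', hf', h'⟩ := gen_mul_pureHom (show k + 1 < m by omega) hf
      refine ⟨i, hi, f', hf', gen m k * c, ?_⟩
      rw [← mul_assoc, gen_succ_mul_tail (by omega) (by omega), map_mul,
        incl_gen _ (by omega), mul_assoc, ← mul_assoc (gen _ _), h', mul_assoc]
    · refine ⟨i + 1, by omega, FreeGroup.of i * f,
        mul_mem (of_mem_initialFree (by omega)) hf, c, ?_⟩
      rw [map_mul, pureHom_of, pureGen_of_lt (by omega), ← gen_mul_tail, pow_two]
      group
    rcases Nat.eq_or_lt_of_le (Nat.succ_le_of_lt h) with rfl | h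
    · exact ⟨j, by omega, f, hf, c, by rw [← mul_assoc, Nat.succ_eq_add_one, gen_mul_tail]⟩
    · obtain ⟨f', hf', h'⟩ := gen_mul_pureHom (show j + 1 < m by omega) hf
      refine ⟨i, hi, f', hf', gen m j * c, ?_⟩
      rw [← mul_assoc, tail_comm_gen h hi, map_mul,
        incl_gen _ (by omega), mul_assoc, ← mul_assoc (gen _ _), h', mul_assoc]
  | inv_mul j x hj ih =>
    obtain ⟨i, hi, f, hf, c, rfl⟩ := ih
    rcases lt_trichotomy i j with h | rfl | h
    · obtain ⟨k, rfl⟩ : ∃ k, j = k + 1 := ⟨j - 1, by omega⟩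
      obtain ⟨f', hf', h'⟩ := gen_inv_mul_pureHom (show k + 1 < m by omega) hf
      refine ⟨i, hi, f', hf', (gen m k)⁻¹ * c, ?_⟩
      have h1 := gen_succ_mul_tail (show i ≤ k by omega) (show k + 1 < m by omega)
      rw [inv_mul_eq_iff_eq_mul, ← mul_assoc (gen _ _), h1, map_mul, map_inv,
        incl_gen _ (by omega), ← mul_assoc (pureHom m f'), ← h']
      group
    · exact ⟨i + 1, by omega, f, hf, c, by rw [← gen_mul_tail]; group⟩
    rcases Nat.eq_or_lt_of_le (Nat.succ_le_of_lt h) with rfl | h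
    · refine ⟨j, by omega, (FreeGroup.of j)⁻¹ * f,
        mul_mem (inv_mem (of_mem_initialFree (by omega))) hf, c, ?_⟩
      rw [map_mul, map_inv, pureHom_of, pureGen_of_lt (by omega), ← gen_mul_tail m j, pow_two,
        Nat.succ_eq_add_one]
      group
    · obtain ⟨f', hf', h'⟩ := gen_inv_mul_pureHom (show j + 1 < m by omega) hf
      refine ⟨i, hi, f', hf', (gen m j)⁻¹ * c, ?_⟩
      have h1 := tail_comm_gen h hi
      rw [inv_mul_eq_iff_eq_mul, ← mul_assoc (gen _ _), h1, map_mul, map_inv,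
        incl_gen _ (by omega), ← mul_assoc (pureHom m f'), ← h']
      group

theorem perm_tail {m i : ℕ} (hi : i ≤ m) : perm (m + 1) (tail m i) m = i := by
  rw [tail, map_mul, map_inv, Equiv.Perm.mul_apply, Equiv.Perm.inv_eq_iff_eq,
    perm_up (by omega), perm_up (by omega)]
  simp

theorem perm_pureGen (m i p : ℕ) : perm (m + 1) (pureGen m i) p = p := by
  by_cases hi : i < m
  · rw [pureGen_of_lt hi, mul_assoc, map_mul, map_inv, Equiv.Perm.mul_apply,
      Equiv.Perm.inv_eq_iff_eq, map_mul, Equiv.Perm.mul_apply, pow_two, map_mul,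
      Equiv.Perm.mul_apply, perm_gen (by omega), perm_gen (by omega), sw_sw]
  · rw [pureGen, if_neg hi]; simp

theorem perm_pureHom (m : ℕ) (f : FreeGroup ℕ) : perm (m + 1) (pureHom m f) = 1 := by
  have : (perm (m + 1)).comp (pureHom m) = 1 := by
    ext i p
    simp [perm_pureGen]
  exact DFunLike.congr_fun this f

/-- A braid that fixes the last strand is the product of a pure braid of the last strand and a
braid on the other strands. -/
theorem exists_of_perm_last {m : ℕ} {b : BraidGroup (m + 1)} (h : perm (m + 1) b m = m) :
    ∃ f ∈ initialFree m, ∃ c : BraidGroup m, b = pureHom m f * incl (Nat.le_succ m) c := by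
  obtain ⟨i, hi, f, hf, c, rfl⟩ := exists_tail_mul b
  have h1 : perm (m + 1) (incl (Nat.le_succ m) c) m = m := (lk_incl_last le_rfl c).1
  rw [map_mul, map_mul, Equiv.Perm.mul_apply, Equiv.Perm.mul_apply, h1, perm_pureHom,
    Equiv.Perm.one_apply, perm_tail hi] at h
  subst h
  exact ⟨f, hf, c, by rw [tail_self, one_mul]⟩

/-! ### Fixed points of partial conjugations of free groups -/

section Fox

variable {α : Type*}

/-- The left multiplication on the free module on the product of the free group with `α`. -/
noncomputable def foxAct (g : FreeGroup α) : (FreeGroup α × α →₀ ℤ) ≃+ (FreeGroup α × α →₀ ℤ) :=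
  Finsupp.domCongr ((Equiv.mulLeft g).prodCongr (Equiv.refl α))

theorem foxAct_single (g u : FreeGroup α) (j : α) (n : ℤ) :
    foxAct g (Finsupp.single (u, j) n) = Finsupp.single (g * u, j) n := by
  simp [foxAct, Finsupp.domCongr, Finsupp.equivMapDomain_single]

theorem foxAct_mul (g h : FreeGroup α) (m : FreeGroup α × α →₀ ℤ) :
    foxAct (g * h) m = foxAct g (foxAct h m) := by
  induction m using Finsupp.induction_linear with
  | zero => simp
  | add x y hx hy => simp only [map_add, hx, hy]
  | single x n => obtain ⟨u, j⟩ := x; simp only [foxAct_single, mul_assoc]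

theorem foxAct_one (m : FreeGroup α × α →₀ ℤ) : foxAct 1 m = m := by
  induction m using Finsupp.induction_linear with
  | zero => simp
  | add x y hx hy => simp only [map_add, hx, hy]
  | single x n => obtain ⟨u, j⟩ := x; simp only [foxAct_single, one_mul]

/-- The affine action of the free group whose translation part is given by the Fox derivatives with
respect to the letters in `J`. -/
noncomputable def foxAffine (J : Set α) [DecidablePred (· ∈ J)] :
    FreeGroup α →* Equiv.Perm (FreeGroup α × α →₀ ℤ) :=
  FreeGroup.lift fun i => (foxAct (FreeGroup.of i)).toEquiv.trans
    (Equiv.addRight (if i ∈ J then Finsupp.single (1, i) 1 else 0))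

/-- The Fox derivatives with respect to the letters in `J`. -/
noncomputable def fox (J : Set α) [DecidablePred (· ∈ J)] (w : FreeGroup α) :
    FreeGroup α × α →₀ ℤ := foxAffine J w 0

variable (J : Set α) [DecidablePred (· ∈ J)]

/-- An affine action evaluated at 0 is a crossed homomorphism. Prescribing the action on letters
therefore yields the Fox derivatives together with their product rule `fox_mul`, with no discussion
of reduced words. -/
theorem foxAffine_apply (w : FreeGroup α) (m : FreeGroup α × α →₀ ℤ) :
    foxAffine J w m = foxAct w m + fox J w := by
  unfold fox
  induction w using FreeGroup.induction_on generalizing m with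
  | C1 => simp [foxAct_one]
  | of i => simp [foxAffine]
  | inv_of i _ =>
    have hA : ∀ x, foxAffine J (FreeGroup.of i) x = foxAct (FreeGroup.of i) x +
        (if i ∈ J then Finsupp.single (1, i) 1 else 0) := fun x => by simp [foxAffine]
    have h : foxAffine J (FreeGroup.of i) ((foxAffine J (FreeGroup.of i))⁻¹ 0) = 0 :=
      (foxAffine J (FreeGroup.of i)).apply_symm_apply 0
    rw [map_inv, Equiv.Perm.inv_eq_iff_eq, hA, map_add, ← foxAct_mul, mul_inv_cancel, foxAct_one,
      add_assoc, ← hA, h, add_zero]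
  | mul x y hx hy =>
    rw [map_mul, Equiv.Perm.mul_apply, Equiv.Perm.mul_apply, hy, hx, hx (foxAffine J y 0),
      map_add, foxAct_mul, add_assoc]

theorem fox_mul (u v : FreeGroup α) : fox J (u * v) = foxAct u (fox J v) + fox J u := by
  rw [fox, map_mul, Equiv.Perm.mul_apply, foxAffine_apply, ← fox]

theorem fox_of (i : α) :
    fox J (FreeGroup.of i) = if i ∈ J then Finsupp.single (1, i) 1 else 0 := by
  simp [fox, foxAffine]

theorem fox_one : fox J 1 = 0 := by simp [fox]

/-- Crossed homomorphisms that agree on the generators are equal. -/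
theorem crossed_ext {M : Type*} [AddCommGroup M] (ρ : FreeGroup α → M →+ M)
    {d e : FreeGroup α → M}
    (hd : ∀ u v, d (u * v) = ρ u (d v) + d u) (he : ∀ u v, e (u * v) = ρ u (e v) + e u)
    (hinj : ∀ u, Function.Injective (ρ u))
    (h : ∀ i, d (FreeGroup.of i) = e (FreeGroup.of i)) (w : FreeGroup α) : d w = e w := by
  have h1 : d 1 = 0 := by
    have := hd 1 1
    rw [mul_one, right_eq_add, map_eq_zero_iff _ (hinj 1)] at this
    exact this
  have h2 : e 1 = 0 := by
    have := he 1 1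
    rw [mul_one, right_eq_add, map_eq_zero_iff _ (hinj 1)] at this
    exact this
  induction w using FreeGroup.induction_on with
  | C1 => rw [h1, h2]
  | of i => exact h i
  | inv_of i _ =>
    have h3 := hd (FreeGroup.of i) (FreeGroup.of i)⁻¹
    have h4 := he (FreeGroup.of i) (FreeGroup.of i)⁻¹
    rw [mul_inv_cancel, h1, h i] at h3
    rw [mul_inv_cancel, h2, h3] at h4
    exact hinj _ (add_right_cancel h4)
  | mul x y hx hy => rw [hd, he, hx, hy]

/-- The fundamental formula of Fox calculus modulo the subgroup `H`: sending the basis element (u,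
j) to [u x_j] - [u] in ℤ[F/H] maps the derivative of `w` to [w] - [1], because the letters outside
`J` contribute nothing. A vanishing derivative thus means that `w` lies in the coset of 1. -/
theorem mem_closure_of_fox_eq_zero {w : FreeGroup α} (hw : fox J w = 0) :
    w ∈ Subgroup.closure {f | ∃ i, i ∉ J ∧ f = FreeGroup.of i} := by
  classical
  set H := Subgroup.closure {f : FreeGroup α | ∃ i, i ∉ J ∧ f = FreeGroup.of i}
  let act : FreeGroup α → (FreeGroup α ⧸ H →₀ ℤ) →+ (FreeGroup α ⧸ H →₀ ℤ) := fun g =>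
    Finsupp.mapDomain.addMonoidHom (g • ·)
  have hact : ∀ g x n, act g (Finsupp.single x n) = Finsupp.single (g • x) n := fun g x n =>
    Finsupp.mapDomain_single
  let T : (FreeGroup α × α →₀ ℤ) →+ (FreeGroup α ⧸ H →₀ ℤ) := Finsupp.liftAddHom fun x =>
    (Finsupp.singleAddHom ((x.1 * FreeGroup.of x.2 : FreeGroup α) : FreeGroup α ⧸ H) :
      ℤ →+ (FreeGroup α ⧸ H →₀ ℤ)) - Finsupp.singleAddHom (x.1 : FreeGroup α ⧸ H)
  have hT : ∀ u j n, T (Finsupp.single (u, j) n) =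
      Finsupp.single ((u * FreeGroup.of j : FreeGroup α) : FreeGroup α ⧸ H) n -
        Finsupp.single (u : FreeGroup α ⧸ H) n := fun u j n => by simp [T]
  have hTact : ∀ g m, T (foxAct g m) = act g (T m) := fun g m => by
    induction m using Finsupp.induction_linear with
    | zero => simp
    | add x y hx hy => simp only [map_add, hx, hy]
    | single x n =>
      obtain ⟨u, j⟩ := x
      simp only [foxAct_single, hT, map_sub, hact, mul_assoc]
      rfl
  have key : T (fox J w) = Finsupp.single (w : FreeGroup α ⧸ H) 1 -
      Finsupp.single ((1 : FreeGroup α) : FreeGroup α ⧸ H) 1 := by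
    refine crossed_ext act (d := fun w => T (fox J w)) (e := fun w : FreeGroup α =>
      Finsupp.single (w : FreeGroup α ⧸ H) 1 -
        Finsupp.single ((1 : FreeGroup α) : FreeGroup α ⧸ H) 1)
      (fun u v => ?_) (fun u v => ?_) (fun u => ?_) (fun i => ?_) w
    · simp only [fox_mul, map_add, hTact]
    · simp only [map_sub, hact]
      rw [show u • ((v : FreeGroup α) : FreeGroup α ⧸ H) = ((u * v : FreeGroup α) : _) from rfl,
        show u • (((1 : FreeGroup α) : FreeGroup α) : FreeGroup α ⧸ H) = (u : _) by
          change ((u * 1 : FreeGroup α) : FreeGroup α ⧸ H) = _; rw [mul_one]]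
      abel
    · exact Finsupp.mapDomain_injective (MulAction.injective u)
    · simp only [fox_of]
      split_ifs with h
      · rw [hT, one_mul]
      · rw [map_zero, eq_comm, sub_eq_zero]
        congr 1
        rw [QuotientGroup.eq, mul_one, inv_mem_iff]
        exact Subgroup.subset_closure ⟨i, h, rfl⟩
  rw [hw, map_zero, eq_comm, sub_eq_zero, Finsupp.single_left_inj one_ne_zero,
    QuotientGroup.eq, mul_one, inv_mem_iff] at key
  exact key

/-- The fixed points of an endomorphism that fixes the letters outside of `J` and conjugates the
letters in `J` by the letter `a` outside of `J`. -/
theorem mem_closure_of_fixed {a : α} (ha : a ∉ J) {τ : FreeGroup α →* FreeGroup α}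
    (hτ : ∀ i, i ∉ J → τ (FreeGroup.of i) = FreeGroup.of i)
    (hτ' : ∀ i, i ∈ J → τ (FreeGroup.of i) =
      (FreeGroup.of a)⁻¹ * FreeGroup.of i * FreeGroup.of a) {w : FreeGroup α} (hw : τ w = w) :
    w ∈ Subgroup.closure {f | ∃ i, i ∉ J ∧ f = FreeGroup.of i} := by
  classical
  apply mem_closure_of_fox_eq_zero
  -- The chain rule for τ: the derivative of a⁻¹ x_j a with respect to the letters in `J` is a⁻¹
  -- times the basis element of x_j, because `a` is outside `J`.
  let Φ : (FreeGroup α × α →₀ ℤ) →+ (FreeGroup α × α →₀ ℤ) :=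
    Finsupp.mapDomain.addMonoidHom fun x => (τ x.1 * (FreeGroup.of a)⁻¹, x.2)
  have hΦ : ∀ u j n, Φ (Finsupp.single (u, j) n) =
      Finsupp.single (τ u * (FreeGroup.of a)⁻¹, j) n := fun u j n => Finsupp.mapDomain_single
  have hΦact : ∀ g m, Φ (foxAct g m) = foxAct (τ g) (Φ m) := fun g m => by
    induction m using Finsupp.induction_linear with
    | zero => simp
    | add x y hx hy => simp only [map_add, hx, hy]
    | single x n => obtain ⟨u, j⟩ := x; simp only [foxAct_single, hΦ, map_mul, mul_assoc]
  have hinv : fox J (FreeGroup.of a)⁻¹ = 0 := by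
    have := fox_mul J (FreeGroup.of a) (FreeGroup.of a)⁻¹
    rw [mul_inv_cancel, fox_one, fox_of, if_neg ha, add_zero, eq_comm] at this
    exact (map_eq_zero_iff _ (foxAct _).injective).1 this
  have key : fox J (τ w) = Φ (fox J w) := by
    refine crossed_ext (fun u => (foxAct (τ u)).toAddMonoidHom) (d := fun w => fox J (τ w))
      (e := fun w => Φ (fox J w)) (fun u v => ?_) (fun u v => ?_)
      (fun u => (foxAct (τ u)).injective) (fun i => ?_) w
    · simp only [map_mul, fox_mul]; rfl
    · simp only [fox_mul, map_add, hΦact]; rfl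
    · by_cases hi : i ∈ J
      · simp only [hτ' i hi, fox_mul, fox_of, if_pos hi, if_neg ha, hinv, map_zero, hΦ, map_one,
          foxAct_single, mul_one, one_mul, zero_add, add_zero]
      · simp only [hτ i hi, fox_of, if_neg hi, map_zero]
  -- The exponent sum in `a` is invariant under τ, so Φ lowers it by exactly one.
  let e : FreeGroup α →* Multiplicative ℤ :=
    FreeGroup.lift fun i => if i = a then Multiplicative.ofAdd 1 else 1
  have heτ : ∀ u, e (τ u) = e u := fun u => by
    have : e.comp τ = e := by
      refine FreeGroup.ext_hom _ _ fun i => ?_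
      by_cases hi : i ∈ J
      · rw [MonoidHom.comp_apply, hτ' i hi, map_mul, map_mul, mul_comm, ← mul_assoc, map_inv,
          mul_inv_cancel, one_mul]
      · rw [MonoidHom.comp_apply, hτ i hi]
    exact DFunLike.congr_fun this u
  by_contra hne
  -- If `w` is fixed, its derivative is fixed by Φ. A term of maximal exponent sum would then be the
  -- image of a term whose exponent sum is larger by one.
  obtain ⟨s, hs, hmax⟩ := Finset.exists_max_image (fox J w).support
    (fun x => Multiplicative.toAdd (e x.1)) (Finsupp.support_nonempty_iff.2 hne)
  rw [hw] at key
  have hs' : s ∈ (Φ (fox J w)).support := by rw [← key]; exact hs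
  obtain ⟨s', hs1, rfl⟩ := Finset.mem_image.1 (Finsupp.mapDomain_support hs')
  have h1 := hmax s' hs1
  simp only [map_mul, heτ, map_inv, toAdd_mul, toAdd_inv] at h1
  have h2 : Multiplicative.toAdd (e (FreeGroup.of a)) = 1 := by simp [e]
  omega

end Fox

/-! ### The loop around the first strands -/

/-- The element `x_{r-1} ⋯ x_0` of the free group. -/
def loop : ℕ → FreeGroup ℕ
  | 0 => 1
  | r + 1 => FreeGroup.of r * loop r

/-- The element `x_k ⋯ x_1` of the free group. -/
def loopTail : ℕ → FreeGroup ℕ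
  | 0 => 1
  | k + 1 => FreeGroup.of (k + 1) * loopTail k

theorem loop_succ (k : ℕ) : loop (k + 1) = loopTail k * FreeGroup.of 0 := by
  induction k with
  | zero => simp [loop, loopTail]
  | succ k ih => rw [loop, ih, loopTail, mul_assoc]

theorem loop_mem_initialFree {r m : ℕ} (h : r ≤ m) : loop r ∈ initialFree m := by
  induction r with
  | zero => exact one_mem _
  | succ r ih => exact mul_mem (of_mem_initialFree h) (ih (by omega))

theorem artinGen_loop_of_le {i r : ℕ} (h : r ≤ i) : artinGen i (loop r) = loop r := by
  induction r with
  | zero => exact map_one _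
  | succ r ih =>
    rw [loop, map_mul, ih (by omega), artinGen_of_ne (by omega) (by omega)]

/-- The product x_{i+1} x_i is fixed by `artinGen i`, and it occurs as a block in the loop; this is
why the indices descend. -/
theorem artinGen_loop {i r : ℕ} (h : i + 1 < r) : artinGen i (loop r) = loop r := by
  induction r with
  | zero => omega
  | succ r ih =>
    rcases Nat.lt_or_ge (i + 1) r with h' | h'
    · rw [loop, map_mul, ih h', artinGen_of_ne (by omega) (by omega)]
    · obtain rfl : r = i + 1 := by omega
      rw [loop, loop, map_mul, map_mul, artinGen_of_self, artinGen_of_succ,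
        artinGen_loop_of_le le_rfl]
      group

/-- Elements fixed by the first generators are fixed by the parabolic subgroup. -/
theorem artin_incl_eq {r m : ℕ} (h : r ≤ m) {f : FreeGroup ℕ}
    (hf : ∀ i, i + 1 < r → artinGen i f = f) (b : BraidGroup r) :
    artin m (incl h b) f = f := by
  induction b using induction_left with
  | one => simp
  | mul i x hi ih =>
    rw [map_mul, map_mul, MulAut.mul_apply, ih, incl_gen _ hi, artin_gen (by omega), hf i hi]
  | inv_mul i x hi ih =>
    rw [map_mul, map_mul, MulAut.mul_apply, ih, map_inv, map_inv, incl_gen _ hi,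
      artin_gen (by omega)]
    nth_rewrite 1 [← hf i hi]
    exact MulAut.inv_apply_self _ _ _

theorem artin_incl_loop {r m : ℕ} (h : r ≤ m) (b : BraidGroup r) :
    artin m (incl h b) (loop r) = loop r :=
  artin_incl_eq h (fun _ hi => artinGen_loop hi) b

theorem artin_incl_of {r m i : ℕ} (h : r ≤ m) (hi : r ≤ i) (b : BraidGroup r) :
    artin m (incl h b) (FreeGroup.of i) = FreeGroup.of i :=
  artin_incl_eq h (fun _ hj => artinGen_of_ne (by omega) (by omega)) b

theorem pureHom_loop_eq {m k : ℕ} (hk : k ≤ m) :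
    pureHom m (loop k) = (tail m k)⁻¹ * (down (m + 1) k * up (m + 1) k) * tail m k := by
  induction k with
  | zero => simp [loop, down, up]
  | succ k ih =>
    rw [loop, map_mul, pureHom_of, pureGen_of_lt hk, ih (by omega), ← gen_mul_tail m k, down, up,
      pow_two]
    group

/-- The loop is the last strand encircling all the others, which is the quotient of two consecutive
full twists. -/
theorem pureHom_loop (m : ℕ) :
    pureHom m (loop m) = delta (m + 1) (m + 1) ^ 2 * (delta (m + 1) m ^ 2)⁻¹ := by
  rw [pureHom_loop_eq le_rfl, tail_self, inv_one, one_mul, mul_one, delta_succ_sq (by omega),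
    mul_inv_cancel_right]

theorem incl_tail {r m i : ℕ} (h : r ≤ m) (hi : i ≤ r) :
    incl (Nat.succ_le_succ h) (tail r i) * tail m r = tail m i := by
  rw [tail, tail, tail, map_mul, map_inv, incl_up _ (by omega), incl_up _ (by omega)]
  group

theorem incl_pureGen {r m i : ℕ} (h : r ≤ m) (hi : i < r) :
    pureGen m i = (tail m r)⁻¹ * incl (Nat.succ_le_succ h) (pureGen r i) * tail m r := by
  rw [pureGen_of_lt (by omega), pureGen_of_lt hi, ← incl_tail h (show i + 1 ≤ r from hi), map_mul,
    map_mul, map_inv, map_pow, incl_gen _ (by omega)]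
  group

theorem tail_comm_delta {r m : ℕ} (h : r ≤ m) : Commute (tail m r) (delta (m + 1) r) := by
  have := mem_centralizer_range (f := incl (show r ≤ m + 1 by omega)) (x := tail m r)
    (fun i hi => by rw [incl_gen _ hi]; exact tail_comm_gen hi h) (delta r r)
  rw [incl_delta _ le_rfl] at this
  exact this.symm

/-- After conjugation by `tail m r` everything happens in B_{r+1}. There Δ_{r+1}² = QΔ_r² is
central, so Δ_r² conjugates in the same way as Q⁻¹, and Q corresponds to the loop. -/
theorem delta_sq_conj_pureGen {r m i : ℕ} (h : r ≤ m) (hi : i < r) :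
    delta (m + 1) r ^ 2 * pureGen m i * (delta (m + 1) r ^ 2)⁻¹ =
      (pureHom m (loop r))⁻¹ * pureGen m i * pureHom m (loop r) := by
  have h1 := (tail_comm_delta h).symm.pow_left 2
  have h2 := delta_sq_comm_incl (Nat.succ_le_succ h) (pureGen r i) le_rfl (Nat.succ_le_succ h)
  rw [delta_succ_sq (by omega)] at h2
  rw [pureHom_loop_eq h, incl_pureGen h hi]
  set y := incl (Nat.succ_le_succ h) (pureGen r i)
  set D := delta (m + 1) r ^ 2
  set t := tail m r
  set Q := down (m + 1) r * up (m + 1) r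
  have h3 : D * y * D⁻¹ = Q⁻¹ * y * Q := by
    rw [mul_inv_eq_iff_eq_mul, mul_assoc, mul_assoc, eq_inv_mul_iff_mul_eq, ← mul_assoc, ← h2.eq]
  calc D * (t⁻¹ * y * t) * D⁻¹ = (D * t⁻¹) * y * (t * D⁻¹) := by group
    _ = t⁻¹ * (D * y * D⁻¹) * t := by
      rw [h1.inv_right.eq, ← h1.inv_left.eq]; group
    _ = _ := by rw [h3]; group

/-- The automorphism is computed inside the braid group, where it is conjugation by the full twist,
and transported back by the injectivity of `pureHom` on `initialFree m`. -/
theorem artin_delta_sq_of_lt {r m i : ℕ} (h : r ≤ m) (hi : i < r) :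
    artin m (delta m r ^ 2) (FreeGroup.of i) =
      (loop r)⁻¹ * FreeGroup.of i * loop r := by
  have h0 : FreeGroup.of i ∈ initialFree m := of_mem_initialFree (by omega)
  have h1 := loop_mem_initialFree h
  refine pureHom_injOn (artin_mem_initialFree _ h0) (mul_mem (mul_mem (inv_mem h1) h0) h1) ?_
  rw [pureHom_artin, map_pow, incl_delta _ h, pureHom_of, delta_sq_conj_pureGen h hi]
  simp

/-- The change of basis of the free group that maps `loop (k + 1)` to `x_0`. -/
def loopBasis (k : ℕ) : FreeGroup ℕ →* FreeGroup ℕ :=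
  FreeGroup.lift fun i => if i = 0 then (loopTail k)⁻¹ * FreeGroup.of 0 else FreeGroup.of i

/-- The inverse of `loopBasis`. -/
def loopBasisInv (k : ℕ) : FreeGroup ℕ →* FreeGroup ℕ :=
  FreeGroup.lift fun i => if i = 0 then loop (k + 1) else FreeGroup.of i

theorem loopBasis_of_ne (k : ℕ) {i : ℕ} (h : i ≠ 0) :
    loopBasis k (FreeGroup.of i) = FreeGroup.of i := by simp [loopBasis, h]

theorem loopBasisInv_of_ne (k : ℕ) {i : ℕ} (h : i ≠ 0) :
    loopBasisInv k (FreeGroup.of i) = FreeGroup.of i := by simp [loopBasisInv, h]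

theorem loopBasisInv_zero (k : ℕ) : loopBasisInv k (FreeGroup.of 0) = loop (k + 1) := by
  simp [loopBasisInv]

theorem loopBasis_loop (k : ℕ) : loopBasis k (loop (k + 1)) = FreeGroup.of 0 := by
  have h : ∀ l, loopBasis k (loopTail l) = loopTail l := fun l => by
    induction l with
    | zero => exact map_one _
    | succ l ih => rw [loopTail, map_mul, ih, loopBasis_of_ne k (by omega)]
  rw [loop_succ, map_mul, h]
  simp [loopBasis]

theorem loopBasisInv_loopBasis (k : ℕ) (w : FreeGroup ℕ) :
    loopBasisInv k (loopBasis k w) = w := by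
  have h : ∀ l, loopBasisInv k (loopTail l) = loopTail l := fun l => by
    induction l with
    | zero => exact map_one _
    | succ l ih => rw [loopTail, map_mul, ih, loopBasisInv_of_ne k (by omega)]
  have : (loopBasisInv k).comp (loopBasis k) = MonoidHom.id _ := by
    ext i
    rcases eq_or_ne i 0 with rfl | hi
    · simp [loopBasis, h, loopBasisInv_zero, loop_succ]
    · simp [loopBasis_of_ne k hi, loopBasisInv_of_ne k hi]
  exact DFunLike.congr_fun this w

/-- The fixed points of the full twist on the first `r` strands in the free group. -/
theorem mem_closure_of_artin_delta_sq {r m : ℕ} (hr : 0 < r) (h : r ≤ m) {f : FreeGroup ℕ}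
    (hf : f ∈ initialFree m) (hfix : artin m (delta m r ^ 2) f = f) :
    f ∈ Subgroup.closure ({loop r} ∪ {x | ∃ i, r ≤ i ∧ i < m ∧ x = FreeGroup.of i}) := by
  obtain ⟨k, rfl⟩ : ∃ k, r = k + 1 := ⟨r - 1, by omega⟩
  have hinv : ∀ i, i ∉ {i : ℕ | 1 ≤ i ∧ i < k + 1} → i ≠ 0 → k + 1 ≤ i := fun i hi h0 => by
    simp only [Set.mem_ofPred_eq, not_and, not_lt] at hi; exact hi (by omega)
  -- In the basis with x_0 replaced by the loop x_k⋯x_0, the full twist fixes x_0 and the x_i with i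
  -- ≥ k + 1 = r, and it conjugates x_1, …, x_k by x_0.
  have h1 := mem_closure_of_fixed {i : ℕ | 1 ≤ i ∧ i < k + 1} (a := 0) (by simp)
    (τ := (loopBasis k).comp ((artin m (delta m (k + 1) ^ 2)).toMonoidHom.comp (loopBasisInv k)))
    (fun i hi => ?_) (fun i hi => ?_) (w := loopBasis k f) ?_
  · have h2 : loopBasisInv k (loopBasis k f) ∈ _ := Subgroup.mem_map_of_mem (loopBasisInv k) h1
    rw [loopBasisInv_loopBasis, MonoidHom.map_closure] at h2
    -- The free group has infinitely many letters, and those with index at least `m` are also fixed.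
    -- This retraction onto `initialFree m` removes them from the generating set.
    let ρ : FreeGroup ℕ →* FreeGroup ℕ :=
      FreeGroup.lift fun i => if i < m then FreeGroup.of i else 1
    have hρ : ∀ w ∈ initialFree m, ρ w = w := fun w hw => by
      have : initialFree m ≤ ρ.eqLocus (MonoidHom.id _) := by
        rw [initialFree, Subgroup.closure_le]
        rintro _ ⟨i, hi, rfl⟩
        change ρ (FreeGroup.of i) = FreeGroup.of i
        simp [ρ, hi]
      exact this hw
    have h3 := Subgroup.mem_map_of_mem ρ h2
    rw [hρ f hf, MonoidHom.map_closure] at h3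
    refine Subgroup.closure_le _ |>.2 ?_ h3
    rintro _ ⟨_, ⟨_, ⟨i, hi, rfl⟩, rfl⟩, rfl⟩
    rcases eq_or_ne i 0 with rfl | h0
    · rw [loopBasisInv_zero, hρ _ (loop_mem_initialFree h)]
      exact Subgroup.subset_closure (Or.inl rfl)
    · rw [loopBasisInv_of_ne k h0]
      by_cases him : i < m
      · rw [hρ _ (of_mem_initialFree him)]
        exact Subgroup.subset_closure (Or.inr ⟨i, hinv i hi h0, him, rfl⟩)
      · have : ρ (FreeGroup.of i) = 1 := by simp [ρ, him]
        rw [this]; exact one_mem _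
  · change loopBasis k (artin m (delta m (k + 1) ^ 2) (loopBasisInv k (FreeGroup.of i))) = _
    have hd : delta m (k + 1) ^ 2 = incl h (delta (k + 1) (k + 1) ^ 2) := by
      rw [map_pow, incl_delta _ le_rfl]
    rcases eq_or_ne i 0 with rfl | h0
    · rw [loopBasisInv_zero, hd, artin_incl_loop, loopBasis_loop]
    · rw [loopBasisInv_of_ne k h0, hd, artin_incl_of h (hinv i hi h0), loopBasis_of_ne k h0]
  · change loopBasis k (artin m (delta m (k + 1) ^ 2) (loopBasisInv k (FreeGroup.of i))) = _
    have h0 : i ≠ 0 := by have := hi.1; omega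
    rw [loopBasisInv_of_ne k h0, artin_delta_sq_of_lt h hi.2, map_mul, map_mul, map_inv,
      loopBasis_loop, loopBasis_of_ne k h0]
  · change loopBasis k (artin m (delta m (k + 1) ^ 2) (loopBasisInv k (loopBasis k f))) = _
    rw [loopBasisInv_loopBasis, hfix]

/-! ### The double centralizer of a parabolic subgroup -/

theorem delta_sq_eq_incl {m n k : ℕ} (h : m ≤ n) (hk : k ≤ m) :
    delta n k ^ 2 = incl h (delta m k ^ 2) := by rw [map_pow, incl_delta _ hk]

/-- Such a braid fixes the last strand. By uniqueness of the factorization its free part is fixed by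
Δ_m², so it is a power of the loop Δ_{m+1}²Δ_m⁻², and the powers of Δ_m² are absorbed into B_m. -/
theorem exists_of_commute_delta_sq {m : ℕ} (hm : 2 ≤ m) {x : BraidGroup (m + 1)}
    (h : Commute x (delta (m + 1) m ^ 2)) :
    ∃ (k : ℤ) (c : BraidGroup m),
      x = (delta (m + 1) (m + 1) ^ 2) ^ k * incl (Nat.le_succ m) c := by
  obtain ⟨f, hf, c, rfl⟩ := exists_of_perm_last (perm_last_of_commute hm h)
  have hfix : artin m (delta m m ^ 2) f = f := by
    have h1 := pureHom_artin (delta m m ^ 2) f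
    rw [← delta_sq_eq_incl (Nat.le_succ m) le_rfl, eq_mul_inv_iff_mul_eq] at h1
    rw [commute_iff_eq, ← mul_assoc, ← h1, mul_assoc, mul_assoc,
      delta_sq_eq_incl (Nat.le_succ m) le_rfl, ← map_mul, ← map_mul] at h
    exact (pureHom_mul_incl_inj (artin_mem_initialFree _ hf) hf h.symm).1
  have hcl := mem_closure_of_artin_delta_sq (by omega) le_rfl hf hfix
  have hemp : {x | ∃ i, m ≤ i ∧ i < m ∧ x = FreeGroup.of i} = (∅ : Set (FreeGroup ℕ)) := by
    ext x; simp only [Set.mem_ofPred_eq, Set.mem_empty_iff_false, iff_false]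
    rintro ⟨i, h1, h2, -⟩; omega
  rw [hemp, Set.union_empty, Subgroup.mem_closure_singleton] at hcl
  obtain ⟨k, rfl⟩ := hcl
  refine ⟨k, (delta m m ^ 2) ^ (-k) * c, ?_⟩
  rw [map_zpow, pureHom_loop, (delta_sq_central _).mul_zpow, map_mul, map_zpow, zpow_neg, inv_zpow,
    ← delta_sq_eq_incl (Nat.le_succ m) le_rfl, mul_assoc]

/-- A braid that commutes with the centralizer of a standard parabolic subgroup is the product
of a power of the full twist and an element of the parabolic subgroup. -/
theorem exists_of_commute_centralizer {r n : ℕ} (hr : 2 ≤ r) (hn : r ≤ n) {x : BraidGroup n}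
    (h : ∀ y, (∀ b : BraidGroup r, Commute (incl hn b) y) → Commute x y) :
    ∃ (k : ℤ) (c : BraidGroup r), x = (delta n n ^ 2) ^ k * incl hn c := by
  induction n, hn using Nat.le_induction with
  | base => exact ⟨0, x, by simp [incl_self]⟩
  | succ m hrm ih =>
    -- Δ_m² lies in the centralizer of B_r because r ≤ m.
    obtain ⟨k, c, rfl⟩ := exists_of_commute_delta_sq (hr.trans hrm)
      (h _ fun b => delta_sq_comm_incl _ b hrm (Nat.le_succ m))
    rcases Nat.eq_or_lt_of_le hrm with rfl | hlt
    · exact ⟨k, c, rfl⟩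
    have hcomm : ∀ y, (∀ b : BraidGroup r, Commute (incl (hrm.trans (Nat.le_succ m)) b) y) →
        Commute (incl (Nat.le_succ m) c) y := fun y hy => by
      have := h y hy
      have h2 := ((delta_sq_central y).zpow_left (-k)).mul_left this
      rwa [zpow_neg, inv_mul_cancel_left] at h2
    obtain ⟨l, b, rfl⟩ := ih (x := c) fun y hy => by
      have h1 := hcomm (incl (Nat.le_succ m) y) fun b => by
        rw [← incl_incl hrm (Nat.le_succ m)]; exact (hy b).map _
      exact incl_succ_injective m (by simpa using h1.eq)
    -- For r < m the generator σ_m of B_{m+1} also centralizes B_r. It commutes with the factor in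
    -- B_r, hence with the leftover power of Δ_m², whose exponent must vanish.
    have h3 := hcomm (gen (m + 1) (m - 1)) fun b => incl_comm_gen _ b (by omega)
    have h4 : Commute (incl (hrm.trans (Nat.le_succ m)) b) (gen (m + 1) (m - 1)) :=
      incl_comm_gen _ b (by omega)
    rw [map_mul, incl_incl, map_zpow, ← delta_sq_eq_incl (Nat.le_succ m) le_rfl] at h3
    have h5 := h3.mul_left h4.inv_left
    rw [mul_inv_cancel_right] at h5
    have h6 := eq_zero_of_commute_gen (by omega) l h5
    exact ⟨k, b, by rw [h6, zpow_zero, one_mul, incl_incl]⟩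

/-! ### Centralizers of parabolic subgroups are finitely generated -/

theorem fg_map {G H : Type*} [Group G] [Group H] {K : Subgroup G} (hK : K.FG) (f : G →* H) :
    (K.map f).FG := by
  obtain ⟨S, rfl, hS⟩ := Subgroup.fg_iff _ |>.1 hK
  exact Subgroup.fg_iff _ |>.2 ⟨f '' S, (MonoidHom.map_closure f S).symm, hS.image f⟩

/-- The function `f` separates the left cosets of `H` in `K` and takes finitely many values on `K`,
so `H` together with one representative for each value generates `K`. -/
theorem fg_of_fibers {G : Type*} [Group G] {H K : Subgroup G} (hH : H.FG) (hHK : H ≤ K)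
    (f : G → ℕ) (N : ℕ) (hf : ∀ x ∈ K, f x < N)
    (h : ∀ x ∈ K, ∀ y ∈ K, f x = f y → x⁻¹ * y ∈ H) : K.FG := by
  classical
  have hrep : ∀ i, ∃ x ∈ K, (∃ y ∈ K, f y = i) → f x = i := fun i => by
    by_cases hi : ∃ y ∈ K, f y = i
    · obtain ⟨y, hy, hyi⟩ := hi; exact ⟨y, hy, fun _ => hyi⟩
    · exact ⟨1, one_mem K, fun h => absurd h hi⟩
  choose rep hrepK hrep using hrep
  have hK : K = H ⊔ Subgroup.closure (rep '' Set.Iio N) := by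
    apply le_antisymm
    · intro x hx
      have h1 := h _ (hrepK (f x)) x hx (hrep (f x) ⟨x, hx, rfl⟩)
      rw [← mul_inv_cancel_left (rep (f x)) x]
      exact mul_mem (Subgroup.mem_sup_right (Subgroup.subset_closure ⟨f x, hf x hx, rfl⟩))
        (Subgroup.mem_sup_left h1)
    · refine sup_le hHK ((Subgroup.closure_le _).2 ?_)
      rintro _ ⟨i, -, rfl⟩
      exact hrepK i
  rw [hK]
  exact hH.sup (Subgroup.fg_iff _ |>.2 ⟨_, rfl, (Set.finite_Iio N).image rep⟩)

theorem exists_zpow_of_two (c : BraidGroup 2) : ∃ j : ℤ, c = gen 2 0 ^ j := by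
  have h : c ∈ Subgroup.closure {x | ∃ i, i + 1 < 2 ∧ x = gen 2 i} := by
    rw [closure_gen]; trivial
  have h2 : {x | ∃ i, i + 1 < 2 ∧ x = gen 2 i} = {gen 2 0} := by
    ext x
    constructor
    · rintro ⟨i, hi, rfl⟩
      obtain rfl : i = 0 := by omega
      rfl
    · rintro rfl; exact ⟨0, by omega, rfl⟩
  rw [h2, Subgroup.mem_closure_singleton] at h
  obtain ⟨j, hj⟩ := h
  exact ⟨j, hj.symm⟩

/-- The double centralizer theorem for r = 2 gives x = Δ^{2k}σ_1^j. Commutation with σ_2, which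
exists because n ≥ 3, forces j = 0: in σ_1^{2j} the first two strands cross 2j times with signs, the
first and the third not at all. -/
theorem center_eq_zpow {n : ℕ} (hn : 3 ≤ n) {x : BraidGroup n} (hx : ∀ y, Commute x y) :
    ∃ k : ℤ, x = (delta n n ^ 2) ^ k := by
  obtain ⟨k, c, rfl⟩ := exists_of_commute_centralizer le_rfl (show 2 ≤ n by omega)
    (x := x) fun y _ => hx y
  obtain ⟨j, rfl⟩ := exists_zpow_of_two c
  rw [map_zpow, incl_gen _ (by omega)] at hx ⊢
  have h1 : Commute (gen n 0 ^ j) (gen n 1) := by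
    have := ((delta_sq_central (gen n 1)).zpow_left k).inv_left.mul_left (hx (gen n 1))
    rwa [inv_mul_cancel_left] at this
  have h2 : Commute ((gen n 0 ^ 2) ^ j) (gen n 1) := by
    rw [← zpow_natCast, ← zpow_mul, mul_comm, zpow_mul, zpow_natCast]
    exact h1.pow_left 2
  have hp : ∀ p, perm n (gen n 0 ^ 2) p = p := fun p => by
    rw [pow_two, map_mul, Equiv.Perm.mul_apply, perm_gen (by omega), perm_gen (by omega), sw_sw]
  have hp' : ∀ p, perm n ((gen n 0 ^ 2) ^ j) p = p := fun p => by
    rw [map_zpow]; exact Function.IsFixedPt.perm_zpow (hp p) j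
  have h3 := lk_conj (gen n 1) ((gen n 0 ^ 2) ^ j) (hp' 0) (hp' 1)
  rw [← h2.eq, mul_inv_cancel_right, lk_zpow _ (hp _) (hp _), lk_zpow _ (hp _) (hp _), pow_two,
    lk_mul, lk_mul, perm_gen (by omega), perm_gen (by omega), perm_gen (by omega),
    perm_gen (by omega), perm_gen (by omega), perm_gen (by omega)] at h3
  simp only [lk_gen (show 0 + 1 < n by omega)] at h3
  have h4 : j = 0 := by simp [sw, adj] at h3; omega
  exact ⟨k, by rw [h4, zpow_zero, mul_one]⟩

theorem center_fg {n : ℕ} (hn : 2 ≤ n) : (Subgroup.center (BraidGroup n)).FG := by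
  rcases Nat.eq_or_lt_of_le hn with rfl | hn
  · have : Subgroup.center (BraidGroup 2) = Subgroup.closure {gen 2 0} := by
      ext x
      obtain ⟨j, rfl⟩ := exists_zpow_of_two x
      refine ⟨fun _ => Subgroup.mem_closure_singleton.2 ⟨j, rfl⟩, fun _ => ?_⟩
      rw [Subgroup.mem_center_iff]
      intro y
      obtain ⟨k, rfl⟩ := exists_zpow_of_two y
      exact zpow_mul_comm _ _ _
    rw [this]
    exact Subgroup.fg_iff _ |>.2 ⟨_, rfl, Set.finite_singleton _⟩
  · have : Subgroup.center (BraidGroup n) = Subgroup.closure {delta n n ^ 2} := by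
      ext x
      rw [Subgroup.mem_closure_singleton, Subgroup.mem_center_iff]
      constructor
      · intro h
        obtain ⟨k, rfl⟩ := center_eq_zpow hn fun y => (h y).symm
        exact ⟨k, rfl⟩
      · rintro ⟨k, rfl⟩ y
        exact ((delta_sq_central y).zpow_left k).eq.symm
    rw [this]
    exact Subgroup.fg_iff _ |>.2 ⟨_, rfl, Set.finite_singleton _⟩

theorem mem_centralizer_range_iff {G H : Type*} [Group G] [Group H] {f : G →* H} {y : H} :
    y ∈ Subgroup.centralizer (f.range : Set H) ↔ ∀ b, Commute (f b) y := by
  rw [Subgroup.mem_centralizer_iff]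
  constructor
  · exact fun h b => h _ ⟨b, rfl⟩
  · rintro h _ ⟨b, rfl⟩; exact h b

/-- Induction on the number of strands. The elements of the centralizer that fix the last strand
form a subgroup of finite index, generated by the part of the free group fixed by B_r and the
centralizer of B_r in B_m. -/
theorem centralizer_fg {r n : ℕ} (hr : 2 ≤ r) (hn : r ≤ n) :
    (Subgroup.centralizer ((incl hn).range : Set (BraidGroup n))).FG := by
  induction n, hn using Nat.le_induction with
  | base =>
    have : Subgroup.centralizer ((incl (le_refl r)).range : Set (BraidGroup r)) =
        Subgroup.center (BraidGroup r) := by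
      ext x
      rw [mem_centralizer_range_iff, Subgroup.mem_center_iff]
      simp only [incl_self]
      rfl
    rw [this]
    exact center_fg hr
  | succ m hrm ih =>
    set S : Set (FreeGroup ℕ) := {loop r} ∪ {x | ∃ i, r ≤ i ∧ i < m ∧ x = FreeGroup.of i} with hS
    have hSfix : ∀ f ∈ S, ∀ b : BraidGroup r, artin m (incl hrm b) f = f := by
      rintro _ (rfl | ⟨i, hi, -, rfl⟩) b
      · exact artin_incl_loop hrm b
      · exact artin_incl_of hrm hi b
    have hSfin : S.Finite := by
      refine (Set.finite_singleton _).union (((Set.finite_Iio m).image FreeGroup.of).subset ?_)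
      rintro _ ⟨i, -, hi, rfl⟩
      exact ⟨i, hi, rfl⟩
    refine fg_of_fibers (H := (Subgroup.closure S).map (pureHom m) ⊔
      (Subgroup.centralizer ((incl hrm).range : Set (BraidGroup m))).map (incl (Nat.le_succ m)))
      ?_ ?_ (fun x => perm (m + 1) x m) (m + 1) (fun x _ => perm_lt x (Nat.lt_succ_self m)) ?_
    · exact (fg_map (Subgroup.fg_iff _ |>.2 ⟨S, rfl, hSfin⟩) _).sup (fg_map ih _)
    · refine sup_le ?_ ?_
      · rw [MonoidHom.map_closure, Subgroup.closure_le]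
        rintro _ ⟨f, hf, rfl⟩
        rw [SetLike.mem_coe, mem_centralizer_range_iff]
        intro b
        have h1 := pureHom_artin (incl hrm b) f
        rw [hSfix f hf, incl_incl, eq_mul_inv_iff_mul_eq] at h1
        exact h1.symm
      · rintro _ ⟨c, hc, rfl⟩
        rw [SetLike.mem_coe, mem_centralizer_range_iff] at hc
        rw [mem_centralizer_range_iff]
        intro b
        rw [← incl_incl hrm (Nat.le_succ m)]
        exact (hc b).map _
    · intro x hx y hy hxy
      have hz := mul_mem (inv_mem hx) hy
      have hp : perm (m + 1) (x⁻¹ * y) m = m := by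
        rw [map_mul, Equiv.Perm.mul_apply, ← hxy, map_inv, perm_inv_apply]
      obtain ⟨f, hf, c, hfc⟩ := exists_of_perm_last hp
      rw [hfc] at hz ⊢
      rw [mem_centralizer_range_iff] at hz
      -- Uniqueness of the factorization splits commutation with B_r into a fixed-point condition on
      -- `f` and commutation of `c` with B_r.
      have key : ∀ b : BraidGroup r, artin m (incl hrm b) f = f ∧ incl hrm b * c = c * incl hrm b := by
        intro b
        have h1 := pureHom_artin (incl hrm b) f
        rw [eq_mul_inv_iff_mul_eq] at h1
        have h2 := (hz b).eq
        rw [← incl_incl hrm (Nat.le_succ m), ← mul_assoc, ← h1, mul_assoc, mul_assoc, ← map_mul,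
          ← map_mul] at h2
        exact pureHom_mul_incl_inj (artin_mem_initialFree _ hf) hf h2
      -- Being fixed by the full twist Δ_r² alone already puts `f` into the subgroup generated by
      -- `S`.
      have h3 := (key (delta r r ^ 2)).1
      rw [← delta_sq_eq_incl hrm le_rfl] at h3
      refine mul_mem (Subgroup.mem_sup_left (Subgroup.mem_map_of_mem _
        (mem_closure_of_artin_delta_sq (by omega) hrm hf h3)))
        (Subgroup.mem_sup_right (Subgroup.mem_map_of_mem _ ?_))
      rw [mem_centralizer_range_iff]
      exact fun b => (key b).2

/-! ### Parabolic subgroups with a connected Coxeter graph -/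

/-- Conjugation by σ_1⋯σ_{n-1} shifts indices by one, so it moves B_{[1,m-k+1]} to B_{[k,m]} in k -
1 steps. -/
theorem up_pow_mul_gen {n i j : ℕ} (h : i + j + 1 < n) :
    up n (n - 1) ^ j * gen n i * (up n (n - 1) ^ j)⁻¹ = gen n (i + j) := by
  induction j with
  | zero => simp
  | succ j ih =>
    rw [pow_succ', mul_inv_rev, mul_assoc, mul_assoc, ← mul_assoc (gen n i), ← mul_assoc _ _ (_⁻¹),
      ← mul_assoc _ (gen n i), ih (by omega), ← mul_assoc, up_mul_gen (by omega) (by omega),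
      mul_inv_cancel_right]
    rfl

/-- `A` is the conjugate by `α` of the subgroup `B_r` of `B_n`. -/
def IsConj {n : ℕ} (A : Subgroup (BraidGroup n)) (r : ℕ) (hr : r ≤ n) (α : BraidGroup n) : Prop :=
  ∀ x, x ∈ A ↔ ∃ b : BraidGroup r, x = α * incl hr b * α⁻¹

theorem exists_isConj {n : ℕ} {A : Subgroup (BraidGroup n)} (hA : IsConnectedParabolic A) :
    ∃ (r : ℕ) (_ : 2 ≤ r) (hr : r ≤ n) (α : BraidGroup n), IsConj A r hr α := by
  obtain ⟨k, m, hk, hkm, hm, α, rfl⟩ := hA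
  refine ⟨m - k + 1, by omega, by omega, α * up n (n - 1) ^ (k - 1), fun x => ?_⟩
  have h : standardParabolic n k m = (incl (show m - k + 1 ≤ n by omega)).range.map
      (MulAut.conj (up n (n - 1) ^ (k - 1))).toMonoidHom := by
    rw [range_incl, MonoidHom.map_closure, standardParabolic]
    congr 1
    ext x
    constructor
    · rintro ⟨i, h1, h2, rfl⟩
      refine ⟨gen n (i - (k - 1)), ⟨_, by omega, rfl⟩, ?_⟩
      change up n (n - 1) ^ (k - 1) * _ * (up n (n - 1) ^ (k - 1))⁻¹ = _
      rw [up_pow_mul_gen (by omega), ← gen_val]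
      congr 1; omega
    · rintro ⟨_, ⟨i, hi, rfl⟩, rfl⟩
      refine ⟨⟨i + (k - 1), by omega⟩, ?_, ?_, ?_⟩
      · change k ≤ i + (k - 1) + 1; omega
      · change i + (k - 1) + 1 < m; omega
      change up n (n - 1) ^ (k - 1) * _ * (up n (n - 1) ^ (k - 1))⁻¹ = _
      rw [up_pow_mul_gen (by omega), ← gen_val]
  rw [h, Subgroup.map_map]
  set u := up n (n - 1) ^ (k - 1)
  constructor
  · rintro ⟨_, ⟨b, rfl⟩, rfl⟩
    exact ⟨b, by simp [mul_assoc]⟩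
  · rintro ⟨b, rfl⟩
    exact ⟨_, ⟨b, rfl⟩, by simp [mul_assoc]⟩

section IsConj

variable {n r s : ℕ} {hr : r ≤ n} {hs : s ≤ n} {A B : Subgroup (BraidGroup n)}
  {α β : BraidGroup n}

theorem IsConj.centralizer_fg (h : IsConj A r hr α) (h2 : 2 ≤ r) :
    (Subgroup.centralizer (A : Set (BraidGroup n))).FG := by
  have : Subgroup.centralizer (A : Set (BraidGroup n)) =
      (Subgroup.centralizer ((incl hr).range : Set (BraidGroup n))).map
        (MulAut.conj α).toMonoidHom := by
    ext x
    constructor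
    · intro hx
      refine ⟨α⁻¹ * x * α, ?_, by simp [mul_assoc]⟩
      rw [SetLike.mem_coe, mem_centralizer_range_iff]
      intro b
      have h1 := Subgroup.mem_centralizer_iff.1 hx _ ((h _).2 ⟨b, rfl⟩)
      have h2 := congrArg (fun y => α⁻¹ * y * α) h1
      simpa [mul_assoc, commute_iff_eq] using h2
    · rintro ⟨y, hy, rfl⟩
      rw [SetLike.mem_coe, mem_centralizer_range_iff] at hy
      rw [Subgroup.mem_centralizer_iff]
      intro a ha
      obtain ⟨b, rfl⟩ := (h a).1 ha
      have := (hy b).map (MulAut.conj α)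
      exact this.eq
  rw [this]
  exact fg_map (Braid.centralizer_fg h2 hr) _

theorem IsConj.exists_of_commute (h : IsConj A r hr α) (h2 : 2 ≤ r) {x : BraidGroup n}
    (hx : ∀ y ∈ Subgroup.centralizer (A : Set (BraidGroup n)), Commute x y) :
    ∃ (k : ℤ), ∃ a ∈ A, x = (delta n n ^ 2) ^ k * a := by
  obtain ⟨k, c, hc⟩ := exists_of_commute_centralizer h2 hr (x := α⁻¹ * x * α) fun y hy => by
    have h3 : Commute x (α * y * α⁻¹) := hx _ <| by
      rw [Subgroup.mem_centralizer_iff]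
      intro a ha
      obtain ⟨b, rfl⟩ := (h a).1 ha
      exact ((hy b).map (MulAut.conj α)).eq
    have h4 := congrArg (fun y => α⁻¹ * y * α) h3.eq
    simpa [mul_assoc, commute_iff_eq] using h4
  refine ⟨k, α * incl hr c * α⁻¹, (h _).2 ⟨c, rfl⟩, ?_⟩
  have h5 := ((delta_sq_central α).zpow_left k).eq
  calc x = α * (α⁻¹ * x * α) * α⁻¹ := by group
    _ = α * (delta n n ^ 2) ^ k * incl hr c * α⁻¹ := by rw [hc]; group
    _ = _ := by rw [← h5]; group

/-- No nontrivial power of the full twist maps an element of a proper parabolic subgroup to a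
conjugate of an element of a proper parabolic subgroup. -/
theorem IsConj.eq_zero (hA : IsConj A r hr α) (hB : IsConj B s hs β) (h2 : 2 ≤ r) (hrn : r < n)
    (hsn : s < n) {a b g : BraidGroup n} (ha : a ∈ A) (hb : b ∈ B) {j : ℤ}
    (h : g * a * g⁻¹ = (delta n n ^ 2) ^ j * b) : j = 0 := by
  obtain ⟨m, rfl⟩ : ∃ m, n = m + 1 := ⟨n - 1, by omega⟩
  obtain ⟨a', rfl⟩ := (hA a).1 ha
  obtain ⟨b', rfl⟩ := (hB b).1 hb
  refine eq_zero_of_conj (by omega) (show r ≤ m by omega) (show s ≤ m by omega) a' b'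
    (β⁻¹ * g * α) j ?_
  have h5 := ((delta_sq_central β).zpow_left j).inv_right.eq
  calc β⁻¹ * g * α * incl hr a' * (β⁻¹ * g * α)⁻¹
      = β⁻¹ * (g * (α * incl hr a' * α⁻¹) * g⁻¹) * β := by group
    _ = (β⁻¹ * (delta (m + 1) (m + 1) ^ 2) ^ j) * β * incl hs b' := by rw [h]; group
    _ = _ := by rw [← h5]; group

theorem IsConj.eq_top (h : IsConj A n le_rfl α) : A = ⊤ := by
  rw [eq_top_iff]
  intro x _
  exact (h x).2 ⟨α⁻¹ * x * α, by rw [incl_self]; group⟩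

end IsConj

/-! ### The fundamental element -/

theorem filter_range_le {N j : ℕ} (h : j < N) :
    (List.range N).filter (fun i => decide (i ≤ j)) = List.range (j + 1) := by
  induction N, h using Nat.le_induction with
  | base =>
    rw [List.filter_eq_self]
    intro i hi
    simpa [Nat.lt_succ_iff] using hi
  | succ N hN ih =>
    rw [List.range_succ, List.filter_append, ih]
    have : ¬ N ≤ j := by omega
    simp [this]

theorem prod_range_gen (n k : ℕ) : ((List.range k).map (gen n)).prod = up n k := by
  induction k with
  | zero => rfl
  | succ k ih => rw [List.range_succ, List.map_append, List.prod_append, ih]; simp [up]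

theorem prod_range_up (n k : ℕ) :
    ((List.range k).reverse.map fun j => up n (j + 1)).prod = delta n (k + 1) := by
  induction k with
  | zero => rfl
  | succ k ih => rw [List.range_succ, List.reverse_append, List.map_append, List.prod_append, ih];
                 simp [delta]

theorem garsideElement_eq {n : ℕ} (hn : 1 ≤ n) : garsideElement n = delta n n := by
  have h1 : ∀ j : Fin (n - 1), (((List.finRange (n - 1)).filter fun i => i ≤ j).map braidGen).prod =
      up n (j + 1) := fun j => by
    rw [← prod_range_gen, ← filter_range_le j.2, ← List.map_coe_finRange_eq_range, List.filter_map,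
      List.map_map]
    congr 1
    refine List.map_congr_left fun i _ => ?_
    exact (gen_val i).symm
  obtain ⟨m, rfl⟩ : ∃ m, n = m + 1 := ⟨n - 1, by omega⟩
  rw [garsideElement, ← prod_range_up]
  simp only [h1]
  rw [← List.map_coe_finRange_eq_range, ← List.map_reverse, List.map_map]
  rfl

end Braid

/-! ### Linear-time stack programs and their compilation to Turing machines -/

namespace StackProgram

open Turing StateTransition

/-! ### Programs of loops over stacks -/

/-- A loop over the stack `src`: every iteration pops a letter from `src` and from `aux` and then
changes the state, pushes letters on the stacks and prepends a word to the output. When `src` is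
empty, the loop ends with one more action of this kind. -/
structure Instr (S W D O : Type) where
  /-- the stack that is read -/
  src : W
  /-- the auxiliary stack -/
  aux : W
  /-- the action for a letter of `src` -/
  step : S → D → Option D → S × List (W × D) × List O
  /-- the action at the end -/
  fin : S → Option D → S × List (W × D) × List O

/-- A configuration: the state, the stacks and the output. -/
@[ext]
structure Config (S W D O : Type) where
  /-- the state -/
  st : S
  /-- the stacks -/
  stk : W → List D
  /-- the output -/
  out : List O

variable {S W D O I : Type} [DecidableEq W]

/-- Pushes letters on the stacks. -/
def pushAll : List (W × D) → (W → List D) → W → List D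
  | [], k => k
  | x :: l, k => pushAll l (Function.update k x.1 (x.2 :: k x.1))

/-- Removes the top of a stack. -/
def Config.pop (c : Config S W D O) (w : W) : Config S W D O :=
  ⟨c.st, Function.update c.stk w (c.stk w).tail, c.out⟩

/-- Performs an action. -/
def Config.act (c : Config S W D O) (r : S × List (W × D) × List O) : Config S W D O :=
  ⟨r.1, pushAll r.2.1 c.stk, r.2.2 ++ c.out⟩

/-- The loop leads from the first configuration to the second one in the given number of steps. -/
inductive Instr.Runs (A : Instr S W D O) : Config S W D O → ℕ → Config S W D O → Prop
  | fin (c : Config S W D O) (h : c.stk A.src = []) :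
      A.Runs c 1 (((c.pop A.src).pop A.aux).act (A.fin c.st ((c.pop A.src).stk A.aux).head?))
  | step (c : Config S W D O) (d : D) (h : (c.stk A.src).head? = some d) {t : ℕ}
      {c₁ : Config S W D O}
      (hr : A.Runs (((c.pop A.src).pop A.aux).act
        (A.step c.st d ((c.pop A.src).stk A.aux).head?)) t c₁) : A.Runs c (t + 1) c₁

/-- The loops of the list lead one after the other from the first configuration to the second one
in the given number of steps. -/
inductive ProgRuns : List (Instr S W D O) → Config S W D O → ℕ → Config S W D O → Prop
  | nil (c : Config S W D O) : ProgRuns [] c 0 c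
  | cons {A : Instr S W D O} {P : List (Instr S W D O)} {c c' c'' : Config S W D O} {t t' : ℕ}
      (h : A.Runs c t c') (h' : ProgRuns P c' t' c'') : ProgRuns (A :: P) c (t + t') c''

theorem ProgRuns.append {P Q : List (Instr S W D O)} {c c' c'' : Config S W D O} {t t' : ℕ}
    (h : ProgRuns P c t c') (hQ : ProgRuns Q c' t' c'') : ProgRuns (P ++ Q) c (t + t') c'' := by
  induction h with
  | nil => simpa using hQ
  | cons h1 _ ih => rw [add_assoc]; exact .cons h1 (ih hQ)

/-! ### Bounds for the number of steps -/

/-- The loop does not push letters on the stack that it reads. -/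
def Instr.Safe (A : Instr S W D O) : Prop :=
  A.aux ≠ A.src ∧ ∀ s d o, ∀ x ∈ (A.step s d o).2.1, x.1 ≠ A.src

theorem pushAll_of_forall_ne {l : List (W × D)} {w : W} (h : ∀ x ∈ l, x.1 ≠ w)
    (k : W → List D) : pushAll l k w = k w := by
  induction l generalizing k with
  | nil => rfl
  | cons x l ih =>
    rw [pushAll, ih fun y hy => h y (List.mem_cons_of_mem _ hy),
      Function.update_of_ne (h x List.mem_cons_self).symm]

theorem Instr.exists_bound {W : Type} [Finite S] [Finite D] (A : Instr S W D O) :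
    ∃ b : ℕ, (∀ s d o, (A.step s d o).2.1.length ≤ b) ∧ ∀ s o, (A.fin s o).2.1.length ≤ b := by
  obtain ⟨b, hb⟩ := (Set.finite_range fun x : S × D × Option D =>
    (A.step x.1 x.2.1 x.2.2).2.1.length).bddAbove
  obtain ⟨b', hb'⟩ := (Set.finite_range fun x : S × Option D =>
    (A.fin x.1 x.2).2.1.length).bddAbove
  exact ⟨max b b', fun s d o => (hb ⟨(s, d, o), rfl⟩).trans (le_max_left _ _),
    fun s o => (hb' ⟨(s, o), rfl⟩).trans (le_max_right _ _)⟩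

section bounds

variable [Fintype W]

/-- The number of letters on the stacks. -/
def size (k : W → List D) : ℕ := ∑ w, (k w).length

theorem size_update (k : W → List D) (w : W) (l : List D) :
    size (Function.update k w l) + (k w).length = size k + l.length := by
  rw [size, size, ← Finset.add_sum_erase _ _ (Finset.mem_univ w),
    ← Finset.add_sum_erase (a := w) _ _ (Finset.mem_univ w), Function.update_self,
    Finset.sum_congr rfl fun x hx => by rw [Function.update_of_ne (Finset.ne_of_mem_erase hx)]]
  ring

theorem size_pushAll (l : List (W × D)) (k : W → List D) :
    size (pushAll l k) = size k + l.length := by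
  induction l generalizing k with
  | nil => rfl
  | cons x l ih =>
    have := size_update k x.1 (x.2 :: k x.1)
    rw [pushAll, ih]
    simp only [List.length_cons] at this ⊢
    omega

theorem length_le_size {W : Type} [Fintype W] (k : W → List D) (w : W) : (k w).length ≤ size k :=
  Finset.single_le_sum (f := fun w => (k w).length) (fun _ _ => Nat.zero_le _) (Finset.mem_univ w)

theorem size_pop_le (c : Config S W D O) (w : W) : size (c.pop w).stk ≤ size c.stk := by
  have := size_update c.stk w (c.stk w).tail
  simp only [List.length_tail] at this
  unfold Config.pop
  dsimp only
  omega

/-- Safety makes the source shrink by exactly one letter in each iteration, which fixes the number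
of iterations; each of them pushes at most `b` letters. -/
theorem Instr.Runs.bound {A : Instr S W D O} (hA : A.Safe) {b : ℕ}
    (hb : ∀ s d o, (A.step s d o).2.1.length ≤ b) (hb' : ∀ s o, (A.fin s o).2.1.length ≤ b)
    {c c' : Config S W D O} {t : ℕ} (h : A.Runs c t c') :
    t = (c.stk A.src).length + 1 ∧ size c'.stk ≤ size c.stk + t * b := by
  induction h with
  | fin c h =>
    refine ⟨by rw [h]; rfl, ?_⟩
    have h1 := size_pop_le (c.pop A.src) A.aux
    have h2 := size_pop_le c A.src
    have h3 := hb' c.st ((c.pop A.src).stk A.aux).head?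
    simp only [Config.act, size_pushAll]
    omega
  | step c d h hr ih =>
    obtain ⟨ih1, ih2⟩ := ih
    have h1 := size_pop_le (c.pop A.src) A.aux
    have h2 := size_pop_le c A.src
    have h3 := hb c.st d ((c.pop A.src).stk A.aux).head?
    have h4 : ((((c.pop A.src).pop A.aux).act
        (A.step c.st d ((c.pop A.src).stk A.aux).head?)).stk A.src) = (c.stk A.src).tail := by
      simp only [Config.act]
      rw [pushAll_of_forall_ne (hA.2 _ _ _)]
      simp only [Config.pop]
      rw [Function.update_of_ne hA.1.symm, Function.update_self]
    rw [h4, List.length_tail] at ih1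
    have h5 : 0 < (c.stk A.src).length := by
      rcases hc : c.stk A.src with - | ⟨x, l⟩
      · rw [hc] at h; simp at h
      · simp
    simp only [Config.act, size_pushAll] at ih2
    refine ⟨by omega, ?_⟩
    rw [add_mul, one_mul]
    omega

/-- One loop enlarges the total stack size by at most a constant factor, up to an additive constant.
A fixed sequence of loops therefore takes time linear in the initial size. -/
theorem ProgRuns.exists_bound [Finite S] [Finite D] (P : List (Instr S W D O))
    (hP : ∀ A ∈ P, A.Safe) :
    ∃ C : ℕ, ∀ (c c' : Config S W D O) (t : ℕ), ProgRuns P c t c' → t ≤ C * (size c.stk + 1) := by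
  induction P with
  | nil => exact ⟨0, fun c c' t h => by cases h; omega⟩
  | cons A P ih =>
    obtain ⟨C, hC⟩ := ih fun B hB => hP B (List.mem_cons_of_mem _ hB)
    obtain ⟨b, hb, hb'⟩ := A.exists_bound
    refine ⟨1 + C * (1 + b), fun c c'' t h => ?_⟩
    cases h with
    | cons h h' =>
      rename_i c' t t'
      obtain ⟨h1, h2⟩ := h.bound (hP A List.mem_cons_self) hb hb'
      have h3 := hC _ _ _ h'
      have h4 := length_le_size c.stk A.src
      have h5 : t ≤ size c.stk + 1 := by omega
      have h6 : size c'.stk + 1 ≤ (size c.stk + 1) * (1 + b) := by nlinarith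
      calc t + t' ≤ (size c.stk + 1) + C * ((size c.stk + 1) * (1 + b)) :=
            Nat.add_le_add h5 (h3.trans (Nat.mul_le_mul_left C h6))
        _ = _ := by ring

end bounds

/-! ### Compilation to Turing machines -/

section machine

/-- The alphabets of the stacks: the input, the output and the working stacks. -/
def Alphabet (W D O I : Type) : Option (Option W) → Type
  | none => I
  | some none => O
  | some (some _) => D

/-- The stacks of the machine. -/
def tapes (inp : List I) (c : Config S W D O) : ∀ k, List (Alphabet W D O I k)
  | none => inp
  | some none => c.out
  | some (some w) => c.stk w

theorem update_tapes_input (inp inp' : List I) (c : Config S W D O) :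
    Function.update (tapes inp c) none inp' = tapes inp' c := by
  funext k
  rcases k with - | - | w
  · exact Function.update_self ..
  · exact Function.update_of_ne (by simp) ..
  · exact Function.update_of_ne (by simp) ..

theorem update_tapes_output (inp : List I) (c : Config S W D O) (o : List O) :
    Function.update (tapes inp c) (some none) o = tapes inp ⟨c.st, c.stk, o⟩ := by
  funext k
  rcases k with - | - | w
  · exact Function.update_of_ne (by simp) ..
  · exact Function.update_self ..
  · exact Function.update_of_ne (by simp) ..

theorem update_tapes_work (inp : List I) (c : Config S W D O) (w : W) (l : List D) :
    Function.update (tapes inp c) (some (some w)) l =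
      tapes inp ⟨c.st, Function.update c.stk w l, c.out⟩ := by
  funext k
  rcases k with - | - | w'
  · exact Function.update_of_ne (by simp) ..
  · exact Function.update_of_ne (by simp) ..
  · by_cases h : w' = w
    · subst h
      refine (Function.update_self ..).trans ?_
      exact (Function.update_self (f := c.stk) ..).symm
    · refine (Function.update_of_ne (by simpa using h) ..).trans ?_
      exact (Function.update_of_ne h ..).symm

/-- The labels: reading the input, the end, and the loops. -/
abbrev Label (N : ℕ) : Type := Option (Option (Fin N))

/-- The label of the loop with the number `i`. -/
def label (N i : ℕ) : Label N := if h : i < N then some (some ⟨i, h⟩) else some none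

/-- The internal states of the machine: the state and the last letters that were read. -/
abbrev Var (S D I : Type) : Type := S × Option I × Option D × Option D

variable (W O) in
/-- The statements of the machine. -/
abbrev St (S D I : Type) (N : ℕ) : Type := TM2.Stmt (Alphabet W D O I) (Label N) (Var S D I)

/-- Pops a letter from a working stack. -/
def popWork {N : ℕ} (w : W) (f : Var S D I → Option D → Var S D I) (q : St W O S D I N) :
    St W O S D I N := .pop (some (some w)) f q

theorem stepAux_popWork {N : ℕ} (w : W) (f : Var S D I → Option D → Var S D I)
    (q : St W O S D I N) (v : Var S D I) (inp : List I) (c : Config S W D O) :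
    TM2.stepAux (popWork w f q) v (tapes inp c) =
      TM2.stepAux q (f v (c.stk w).head?) (tapes inp (c.pop w)) :=
  congrArg (TM2.stepAux q _) (update_tapes_work ..)

/-- Pops a letter from the input. -/
def popInput {N : ℕ} (f : Var S D I → Option I → Var S D I) (q : St W O S D I N) :
    St W O S D I N := .pop none f q

theorem stepAux_popInput {N : ℕ} (f : Var S D I → Option I → Var S D I)
    (q : St W O S D I N) (v : Var S D I) (inp : List I) (c : Config S W D O) :
    TM2.stepAux (popInput f q) v (tapes inp c) =
      TM2.stepAux q (f v inp.head?) (tapes inp.tail c) :=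
  congrArg (TM2.stepAux q _) (update_tapes_input ..)

/-- Case distinction by the internal state. -/
def caseOn [DecidableEq S] [DecidableEq D] [DecidableEq I] {N : ℕ} (f : Var S D I → St W O S D I N) : List (Var S D I) → St W O S D I N
  | [] => .halt
  | v :: l => .branch (fun v' => decide (v' = v)) (f v) (caseOn f l)

/-- A machine statement pushes a fixed number of letters, whereas an action pushes a word that
depends on the state. Branching over all of the finitely many internal states resolves this. -/
theorem stepAux_caseOn [DecidableEq S] [DecidableEq D] [DecidableEq I] {N : ℕ} (f : Var S D I → St W O S D I N) {l : List (Var S D I)}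
    {v : Var S D I} (h : v ∈ l) (k : ∀ k, List (Alphabet W D O I k)) :
    TM2.stepAux (caseOn f l) v k = TM2.stepAux (f v) v k := by
  induction l with
  | nil => simp at h
  | cons v' l ih =>
    by_cases hv : v = v'
    · subst hv; simp [caseOn]
    · simp only [caseOn, TM2.stepAux, hv, decide_false, cond_false]
      exact ih ((List.mem_cons.1 h).resolve_left hv)

/-- Pushes letters on the working stacks. -/
def pushWork {N : ℕ} : List (W × D) → St W O S D I N → St W O S D I N
  | [], q => q
  | x :: l, q => .push (some (some x.1)) (fun _ => x.2) (pushWork l q)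

/-- Prepends the reverse of a word to the output. -/
def pushOut {N : ℕ} : List O → St W O S D I N → St W O S D I N
  | [], q => q
  | x :: l, q => .push (some none) (fun _ => x) (pushOut l q)

theorem stepAux_pushWork {N : ℕ} (l : List (W × D)) (q : St W O S D I N) (v : Var S D I)
    (inp : List I) (c : Config S W D O) :
    TM2.stepAux (pushWork l q) v (tapes inp c) =
      TM2.stepAux q v (tapes inp ⟨c.st, pushAll l c.stk, c.out⟩) := by
  induction l generalizing c with
  | nil => rfl
  | cons x l ih =>
    refine Eq.trans (congrArg (TM2.stepAux (pushWork l q) v) (update_tapes_work ..)) ?_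
    rw [ih]; rfl

theorem stepAux_pushOut {N : ℕ} (l : List O) (q : St W O S D I N) (v : Var S D I)
    (inp : List I) (c : Config S W D O) :
    TM2.stepAux (pushOut l q) v (tapes inp c) =
      TM2.stepAux q v (tapes inp ⟨c.st, c.stk, l.reverse ++ c.out⟩) := by
  induction l generalizing c with
  | nil => rfl
  | cons x l ih =>
    refine Eq.trans (congrArg (TM2.stepAux (pushOut l q) v) (update_tapes_output ..)) ?_
    rw [ih]
    simp only [List.reverse_cons, List.append_assoc]
    rfl

/-- The statement that performs an action and jumps to a label. -/
def actStmt {N : ℕ} (r : S × List (W × D) × List O) (next : Label N) : St W O S D I N :=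
  pushWork r.2.1 <| pushOut r.2.2.reverse <|
    .load (fun _ => (r.1, none, none, none)) <| .goto fun _ => next

theorem stepAux_actStmt {N : ℕ} (r : S × List (W × D) × List O) (next : Label N) (v : Var S D I)
    (inp : List I) (c : Config S W D O) :
    TM2.stepAux (actStmt r next) v (tapes inp c) =
      ⟨some next, (r.1, none, none, none), tapes inp (c.act r)⟩ := by
  rw [actStmt, stepAux_pushWork, stepAux_pushOut, List.reverse_reverse]
  rfl

/-- The statement of a loop. -/
noncomputable def Instr.stmt [DecidableEq S] [DecidableEq D] [DecidableEq I] [Fintype S] [Fintype D]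
    [Fintype I] {N : ℕ} (A : Instr S W D O) (here next : Label N) : St W O S D I N :=
  popWork A.src (fun v d => (v.1, none, d, none)) <|
  popWork A.aux (fun v d => (v.1, none, v.2.2.1, d)) <|
  caseOn (fun v => match v.2.2.1 with
    | none => actStmt (A.fin v.1 v.2.2.2) next
    | some d => actStmt (A.step v.1 d v.2.2.2) here) Finset.univ.toList

/-- The machine of a program. The letters of the input are distributed on the stacks first. -/
noncomputable def machine [DecidableEq S] [DecidableEq D] [DecidableEq I] [Fintype S] [Fintype D]
    [Fintype I] [Fintype W] (P : List (Instr S W D O)) (split : I → W × D) (s₀ : S) : FinTM2 where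
  K := Option (Option W)
  k₀ := none
  k₁ := some none
  Γ := Alphabet W D O I
  Λ := Label P.length
  main := none
  σ := Var S D I
  initialState := (s₀, none, none, none)
  Γk₀Fin := inferInstanceAs (Fintype I)
  m
    | none => popInput (fun v x => (v.1, x, none, none)) <|
      caseOn (fun v => match v.2.1 with
        | none => actStmt (v.1, [], []) (label P.length 0)
        | some x => actStmt (v.1, [split x], []) none) Finset.univ.toList
    -- A halting configuration must carry the initial internal state, so the state is reset before
    -- the machine stops.
    | some none => .load (fun _ => (s₀, none, none, none)) .halt
    | some (some i) => (P.get i).stmt (some (some i)) (label P.length (i + 1))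


/-! ### Runs of the machine -/

/-- The step function leads from `a` to `b` in `t` steps. -/
def Steps {σ : Type} (f : σ → Option σ) (t : ℕ) (a b : σ) : Prop :=
  (flip bind f)^[t] (some a) = some b

theorem Steps.refl {σ : Type} (f : σ → Option σ) (a : σ) : Steps f 0 a a := rfl

theorem Steps.head {σ : Type} {f : σ → Option σ} {t : ℕ} {a b c : σ} (h : f a = some b)
    (h' : Steps f t b c) : Steps f (t + 1) a c := by
  rw [Steps, Function.iterate_succ_apply]
  exact (congrArg _ h).trans h'

theorem Steps.trans {σ : Type} {f : σ → Option σ} {t t' : ℕ} {a b c : σ} (h : Steps f t a b)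
    (h' : Steps f t' b c) : Steps f (t + t') a c := by
  rw [Steps, add_comm, Function.iterate_add_apply, show _ = _ from h]
  exact h'

section runs

variable [DecidableEq S] [DecidableEq D] [DecidableEq I] [Fintype S] [Fintype D] [Fintype I]

/-- The configuration of the machine with the given label. -/
def toCfg {N : ℕ} (l : Option (Label N)) (inp : List I) (c : Config S W D O) :
    TM2.Cfg (Alphabet W D O I) (Label N) (Var S D I) :=
  ⟨l, (c.st, none, none, none), tapes inp c⟩

theorem stepAux_stmt_fin {N : ℕ} (A : Instr S W D O) (here next : Label N) (inp : List I)
    (c : Config S W D O) (h : c.stk A.src = []) :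
    TM2.stepAux (A.stmt here next) (c.st, none, none, none) (tapes inp c) =
      toCfg (some next) inp (((c.pop A.src).pop A.aux).act
        (A.fin c.st ((c.pop A.src).stk A.aux).head?)) := by
  rw [Instr.stmt, stepAux_popWork, stepAux_popWork, stepAux_caseOn _ (by simp), h]
  exact stepAux_actStmt ..

theorem stepAux_stmt_step {N : ℕ} (A : Instr S W D O) (here next : Label N) (inp : List I)
    (c : Config S W D O) (d : D) (h : (c.stk A.src).head? = some d) :
    TM2.stepAux (A.stmt here next) (c.st, none, none, none) (tapes inp c) =
      toCfg (some here) inp (((c.pop A.src).pop A.aux).act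
        (A.step c.st d ((c.pop A.src).stk A.aux).head?)) := by
  rw [Instr.stmt, stepAux_popWork, stepAux_popWork, stepAux_caseOn _ (by simp), h]
  exact stepAux_actStmt ..

variable [Fintype W]

theorem Instr.Runs.steps (P : List (Instr S W D O)) (split : I → W × D) (s₀ : S)
    (i : Fin P.length) {c c' : Config S W D O} {t : ℕ} (h : (P.get i).Runs c t c') :
    Steps (machine P split s₀).step t (toCfg (some (some (some i))) [] c)
      (toCfg (some (label P.length (i + 1))) [] c') := by
  generalize hA : P.get i = A at h
  induction h with
  | fin c h =>
    refine .head ?_ (.refl _ _)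
    refine congrArg some (Eq.trans ?_ (stepAux_stmt_fin A (some (some i)) _ [] c h))
    rw [← hA]; rfl
  | step c d h hr ih =>
    refine .head ?_ ih
    refine congrArg some (Eq.trans ?_ (stepAux_stmt_step A (some (some i))
      (label P.length (i + 1)) [] c d h))
    rw [← hA]; rfl

theorem ProgRuns.steps (P : List (Instr S W D O)) (split : I → W × D) (s₀ : S)
    {Q : List (Instr S W D O)} {c c' : Config S W D O} {t : ℕ} (h : ProgRuns Q c t c') (i : ℕ)
    (hi : P.drop i = Q) :
    Steps (machine P split s₀).step t (toCfg (some (label P.length i)) [] c)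
      (toCfg (some (some none)) [] c') := by
  induction h generalizing i with
  | nil c =>
    rw [label, dif_neg (by simpa using hi)]
    exact .refl _ _
  | cons h h' ih =>
    have hlt : i < P.length := by
      by_contra hc
      rw [List.drop_eq_nil_of_le (by omega)] at hi
      simp at hi
    rw [List.drop_eq_getElem_cons hlt] at hi
    rw [label, dif_pos hlt]
    refine Steps.trans (Instr.Runs.steps P split s₀ ⟨i, hlt⟩ ?_) (ih (i + 1) (List.cons.inj hi).2)
    rw [List.get_eq_getElem, (List.cons.inj hi).1]
    exact h

theorem steps_split (P : List (Instr S W D O)) (split : I → W × D) (s₀ : S) (l : List I)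
    (k : W → List D) :
    Steps (machine P split s₀).step (l.length + 1) (toCfg (some none) l ⟨s₀, k, []⟩)
      (toCfg (some (label P.length 0)) [] ⟨s₀, pushAll (l.map split) k, []⟩) := by
  have key (l : List I) (c : Config S W D O) :
      (machine P split s₀).step (toCfg (some none) l c) =
        some (match l with
          | [] => toCfg (some (label P.length 0)) [] c
          | x :: l => toCfg (some none) l (c.act (c.st, [split x], []))) := by
    refine congrArg some ?_
    change TM2.stepAux (popInput _ _) _ _ = _
    refine ((stepAux_popInput ..).trans (stepAux_caseOn _ (by simp) _)).trans ?_
    cases l with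
    | nil => exact stepAux_actStmt ..
    | cons x l => exact stepAux_actStmt ..
  induction l generalizing k with
  | nil => exact .head (key _ _) (.refl _ _)
  | cons x l ih => exact .head (key _ _) (ih _)

/-- A function that is computed by a program is computed by a Turing machine in polynomial time. -/
theorem polyTime_of_progRuns {α β : Type} (ea : α → List I) (eb : β → List O) (f : α → β)
    (P : List (Instr S W D O)) (hP : ∀ A ∈ P, A.Safe) (split : I → W × D) (s₀ : S)
    (h : ∀ a, ∃ t s, ProgRuns P ⟨s₀, pushAll ((ea a).map split) fun _ => [], []⟩ t
      ⟨s, fun _ => [], eb (f a)⟩) : Nonempty (TM2ComputableInPolyTime ea eb f) := by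
  obtain ⟨C, hC⟩ := ProgRuns.exists_bound P hP
  refine ⟨⟨⟨machine P split s₀, Equiv.refl _, Equiv.refl _⟩,
    -- Distributing the input takes its length plus one steps, the program at most `C` times as
    -- many, and halting one more.
    Polynomial.C (C + 1) * (Polynomial.X + 1) + 1, fun a => ?_⟩⟩
  choose t s hr using h
  refine ⟨⟨(ea a).length + 1 + (t a + 1), ?_⟩, ?_⟩
  · have h1 := (steps_split P split s₀ (ea a) fun _ => []).trans
      (((hr a).steps P split s₀ 0 rfl).trans (.head (f := (machine P split s₀).step) (c := 
        toCfg none [] ⟨s₀, fun _ => [], eb (f a)⟩) rfl (.refl _ _)))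
    have h2 : toCfg (some none) (ea a) ⟨s₀, fun _ => [], []⟩ =
        initList (machine P split s₀) ((ea a).map (Equiv.refl I).invFun) := by
      refine congrArg (TM2.Cfg.mk _ _) (funext fun k => ?_)
      rcases k with - | - | w
      · exact (List.map_id _).symm
      · rfl
      · rfl
    have h3 : toCfg none [] ⟨s₀, fun _ => [], eb (f a)⟩ =
        haltList (machine P split s₀) ((eb (f a)).map (Equiv.refl O).invFun) := by
      refine congrArg (TM2.Cfg.mk _ _) (funext fun k => ?_)
      rcases k with - | - | w
      · rfl
      · exact (List.map_id _).symm
      · rfl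
    rw [h2, h3] at h1
    exact h1
  · have h1 := hC _ _ _ (hr a)
    have h2 : size (pushAll ((ea a).map split) fun _ => ([] : List D)) = (ea a).length := by
      rw [size_pushAll, List.length_map, size]
      simp
    dsimp only at h1
    rw [h2] at h1
    simp only [Polynomial.eval_add, Polynomial.eval_mul, Polynomial.eval_C, Polynomial.eval_X,
      Polynomial.eval_one]
    linarith

end runs

end machine

end StackProgram

namespace StackProgram

/-! ### Transducers on a family of words -/

variable {J S ι O : Type} [DecidableEq J]

/-- The data that a transducer changes: the state, the word to which letters are appended, a counter
and the output. -/
@[ext]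
structure Reg (S ι O : Type) where
  /-- the state -/
  st : S
  /-- the word that is written -/
  word : List (ι × Bool)
  /-- the counter -/
  ctr : ℤ
  /-- the output -/
  out : List O

/-- The effect of one letter: the new state, the letters that are written, the change of the counter
and the word that is prepended to the output. -/
abbrev Effect (S ι O : Type) : Type := S × List (ι × Bool) × Option Bool × List O

/-- The integer for a sign. -/
def signVal : Option Bool → ℤ
  | none => 0
  | some true => 1
  | some false => -1

/-- Applies an effect. -/
def Reg.app (R : Reg S ι O) (e : Effect S ι O) : Reg S ι O :=
  ⟨e.1, R.word ++ e.2.1, R.ctr + signVal e.2.2.1, e.2.2.2 ++ R.out⟩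

/-- An operation on a family of words: the word `src` is read from right to left by the
transducer `bwd` and then from left to right by the transducer `fwd`, and finally `fin` is
performed, which may test whether the counter is zero. The word `tgt` is extended. -/
structure Op (J S ι O : Type) where
  /-- the word that is read -/
  src : J
  /-- the word that is written -/
  tgt : J
  /-- the action for a letter on the way from right to left -/
  bwd : S → ι × Bool → Effect S ι O
  /-- the action for a letter on the way from left to right -/
  fwd : S → ι × Bool → Effect S ι O
  /-- the action at the end -/
  fin : S → Bool → S × List (ι × Bool) × List O

/-- A family of words together with the state, the counter and the output. -/
@[ext]
structure Mem (J S ι O : Type) where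
  /-- the state -/
  st : S
  /-- the words -/
  words : J → List (ι × Bool)
  /-- the counter -/
  ctr : ℤ
  /-- the output -/
  out : List O

/-- The final action on the data of a transducer. -/
def Reg.fin (R : Reg S ι O) (f : S → Bool → S × List (ι × Bool) × List O) : Reg S ι O :=
  R.app ((f R.st (decide (R.ctr = 0))).1, (f R.st (decide (R.ctr = 0))).2.1, none,
    (f R.st (decide (R.ctr = 0))).2.2)

/-- The result of an operation on the data of the transducers. -/
def Op.reg (o : Op J S ι O) (u : List (ι × Bool)) (R : Reg S ι O) : Reg S ι O :=
  Reg.fin (u.foldl (fun R d => R.app (o.fwd R.st d)) (u.foldr (fun d R => R.app (o.bwd R.st d)) R))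
    o.fin

/-- The data for a transducer that writes the given word. -/
def Mem.reg (M : Mem J S ι O) (j : J) : Reg S ι O := ⟨M.st, M.words j, M.ctr, M.out⟩

/-- Stores the data of a transducer. -/
def Mem.set (M : Mem J S ι O) (j : J) (R : Reg S ι O) : Mem J S ι O :=
  ⟨R.st, Function.update M.words j R.word, R.ctr, R.out⟩

/-- The result of an operation. -/
def Op.apply (o : Op J S ι O) (M : Mem J S ι O) : Mem J S ι O :=
  M.set o.tgt (o.reg (M.words o.src) (M.reg o.tgt))

/-! ### Compilation of operations to loops -/

/-- The stack that represents the value `z` of the counter. -/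
def ctrStack (i₀ : ι) (z : ℤ) : List (ι × Bool) := List.replicate z.natAbs (i₀, decide (0 < z))

/-- The letters to be pushed on the counter stack after removing its top. -/
def ctrPush (i₀ : ι) : Option (ι × Bool) → Option Bool → List (ι × Bool)
  | o, none => o.toList
  | none, some b => [(i₀, b)]
  | some d, some b => if d.2 = b then [d, d] else []

/-- The counter is unary with the sign stored in its letters, and each iteration has already popped
its top. A change of the same sign puts back two letters, one of the opposite sign puts back none,
and no change restores the letter. -/
theorem ctrPush_ctrStack (i₀ : ι) (z : ℤ) (e : Option Bool) :
    (ctrPush i₀ (ctrStack i₀ z).head? e).reverse ++ (ctrStack i₀ z).tail =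
      ctrStack i₀ (z + signVal e) := by
  rcases e with - | e
  · rw [signVal, add_zero]
    cases h : ctrStack i₀ z <;> simp [ctrPush]
  · rcases lt_trichotomy z 0 with h | rfl | h
    · obtain ⟨m, rfl⟩ : ∃ m : ℕ, z = -(m + 1) := ⟨z.natAbs - 1, by omega⟩
      have h1 : ctrStack i₀ (-(m + 1)) = List.replicate (m + 1) (i₀, false) := by
        rw [ctrStack, decide_eq_false (by omega), show (-(m + 1 : ℤ)).natAbs = m + 1 by omega]
      rw [h1, List.replicate_succ]
      cases e
      · rw [signVal, ctrStack, decide_eq_false (by omega),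
          show (-(m + 1 : ℤ) + -1).natAbs = m + 2 by omega]
        rfl
      · rw [signVal, ctrStack, decide_eq_false (by omega),
          show (-(m + 1 : ℤ) + 1).natAbs = m by omega]
        rfl
    · cases e <;> rfl
    · obtain ⟨m, rfl⟩ : ∃ m : ℕ, z = m + 1 := ⟨z.natAbs - 1, by omega⟩
      have h1 : ctrStack i₀ (m + 1) = List.replicate (m + 1) (i₀, true) := by
        rw [ctrStack, decide_eq_true (by omega), show (m + 1 : ℤ).natAbs = m + 1 by omega]
      rw [h1, List.replicate_succ]
      cases e
      · rcases m with - | m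
        · rfl
        · rw [signVal, ctrStack, decide_eq_true (by push_cast; omega),
            show (((m + 1 : ℕ) : ℤ) + 1 + -1).natAbs = m + 1 by omega]
          rfl
      · rw [signVal, ctrStack, decide_eq_true (by omega),
          show ((m : ℤ) + 1 + 1).natAbs = m + 2 by omega]
        rfl

theorem isNone_head?_ctrStack (i₀ : ι) (z : ℤ) :
    (ctrStack i₀ z).head?.isNone = decide (z = 0) := by
  by_cases h : z = 0
  · subst h; rfl
  · obtain ⟨m, hm⟩ : ∃ m, z.natAbs = m + 1 := ⟨z.natAbs - 1, by omega⟩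
    simp [ctrStack, hm, h]

/-- The loop for one direction of an operation. -/
def passInstr (i₀ : ι) (src : J) (b : Bool) (tgt : J) (f : S → ι × Bool → Effect S ι O)
    (fin : S → Bool → S × List (ι × Bool) × List O) :
    Instr S (Option (J × Bool)) (ι × Bool) O where
  src := some (src, b)
  aux := none
  step s d o := ((f s d).1, (f s d).2.1.map (some (tgt, false), ·) ++
    (ctrPush i₀ o (f s d).2.2.1).map (none, ·) ++ [(some (src, !b), d)], (f s d).2.2.2)
  fin s o := ((fin s o.isNone).1, (fin s o.isNone).2.1.map (some (tgt, false), ·) ++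
    (ctrPush i₀ o none).map (none, ·), (fin s o.isNone).2.2)

/-- The loops of an operation. -/
def Op.instrs (i₀ : ι) (o : Op J S ι O) : List (Instr S (Option (J × Bool)) (ι × Bool) O) :=
  [passInstr i₀ o.src false o.tgt o.bwd fun s _ => (s, [], []),
    passInstr i₀ o.src true o.tgt o.fwd o.fin]

/-- The stacks during an operation. -/
def layout (i₀ : ι) (v : J → List (ι × Bool)) (j t : J) (x y m : List (ι × Bool)) (z : ℤ) :
    Option (J × Bool) → List (ι × Bool)
  | none => ctrStack i₀ z
  | some (i, b) => if i = j then bif b then y else x else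
      bif b then [] else if i = t then m.reverse else (v i).reverse

/-- The configuration that represents a family of words. -/
def Mem.cfg (i₀ : ι) (M : Mem J S ι O) : Config S (Option (J × Bool)) (ι × Bool) O :=
  ⟨M.st, fun
    | none => ctrStack i₀ M.ctr
    | some (i, b) => bif b then [] else (M.words i).reverse, M.out⟩

theorem pushAll_append {W D : Type} [DecidableEq W] (l l' : List (W × D)) (k : W → List D) :
    pushAll (l ++ l') k = pushAll l' (pushAll l k) := by
  induction l generalizing k with
  | nil => rfl
  | cons x l ih => exact ih _

theorem pushAll_map {W D : Type} [DecidableEq W] (w : W) (l : List D) (k : W → List D) :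
    pushAll (l.map (w, ·)) k = Function.update k w (l.reverse ++ k w) := by
  induction l generalizing k with
  | nil => simp [pushAll]
  | cons x l ih => simp [pushAll, ih]

theorem act_step_bwd (i₀ : ι) (v : J → List (ι × Bool)) {j t : J} (hjt : j ≠ t)
    (f : S → ι × Bool → Effect S ι O) (fin : S → Bool → S × List (ι × Bool) × List O)
    (R : Reg S ι O) (d : ι × Bool) (x y : List (ι × Bool)) :
    (((Config.mk R.st (layout i₀ v j t (d :: x) y R.word R.ctr) R.out).pop
      (passInstr i₀ j false t f fin).src).pop (passInstr i₀ j false t f fin).aux).act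
      ((passInstr i₀ j false t f fin).step R.st d (ctrStack i₀ R.ctr).head?) =
    ⟨(R.app (f R.st d)).st, layout i₀ v j t x (d :: y) (R.app (f R.st d)).word
      (R.app (f R.st d)).ctr, (R.app (f R.st d)).out⟩ := by
  refine Config.ext rfl (funext fun w => ?_) rfl
  simp only [Config.act, Config.pop, passInstr, pushAll_append, pushAll_map, pushAll]
  rcases w with - | ⟨i, b⟩
  · simpa [layout, Reg.app, Reg.fin] using ctrPush_ctrStack i₀ R.ctr (f R.st d).2.2.1
  · by_cases hi : i = j
    · subst hi
      cases b <;> simp [layout, Function.update_apply, hjt]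
    · by_cases hi' : i = t
      · subst hi'
        cases b <;> simp [layout, hi, Reg.app]
      · cases b <;> simp [layout, Function.update_apply, hi, hi']

theorem act_step_fwd (i₀ : ι) (v : J → List (ι × Bool)) {j t : J} (hjt : j ≠ t)
    (f : S → ι × Bool → Effect S ι O) (fin : S → Bool → S × List (ι × Bool) × List O)
    (R : Reg S ι O) (d : ι × Bool) (x y : List (ι × Bool)) :
    (((Config.mk R.st (layout i₀ v j t x (d :: y) R.word R.ctr) R.out).pop
      (passInstr i₀ j true t f fin).src).pop (passInstr i₀ j true t f fin).aux).act
      ((passInstr i₀ j true t f fin).step R.st d (ctrStack i₀ R.ctr).head?) =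
    ⟨(R.app (f R.st d)).st, layout i₀ v j t (d :: x) y (R.app (f R.st d)).word
      (R.app (f R.st d)).ctr, (R.app (f R.st d)).out⟩ := by
  refine Config.ext rfl (funext fun w => ?_) rfl
  simp only [Config.act, Config.pop, passInstr, pushAll_append, pushAll_map, pushAll]
  rcases w with - | ⟨i, b⟩
  · simpa [layout, Reg.app, Reg.fin] using ctrPush_ctrStack i₀ R.ctr (f R.st d).2.2.1
  · by_cases hi : i = j
    · subst hi
      cases b <;> simp [layout, hjt]
    · by_cases hi' : i = t
      · subst hi'
        cases b <;> simp [layout, hi, Reg.app]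
      · cases b <;> simp [layout, Function.update_apply, hi, hi']

theorem act_fin (i₀ : ι) (v : J → List (ι × Bool)) {j t : J} (hjt : j ≠ t) (b : Bool)
    (f : S → ι × Bool → Effect S ι O) (fin : S → Bool → S × List (ι × Bool) × List O)
    (R : Reg S ι O) {x y : List (ι × Bool)} (hxy : (bif b then y else x) = []) :
    (((Config.mk R.st (layout i₀ v j t x y R.word R.ctr) R.out).pop
      (passInstr i₀ j b t f fin).src).pop (passInstr i₀ j b t f fin).aux).act
      ((passInstr i₀ j b t f fin).fin R.st (ctrStack i₀ R.ctr).head?) =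
    ⟨(R.fin fin).st, layout i₀ v j t x y (R.fin fin).word (R.fin fin).ctr, (R.fin fin).out⟩ := by
  have h := isNone_head?_ctrStack i₀ R.ctr
  refine Config.ext (by simp [passInstr, h, Config.act, Reg.fin, Reg.app])
    (funext fun w => ?_) (by simp [passInstr, h, Config.act, Reg.fin, Reg.app, Config.pop])
  simp only [Config.act, Config.pop, passInstr, pushAll_append, pushAll_map, h]
  rcases w with - | ⟨i, b'⟩
  · simpa [layout, Reg.app, Reg.fin] using ctrPush_ctrStack i₀ R.ctr none
  · by_cases hi : i = j
    · subst hi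
      cases b <;> cases b' <;> simp_all [layout, Function.update_apply]
    · by_cases hi' : i = t
      · subst hi'
        cases b' <;> simp [layout, hi, Reg.app, Reg.fin]
      · cases b' <;> simp [layout, Function.update_apply, hi, hi']

theorem head?_stk_pop (i₀ : ι) (v : J → List (ι × Bool)) (j t : J) (b : Bool)
    (f : S → ι × Bool → Effect S ι O) (fin : S → Bool → S × List (ι × Bool) × List O)
    (R : Reg S ι O) (x y : List (ι × Bool)) :
    (((Config.mk R.st (layout i₀ v j t x y R.word R.ctr) R.out).pop
      (passInstr i₀ j b t f fin).src).stk (passInstr i₀ j b t f fin).aux) =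
      ctrStack i₀ R.ctr := by
  simp [Config.pop, passInstr, layout]

theorem exists_runs_bwd (i₀ : ι) (v : J → List (ι × Bool)) {j t : J} (hjt : j ≠ t)
    (f : S → ι × Bool → Effect S ι O) (fin : S → Bool → S × List (ι × Bool) × List O)
    (x y : List (ι × Bool)) (R R' : Reg S ι O)
    (hR : R' = (x.foldl (fun R d => R.app (f R.st d)) R).fin fin) :
    ∃ k, (passInstr i₀ j false t f fin).Runs
      ⟨R.st, layout i₀ v j t x y R.word R.ctr, R.out⟩ k
      ⟨R'.st, layout i₀ v j t [] (x.reverse ++ y) R'.word R'.ctr, R'.out⟩ := by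
  induction x generalizing R y with
  | nil =>
    subst hR
    have h := Instr.Runs.fin (A := passInstr i₀ j false t f fin)
      ⟨R.st, layout i₀ v j t [] y R.word R.ctr, R.out⟩ (by simp [passInstr, layout])
    rw [head?_stk_pop, act_fin _ _ hjt _ _ _ _ rfl] at h
    exact ⟨_, h⟩
  | cons d x ih =>
    obtain ⟨k, hk⟩ := ih (d :: y) (R.app (f R.st d)) hR
    refine ⟨k + 1, .step _ d (by simp [passInstr, layout]) ?_⟩
    rw [head?_stk_pop, act_step_bwd _ _ hjt]
    simpa using hk

theorem exists_runs_fwd (i₀ : ι) (v : J → List (ι × Bool)) {j t : J} (hjt : j ≠ t)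
    (f : S → ι × Bool → Effect S ι O) (fin : S → Bool → S × List (ι × Bool) × List O)
    (x y : List (ι × Bool)) (R R' : Reg S ι O)
    (hR : R' = (y.foldl (fun R d => R.app (f R.st d)) R).fin fin) :
    ∃ k, (passInstr i₀ j true t f fin).Runs
      ⟨R.st, layout i₀ v j t x y R.word R.ctr, R.out⟩ k
      ⟨R'.st, layout i₀ v j t (y.reverse ++ x) [] R'.word R'.ctr, R'.out⟩ := by
  induction y generalizing R x with
  | nil =>
    subst hR
    have h := Instr.Runs.fin (A := passInstr i₀ j true t f fin)
      ⟨R.st, layout i₀ v j t x [] R.word R.ctr, R.out⟩ (by simp [passInstr, layout])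
    rw [head?_stk_pop, act_fin _ _ hjt _ _ _ _ rfl] at h
    exact ⟨_, h⟩
  | cons d y ih =>
    obtain ⟨k, hk⟩ := ih (d :: x) (R.app (f R.st d)) hR
    refine ⟨k + 1, .step _ d (by simp [passInstr, layout]) ?_⟩
    rw [head?_stk_pop, act_step_fwd _ _ hjt]
    simpa using hk

theorem Mem.cfg_eq (i₀ : ι) (M : Mem J S ι O) {j t : J} (hjt : j ≠ t) (R : Reg S ι O) :
    (M.set t R).cfg i₀ =
      ⟨R.st, layout i₀ M.words j t (M.words j).reverse [] R.word R.ctr, R.out⟩ := by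
  refine Config.ext rfl (funext fun w => ?_) rfl
  rcases w with - | ⟨i, b⟩
  · rfl
  · by_cases hi : i = j
    · subst hi
      simp [Mem.cfg, Mem.set, layout, hjt]
    · by_cases hi' : i = t
      · subst hi'
        simp [Mem.cfg, Mem.set, layout, hi]
      · simp [Mem.cfg, Mem.set, layout, hi, hi']

/-- Between operations each word lies on its `false` stack with its last letter on top. The first
loop moves it to the `true` stack, reading from right to left; the second moves it back, reading
from left to right, so the word is restored. -/
theorem Op.exists_progRuns (i₀ : ι) (o : Op J S ι O) (h : o.src ≠ o.tgt) (M : Mem J S ι O) :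
    ∃ k, ProgRuns (o.instrs i₀) (M.cfg i₀) k ((o.apply M).cfg i₀) := by
  have h0 (R : Reg S ι O) : R.fin (fun s _ => (s, [], [])) = R :=
    Reg.ext rfl (List.append_nil _) (add_zero _) rfl
  have h1 := M.cfg_eq i₀ h (M.reg o.tgt)
  have h2 : M.set o.tgt (M.reg o.tgt) = M := Mem.ext rfl (by simp [Mem.set, Mem.reg]) rfl rfl
  rw [h2] at h1
  rw [h1, Op.apply, M.cfg_eq i₀ h]
  obtain ⟨k, hk⟩ := exists_runs_bwd i₀ M.words h o.bwd (fun s _ => (s, [], []))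
    (M.words o.src).reverse [] (M.reg o.tgt) _ rfl
  obtain ⟨k', hk₂⟩ := exists_runs_fwd i₀ M.words h o.fwd o.fin []
    ((M.words o.src).reverse.reverse ++ []) (((M.words o.src).reverse.foldl
      (fun R d => R.app (o.bwd R.st d)) (M.reg o.tgt)).fin fun s _ => (s, [], [])) _ rfl
  refine ⟨k + (k' + 0), .cons hk (.cons ?_ (.nil _))⟩
  simp only [h0, List.reverse_reverse, List.append_nil, List.foldl_reverse] at hk₂ ⊢
  exact hk₂

/-- The result of a list of operations. -/
def applyAll (l : List (Op J S ι O)) (M : Mem J S ι O) : Mem J S ι O :=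
  l.foldl (fun M o => o.apply M) M

theorem applyAll_append (l l' : List (Op J S ι O)) (M : Mem J S ι O) :
    applyAll (l ++ l') M = applyAll l' (applyAll l M) := List.foldl_append ..

theorem exists_progRuns_flatMap (i₀ : ι) (l : List (Op J S ι O)) (h : ∀ o ∈ l, o.src ≠ o.tgt)
    (M : Mem J S ι O) :
    ∃ k, ProgRuns (l.flatMap (Op.instrs i₀)) (M.cfg i₀) k ((applyAll l M).cfg i₀) := by
  induction l generalizing M with
  | nil => exact ⟨0, .nil _⟩
  | cons o l ih =>
    obtain ⟨k, hk⟩ := o.exists_progRuns i₀ (h o List.mem_cons_self) M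
    obtain ⟨k', hk₂⟩ := ih (fun o' h' => h o' (List.mem_cons_of_mem _ h')) (o.apply M)
    exact ⟨_, hk.append hk₂⟩

/-- The loop that empties a stack. -/
def clearInstr {W D : Type} (w w' : W) : Instr S W D O where
  src := w
  aux := w'
  step s _ _ := (s, [], [])
  fin s _ := (s, [], [])

theorem exists_runs_clearInstr {W D : Type} [DecidableEq W] {w w' : W} (h : w ≠ w') (s : S)
    (k : W → List D) (o : List O) : ∃ t k', (clearInstr w w').Runs ⟨s, k, o⟩ t ⟨s, k', o⟩ ∧
      k' w = [] ∧ ∀ x, k x = [] → k' x = [] := by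
  generalize hu : k w = u
  induction u generalizing k with
  | nil =>
    refine ⟨_, _, .fin _ hu, ?_, fun x hx => ?_⟩
    · simp [Config.pop, clearInstr, pushAll, h, hu]
    · by_cases h1 : x = w <;> by_cases h2 : x = w' <;> simp_all [Config.pop, clearInstr, pushAll,
        Function.update_apply]
  | cons d u ih =>
    obtain ⟨t, k', h1, h2, h3⟩ := ih (Function.update (Function.update k w (k w).tail) w'
      (Function.update k w (k w).tail w').tail) (by simp [h, hu])
    refine ⟨_, k', .step _ d (by simp [clearInstr, hu]) h1, h2, fun x hx => h3 x ?_⟩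
    by_cases h1 : x = w <;> by_cases h2 : x = w' <;> simp_all [Function.update_apply]

theorem exists_progRuns_clearInstr {W D : Type} [DecidableEq W] (l : List (W × W))
    (h : ∀ x ∈ l, x.1 ≠ x.2) (s : S) (k : W → List D) (o : List O) :
    ∃ t k', ProgRuns (l.map fun x => clearInstr x.1 x.2) ⟨s, k, o⟩ t ⟨s, k', o⟩ ∧
      (∀ x ∈ l, k' x.1 = []) ∧ ∀ x, k x = [] → k' x = [] := by
  induction l generalizing k with
  | nil => exact ⟨0, k, .nil _, by simp, fun _ h => h⟩
  | cons x l ih =>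
    obtain ⟨t, k1, h1, h2, h3⟩ := exists_runs_clearInstr (h x List.mem_cons_self) s k o
    obtain ⟨t', k2, h4, h5, h6⟩ := ih (fun x hx => h x (List.mem_cons_of_mem _ hx)) k1
    refine ⟨_, k2, .cons h1 h4, fun y hy => ?_, fun y hy => h6 y (h3 y hy)⟩
    rcases List.mem_cons.1 hy with rfl | hy
    · exact h6 _ h2
    · exact h5 y hy

/-- A function that is computed by a list of operations is computed by a Turing machine in
polynomial time. -/
theorem polyTime_of_applyAll [Fintype J] [Nonempty J] [DecidableEq S] [Fintype S] [DecidableEq ι]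
    [Fintype ι] (i₀ : ι) {α β I : Type} [DecidableEq I] [Fintype I] (ea : α → List I)
    (eb : β → List O) (f : α → β) (l : List (Op J S ι O)) (hl : ∀ o ∈ l, o.src ≠ o.tgt)
    (split : I → J × (ι × Bool)) (s₀ : S)
    (h : ∀ a, (applyAll l ⟨s₀, fun j => ((ea a).map split).filterMap fun x =>
      if x.1 = j then some x.2 else none, 0, []⟩).out = eb (f a)) :
    Nonempty (Turing.TM2ComputableInPolyTime ea eb f) := by
  -- Every loop needs an auxiliary stack different from its source, so each stack to be emptied is
  -- paired with another one.
  let w : Option (J × Bool) → Option (J × Bool) × Option (J × Bool)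
    | none => (none, some (Classical.arbitrary J, true))
    | some x => (some x, none)
  have hw1 (x) : (w x).1 = x := by cases x <;> rfl
  have hw2 (x) : (w x).1 ≠ (w x).2 := by cases x <;> simp [w]
  refine polyTime_of_progRuns ea eb f (l.flatMap (Op.instrs i₀) ++
    (Finset.univ.toList.map w).map fun x => clearInstr x.1 x.2) ?_
    (fun x => (some ((split x).1, false), (split x).2)) s₀ fun a => ?_
  · intro A hA
    rcases List.mem_append.1 hA with hA | hA
    · obtain ⟨o, ho, hA⟩ := List.mem_flatMap.1 hA
      have := hl o ho
      simp only [Op.instrs, List.mem_cons, List.not_mem_nil, or_false] at hA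
      rcases hA with rfl | rfl <;> refine ⟨by simp [passInstr], fun s d c x hx => ?_⟩ <;>
        simp only [passInstr, List.mem_append, List.mem_map, List.mem_singleton] at hx ⊢ <;>
        rcases hx with (⟨_, _, rfl⟩ | ⟨_, _, rfl⟩) | rfl <;> simp [this.symm]
    · simp only [List.map_map, List.mem_map] at hA
      obtain ⟨x, -, rfl⟩ := hA
      exact ⟨(hw2 x).symm, fun s d o y hy => by simp [clearInstr] at hy⟩
  · set M : Mem J S ι O := ⟨s₀, fun j => ((ea a).map split).filterMap fun x =>
      if x.1 = j then some x.2 else none, 0, []⟩ with hM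
    obtain ⟨t, ht⟩ := exists_progRuns_flatMap i₀ l hl M
    obtain ⟨t', k', h1, h2, -⟩ := exists_progRuns_clearInstr (Finset.univ.toList.map w)
      (by simpa using fun x => hw2 x) (applyAll l M).st ((applyAll l M).cfg i₀).stk
      (applyAll l M).out
    -- The halting configuration requires all working stacks to be empty, which is the purpose of
    -- the clearing loops.
    have h3 : k' = fun _ => [] := funext fun x => by
      simpa [hw1] using h2 (w x) (List.mem_map_of_mem (by simp))
    have h4 : M.cfg i₀ = ⟨s₀, pushAll ((ea a).map fun x => (some ((split x).1, false), (split x).2))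
        fun _ => [], []⟩ := by
      refine Config.ext rfl ?_ rfl
      have key (u : List I) (k : Option (J × Bool) → List (ι × Bool)) (x : Option (J × Bool)) :
          pushAll (u.map fun x => (some ((split x).1, false), (split x).2)) k x = (match x with
            | none => []
            | some (i, b) => bif b then [] else ((u.map split).filterMap fun x =>
              if x.1 = i then some x.2 else none).reverse) ++ k x := by
        induction u generalizing k with
        | nil => rcases x with - | ⟨i, - | -⟩ <;> rfl
        | cons d u ih =>
          rw [List.map_cons, pushAll, ih]
          rcases x with - | ⟨i, - | -⟩
          · simp
          · by_cases hi : (split d).1 = i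
            · subst hi; simp
            · simp [hi, Ne.symm hi]
          · simp
      funext x
      refine Eq.trans ?_ ((key _ _ x).trans (List.append_nil _)).symm
      rcases x with - | ⟨i, b⟩
      · rfl
      · rfl
    rw [h3] at h1
    rw [← h4, ← h a]
    exact ⟨_, _, ht.append h1⟩

end StackProgram

namespace StackProgram

/-! ### Operations that only write the output -/

variable {J S ι O : Type}

/-- The operation that only performs a final action. -/
def Op.ofFin (src tgt : J) (fin : S → Bool → S × List (ι × Bool) × List O) : Op J S ι O :=
  ⟨src, tgt, fun s _ => (s, [], none, []), fun s _ => (s, [], none, []), fin⟩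

theorem Reg.app_eq_self (R : Reg S ι O) : R.app (R.st, [], none, []) = R :=
  Reg.ext rfl (List.append_nil _) (add_zero _) rfl

theorem Op.reg_ofFin (src tgt : J) (fin : S → Bool → S × List (ι × Bool) × List O)
    (u : List (ι × Bool)) (R : Reg S ι O) : (Op.ofFin src tgt fin).reg u R = R.fin fin := by
  simp [Op.reg, Op.ofFin, Reg.app_eq_self]

/-- An operation that prepends to the output the images of the letters of the word `src`, in the
same order by `e₁` and in reverse order by `e₂`, and a constant word. -/
structure Token (J S ι O : Type) where
  /-- the word that is read -/
  src : J
  /-- another word -/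
  tgt : J
  /-- the image of a letter of the word -/
  e₁ : S → ι × Bool → List O
  /-- the image of a letter of the reversed word -/
  e₂ : S → ι × Bool → List O
  /-- the constant word -/
  c : S → List O

/-- The operation for a token. -/
def Token.op (k : Token J S ι O) : Op J S ι O :=
  ⟨k.src, k.tgt, fun s d => (s, [], none, k.e₁ s d), fun s d => (s, [], none, k.e₂ s d),
    fun s _ => (s, [], k.c s)⟩

/-- The word that is prepended to the output. -/
def Token.val (k : Token J S ι O) (s : S) (v : J → List (ι × Bool)) : List O :=
  k.c s ++ (v k.src).reverse.flatMap (k.e₂ s) ++ (v k.src).flatMap (k.e₁ s)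

theorem Token.apply_op [DecidableEq J] (k : Token J S ι O) (M : Mem J S ι O) :
    k.op.apply M = ⟨M.st, M.words, M.ctr, k.val M.st M.words ++ M.out⟩ := by
  have h1 (e : S → ι × Bool → List O) (u : List (ι × Bool)) (R : Reg S ι O) :
      u.foldr (fun d R => R.app (R.st, [], none, e R.st d)) R =
        ⟨R.st, R.word, R.ctr, u.flatMap (e R.st) ++ R.out⟩ := by
    induction u with
    | nil => rfl
    | cons d u ih => rw [List.foldr_cons, ih]; simp [Reg.app, signVal]
  have h2 (e : S → ι × Bool → List O) (u : List (ι × Bool)) (R : Reg S ι O) :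
      u.foldl (fun R d => R.app (R.st, [], none, e R.st d)) R =
        ⟨R.st, R.word, R.ctr, u.reverse.flatMap (e R.st) ++ R.out⟩ := by
    rw [← h1, List.foldr_reverse]
  simp only [Op.apply, Op.reg, Token.op, h1, h2]
  refine Mem.ext rfl ?_ ?_ ?_ <;> simp [Mem.set, Mem.reg, Reg.fin, Reg.app, signVal, Token.val]

/-- The output grows at its front, so the operation of the last token has to run first. -/
theorem applyAll_tokens [DecidableEq J] (l : List (Token J S ι O)) (M : Mem J S ι O) :
    applyAll (l.reverse.map Token.op) M =
      ⟨M.st, M.words, M.ctr, l.flatMap (fun k => k.val M.st M.words) ++ M.out⟩ := by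
  induction l with
  | nil => rfl
  | cons k l ih =>
    rw [List.reverse_cons, List.map_append, applyAll_append, ih]
    refine (Token.apply_op k _).trans ?_
    simp

/-- The token for a constant word. -/
def Token.const (src tgt : J) (c : S → List O) : Token J S ι O :=
  ⟨src, tgt, fun _ _ => [], fun _ _ => [], c⟩

/-- The token for the image of a word. -/
def Token.fwd (src tgt : J) (e : S → ι × Bool → List O) : Token J S ι O :=
  ⟨src, tgt, e, fun _ _ => [], fun _ => []⟩

/-- The token for the image of the formal inverse of a word. -/
def Token.inv (src tgt : J) (e : S → ι × Bool → List O) : Token J S ι O :=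
  ⟨src, tgt, fun _ _ => [], fun s d => e s (d.1, !d.2), fun _ => []⟩

@[simp]
theorem Token.val_const (src tgt : J) (c : S → List O) (s : S) (v : J → List (ι × Bool)) :
    (Token.const src tgt c).val s v = c s := by simp [Token.val, Token.const]

@[simp]
theorem Token.val_fwd (src tgt : J) (e : S → ι × Bool → List O) (s : S)
    (v : J → List (ι × Bool)) : (Token.fwd src tgt e).val s v = (v src).flatMap (e s) := by
  simp [Token.val, Token.fwd]

@[simp]
theorem Token.val_inv (src tgt : J) (e : S → ι × Bool → List O) (s : S)
    (v : J → List (ι × Bool)) :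
    (Token.inv src tgt e).val s v = (FreeGroup.invRev (v src)).flatMap (e s) := by
  simp [Token.val, Token.inv, FreeGroup.invRev, ← List.map_reverse, List.flatMap_map]

end StackProgram

namespace Braid

open StackProgram

/-! ### The machine for the query -/

variable {n p q : ℕ}

/-- The tokens for the code of a system of conjugacy equations. -/
def queryTokens (c : Fin p → BraidWord n) (d : Fin q → BraidWord n) :
    List (Token Bool Unit (Fin (n - 1))
      (Option ((Fin (n - 1) × Bool) ⊕ (Fin (n - 1) × Bool)))) :=
  ((List.ofFn c).map fun w => Token.const true false fun _ =>
    w.map (some ∘ .inl) ++ w.map (some ∘ .inr) ++ [none]) ++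
  -- Slot `true` holds g and slot `false` holds g'. The tokens spell g d g⁻¹ in left letters, then
  -- g' d g'⁻¹ in right letters, then the separator.
  (List.ofFn d).flatMap fun w =>
    [.fwd true false fun _ x => [some (.inl x)], .const true false fun _ => w.map (some ∘ .inl),
      .inv true false fun _ x => [some (.inl x)],
      .fwd false true fun _ x => [some (.inr x)], .const true false fun _ => w.map (some ∘ .inr),
      .inv false true fun _ x => [some (.inr x)], .const true false fun _ => [none]]

theorem polyTime_systemInstance (h2 : 2 ≤ n) (c : Fin p → BraidWord n) (d : Fin q → BraidWord n) :
    Nonempty (Turing.TM2ComputableInPolyTime (wordPairEncoding n).encode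
      (sepEncoding (wordPairEncoding n)).encode (systemInstance c d)) := by
  refine polyTime_of_applyAll (J := Bool) (S := Unit) (ι := Fin (n - 1)) ⟨0, by omega⟩ _ _ _
    ((queryTokens c d).reverse.map Token.op) ?_
    (fun | .inl x => (true, x) | .inr x => (false, x)) () fun gg => ?_
  · intro o ho
    simp only [queryTokens, List.mem_map, List.mem_reverse, List.mem_append, List.mem_flatMap,
      List.mem_cons, List.not_mem_nil, or_false] at ho
    obtain ⟨k, ⟨_, _, rfl⟩ | ⟨_, _, rfl | rfl | rfl | rfl | rfl | rfl | rfl⟩, rfl⟩ := ho <;>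
      simp [Token.op, Token.const, Token.fwd, Token.inv]
  · obtain ⟨g, g'⟩ := gg
    rw [applyAll_tokens]
    have hw (j : Bool) : ((((wordPairEncoding n).encode (g, g')).map
        (fun | .inl x => (true, x) | .inr x => (false, x)) :
          List (Bool × (Fin (n - 1) × Bool))).filterMap fun x =>
        if x.1 = j then some x.2 else none) = if j then g else g' := by
      cases j <;> simp [wordPairEncoding, wordEncoding, Computability.encodingProd,
        Computability.encodingList, List.filterMap_append, List.filterMap_map, Function.comp_def]
    simp only [hw]
    have h3 : systemInstance c d (g, g') = (List.ofFn c).map (fun w => (w, w)) ++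
        (List.ofFn d).map fun w => (g ++ w ++ FreeGroup.invRev g, g' ++ w ++ FreeGroup.invRev g') := by
      rw [systemInstance, List.map_ofFn, List.map_ofFn]
      rfl
    rw [h3]
    simp only [queryTokens, sepEncoding, encodeSep, List.flatMap_append, List.flatMap_map,
      List.append_nil, List.flatMap_assoc]
    congr 2
    · funext w
      simp [wordPairEncoding, wordEncoding, Computability.encodingProd,
        Computability.encodingList]
    · funext w
      have h4 {α β : Type} (f : α → β) (l : List α) : (l.flatMap fun x => [f x]) = l.map f :=
        List.map_eq_flatMap.symm
      simp [wordPairEncoding, wordEncoding, Computability.encodingProd,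
        Computability.encodingList, Function.comp_def, h4]

end Braid

namespace Braid

open StackProgram

variable {n : ℕ}

/-! ### Words -/

theorem eval_nil : BraidWord.eval ([] : BraidWord n) = 1 := rfl

theorem eval_append (u w : BraidWord n) : (u ++ w : BraidWord n).eval = u.eval * w.eval := by
  rw [BraidWord.eval, BraidWord.eval, BraidWord.eval, ← map_mul, FreeGroup.mul_mk]

theorem eval_invRev (w : BraidWord n) : BraidWord.eval (FreeGroup.invRev w) = w.eval⁻¹ := by
  rw [BraidWord.eval, BraidWord.eval, ← map_inv, FreeGroup.inv_mk]

theorem exists_eval (x : BraidGroup n) : ∃ w : BraidWord n, w.eval = x := by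
  obtain ⟨y, rfl⟩ := PresentedGroup.mk_surjective (braidRels n) x
  exact ⟨y.toWord, by rw [BraidWord.eval, FreeGroup.mk_toWord]⟩

theorem eval_singleton (d : Fin (n - 1) × Bool) :
    BraidWord.eval [d] = if d.2 then gen n d.1 else (gen n d.1)⁻¹ := by
  obtain ⟨i, - | -⟩ := d
  · have := eval_invRev [(i, true)]
    rw [gen_val]
    exact this
  · rw [gen_val]
    rfl

theorem eval_cons (d : Fin (n - 1) × Bool) (w : BraidWord n) :
    BraidWord.eval (d :: w) = BraidWord.eval [d] * w.eval := eval_append [d] w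

/-! ### Following two strands through a word -/

/-- The state of the machine: a pair of strands. -/
abbrev Strands (n : ℕ) : Type := Option (Fin n × Fin n)

/-- The action of the generators on strands. -/
def moveStrand (i : Fin (n - 1)) (p : Fin n) : Fin n := ⟨sw i p, sw_lt (by omega) p.2⟩

/-- The action of the generators on pairs of strands. -/
def moveStrands (i : Fin (n - 1)) (s : Strands n) : Strands n :=
  s.map fun x => (moveStrand i x.1, moveStrand i x.2)

/-- The letter, if it is a crossing of the two strands. -/
def crossing (s : Strands n) (d : Fin (n - 1) × Bool) : BraidWord n :=
  s.elim [] fun x => if adj d.1 x.1 x.2 = 1 then [d] else []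

/-- The images of two strands. -/
def strands (s : Strands n) (w : BraidWord n) : Strands n :=
  w.foldr (fun d s => moveStrands d.1 s) s

/-- The crossings of two strands. -/
def crossings (s : Strands n) : BraidWord n → BraidWord n
  | [] => []
  | d :: w => crossings s w ++ crossing (strands s w) d

/-- The sum of the exponents of a word. -/
def expSum (w : BraidWord n) : ℤ := (w.map fun d => signVal (some d.2)).sum

theorem expSum_append (u w : BraidWord n) :
    expSum (u ++ w : BraidWord n) = expSum u + expSum w := by
  simp [expSum]

theorem strands_some (p q : Fin n) (w : BraidWord n) : ∃ p' q', strands (some (p, q)) w =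
    some (p', q') ∧ (p' : ℕ) = perm n w.eval p ∧ (q' : ℕ) = perm n w.eval q := by
  induction w with
  | nil => exact ⟨p, q, rfl, by simp [eval_nil], by simp [eval_nil]⟩
  | cons d w ih =>
    obtain ⟨p', q', h1, h2, h3⟩ := ih
    refine ⟨moveStrand d.1 p', moveStrand d.1 q', ?_, ?_, ?_⟩
    · change moveStrands d.1 (strands _ w) = _
      rw [h1]; rfl
    all_goals
      have hd : (d.1 : ℕ) + 1 < n := by omega
      rw [eval_cons, map_mul, Equiv.Perm.mul_apply, eval_singleton]
      simp only [← h2, ← h3]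
      split_ifs
      · rw [perm_gen hd]; rfl
      · rw [perm_gen_inv hd]; rfl

/-- Braids act from the left, so the strands are followed from the end of the word. The recorded
letters are the crossings of the pair, and their signs add up to the crossing number; their order is
irrelevant. -/
theorem expSum_crossings (p q : Fin n) (w : BraidWord n) :
    expSum (crossings (some (p, q)) w) = lk w.eval p q := by
  induction w with
  | nil => simp [crossings, expSum, eval_nil, lk_one]
  | cons d w ih =>
    obtain ⟨p', q', h1, h2, h3⟩ := strands_some p q w
    have hd : (d.1 : ℕ) + 1 < n := by omega
    rw [crossings, expSum_append, ih, eval_cons, lk_mul, h1, ← h2, ← h3, eval_singleton]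
    congr 1
    obtain ⟨i, - | -⟩ := d
    · rw [if_neg (by simp), lk_gen_inv hd]
      simp only [crossing, Option.elim_some, adj]
      split_ifs <;> simp_all [expSum, signVal]
    · rw [if_pos rfl, lk_gen hd]
      simp only [crossing, Option.elim_some, adj]
      split_ifs <;> simp_all [expSum, signVal]

/-! ### The machine for the answer -/

/-- The words of the machine for the answer: five given words and two lists of crossings. -/
abbrev Slot : Type := Fin 5 ⊕ Bool

/-- The product of some of the given words and their inverses. -/
def seqWord (v : Fin 5 → BraidWord n) (l : List (Fin 5 × Bool)) : BraidWord n :=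
  l.flatMap fun x => if x.2 then v x.1 else FreeGroup.invRev (v x.1)

variable {O : Type}

/-- The operation that follows the strands through a word or its inverse. -/
def strandsOp (t : Bool) (x : Fin 5 × Bool) : Op Slot (Strands n) (Fin (n - 1)) O where
  src := .inl x.1
  tgt := .inr t
  bwd s d := if x.2 then (moveStrands d.1 s, crossing s d, none, []) else (s, [], none, [])
  fwd s d := if x.2 then (s, [], none, []) else
    (moveStrands d.1 s, crossing s (d.1, !d.2), none, [])
  fin s _ := (s, [], [])

theorem foldr_app (w : BraidWord n) (R : Reg (Strands n) (Fin (n - 1)) O) :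
    w.foldr (fun d R => R.app (moveStrands d.1 R.st, crossing R.st d, none, [])) R =
      ⟨strands R.st w, R.word ++ crossings R.st w, R.ctr, R.out⟩ := by
  induction w with
  | nil => exact Reg.ext rfl (List.append_nil _).symm rfl rfl
  | cons d w ih =>
    rw [List.foldr_cons, ih]
    simp [Reg.app, signVal, strands, crossings]

/-- Reading the formal inverse of a word from right to left amounts to reading the word from left to
right with inverted letters; hence the sign in `x` decides which of the two passes does the work. -/
theorem apply_strandsOp (t : Bool) (x : Fin 5 × Bool) (v : Fin 5 → BraidWord n)
    (u : Bool → BraidWord n) (s : Strands n) (z : ℤ) (o : List O) :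
    (strandsOp t x).apply ⟨s, Sum.elim v u, z, o⟩ = ⟨strands s (seqWord v [x]),
      Sum.elim v (Function.update u t (u t ++ crossings s (seqWord v [x]))), z, o⟩ := by
  have h : (strandsOp t x).reg (v x.1) ⟨s, u t, z, o⟩ =
      ⟨strands s (seqWord v [x]), u t ++ crossings s (seqWord v [x]), z, o⟩ := by
    obtain ⟨j, - | -⟩ := x
    · have h1 := foldr_app (FreeGroup.invRev (v j)) ⟨s, u t, z, o⟩
      rw [FreeGroup.invRev, List.foldr_reverse, List.foldl_map] at h1
      simp [strandsOp, Op.reg, Reg.app_eq_self, h1, seqWord, Reg.fin, FreeGroup.invRev]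
      simp [Reg.app, signVal]
    · have h1 := foldr_app (v j) ⟨s, u t, z, o⟩
      simp [strandsOp, Op.reg, Reg.app_eq_self, h1, seqWord, Reg.fin]
      simp [Reg.app, signVal]
  change Mem.set _ (Sum.inr t) ((strandsOp t x).reg (v x.1) ⟨s, u t, z, o⟩) = _
  rw [h, Mem.set, Sum.update_elim_inr]

theorem applyAll_strandsOp (t : Bool) (l : List (Fin 5 × Bool)) (v : Fin 5 → BraidWord n)
    (u : Bool → BraidWord n) (s : Strands n) (z : ℤ) (o : List O) :
    applyAll (l.reverse.map (strandsOp t)) ⟨s, Sum.elim v u, z, o⟩ = ⟨strands s (seqWord v l),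
      Sum.elim v (Function.update u t (u t ++ crossings s (seqWord v l))), z, o⟩ := by
  induction l with
  | nil => simp [applyAll, seqWord, strands, crossings]
  | cons x l ih =>
    rw [List.reverse_cons, List.map_append, applyAll_append, ih]
    refine (apply_strandsOp ..).trans ?_
    have h1 (w w' : BraidWord n) : strands s (w ++ w') = strands (strands s w') w :=
      List.foldr_append ..
    have h2 (w w' : BraidWord n) :
        crossings s (w ++ w') = crossings s w' ++ crossings (strands s w') w := by
      induction w with
      | nil => simp [crossings]
      | cons d w ih => rw [List.cons_append, crossings, crossings, ih, h1, List.append_assoc]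
    have h3 : seqWord v (x :: l) = seqWord v [x] ++ seqWord v l := by simp [seqWord]
    rw [h3, h1, h2, Function.update_self, Function.update_idem, List.append_assoc]

/-- The operation that adds the exponent sum of a list of crossings to the counter or subtracts
it. -/
def countOp (t b : Bool) : Op Slot (Strands n) (Fin (n - 1)) O where
  src := .inr t
  tgt := .inl 0
  bwd s d := (s, [], some (d.2 == b), [])
  fwd s _ := (s, [], none, [])
  fin s _ := (s, [], [])

theorem apply_countOp (t b : Bool) (M : Mem Slot (Strands n) (Fin (n - 1)) O) :
    (countOp t b).apply M = ⟨M.st, M.words,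
      M.ctr + (if b then 1 else -1) * expSum (M.words (.inr t)), M.out⟩ := by
  have h (w : BraidWord n) (R : Reg (Strands n) (Fin (n - 1)) O) :
      w.foldr (fun d R => R.app (R.st, [], some (d.2 == b), [])) R =
        ⟨R.st, R.word, R.ctr + (if b then 1 else -1) * expSum w, R.out⟩ := by
    induction w with
    | nil => simp [expSum]
    | cons d w ih =>
      rw [List.foldr_cons, ih]
      obtain ⟨i, - | -⟩ := d <;> cases b <;> simp [Reg.app, signVal, expSum] <;> ring
  have h2 := h (M.words (.inr t)) (M.reg (.inl 0))
  simp only [Op.apply, Op.reg, countOp, Reg.app_eq_self, List.foldl_fixed, h2]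
  refine Mem.ext rfl ?_ ?_ rfl <;> simp [Mem.set, Mem.reg, Reg.fin, Reg.app, signVal]

/-- The image of a list of crossings under the map that sends the generators to a given braid. -/
def powWord (δ w : BraidWord n) : BraidWord n :=
  w.flatMap fun d => if d.2 then δ else FreeGroup.invRev δ

/-- Each recorded crossing is replaced by Δ to the power given by its sign. Since the crossing
number in question is 2k, this produces Δ^{2k} without division by two, in length linear in the list
of crossings. -/
theorem eval_powWord (δ w : BraidWord n) : (powWord δ w).eval = δ.eval ^ expSum w := by
  induction w with
  | nil => rfl
  | cons d w ih =>
    have h : powWord δ (d :: w) = (if d.2 then δ else FreeGroup.invRev δ) ++ powWord δ w := rfl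
    have h' : expSum (d :: w) = signVal (some d.2) + expSum w := by simp [expSum]
    rw [h, h', eval_append, ih, zpow_add]
    obtain ⟨i, - | -⟩ := d
    · rw [if_neg (by simp), eval_invRev, signVal, zpow_neg_one]
    · rw [if_pos rfl, signVal, zpow_one]

/-- The answer: two lists of crossings are compared, and if their exponent sums agree, the first one
determines a power of the braid `δ`. -/
def answer (δ : BraidWord n) (l l' : List (Fin 5 × Bool)) (s : Strands n)
    (v : Fin 5 → BraidWord n) : Option (BraidWord n × BraidWord n) :=
  if expSum (crossings s (seqWord v l)) = expSum (crossings s (seqWord v l')) then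
    some (powWord (FreeGroup.invRev δ) (crossings s (seqWord v l)) ++ v 4,
      FreeGroup.invRev (v 2) ++ (FreeGroup.invRev (v 4) ++
        (powWord δ (crossings s (seqWord v l)) ++ v 3)))
  else none

/-- The tokens for the code of the answer. -/
def answerTokens (δ : BraidWord n) : List (Token Slot (Strands n) (Fin (n - 1))
    (Option ((Fin (n - 1) × Bool) ⊕ (Fin (n - 1) × Bool)))) :=
  [.const (.inl 0) (.inl 1) fun s => s.elim [] fun _ => [none],
    .fwd (.inr true) (.inl 1) fun s d => s.elim [] fun _ =>
      (if d.2 then FreeGroup.invRev δ else FreeGroup.invRev (FreeGroup.invRev δ)).map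
        (some ∘ .inl),
    .fwd (.inl 4) (.inl 1) fun s d => s.elim [] fun _ => [some (.inl d)],
    .inv (.inl 2) (.inl 1) fun s d => s.elim [] fun _ => [some (.inr d)],
    .inv (.inl 4) (.inl 1) fun s d => s.elim [] fun _ => [some (.inr d)],
    .fwd (.inr true) (.inl 1) fun s d => s.elim [] fun _ =>
      (if d.2 then δ else FreeGroup.invRev δ).map (some ∘ .inr),
    .fwd (.inl 3) (.inl 1) fun s d => s.elim [] fun _ => [some (.inr d)]]

/-- The program for the answer. -/
def answerProg (δ α β : BraidWord n) (l l' : List (Fin 5 × Bool)) (s : Strands n) :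
    List (Op Slot (Strands n) (Fin (n - 1))
      (Option ((Fin (n - 1) × Bool) ⊕ (Fin (n - 1) × Bool)))) :=
  [.ofFin (.inl 2) (.inl 0) fun s _ => (s, α, []), .ofFin (.inl 2) (.inl 1) fun s _ => (s, β, [])]
    ++ (l.reverse.map (strandsOp true) ++ ([.ofFin (.inl 0) (.inl 1) fun _ _ => (s, [], [])] ++
    (l'.reverse.map (strandsOp false) ++ ([countOp true true, countOp false false,
      .ofFin (.inl 0) (.inl 1) fun s b => (if b then s else none, [], [])] ++
    (answerTokens δ).reverse.map Token.op))))

theorem apply_ofFin (src tgt : Slot) (fin : Strands n → Bool → Strands n × BraidWord n × List O)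
    (M : Mem Slot (Strands n) (Fin (n - 1)) O) :
    (Op.ofFin src tgt fin).apply M = M.set tgt ((M.reg tgt).fin fin) := by
  rw [Op.apply, Op.reg_ofFin]
  rfl

theorem out_applyAll_answerProg (δ α β : BraidWord n) (l l' : List (Fin 5 × Bool))
    (x : Fin n × Fin n) (v : Fin 5 → BraidWord n) (h0 : v 0 = []) (h1 : v 1 = []) :
    (applyAll (answerProg δ α β l l' (some x)) ⟨some x, Sum.elim v fun _ => [], 0, []⟩).out =
      (optionEncoding (wordPairEncoding n)).encode
        (answer δ l l' (some x) (Function.update (Function.update v 0 α) 1 β)) := by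
  -- The constants α and β are first written into the slots 0 and 1, which are empty at the start,
  -- so that they can be traversed like the words of the input.
  have e1 : applyAll [.ofFin (.inl 2) (.inl 0) fun s _ => (s, α, []),
      .ofFin (.inl 2) (.inl 1) fun s _ => (s, β, [])]
      (⟨some x, Sum.elim v fun _ => [], 0, []⟩ : Mem Slot (Strands n) (Fin (n - 1))
      (Option ((Fin (n - 1) × Bool) ⊕ (Fin (n - 1) × Bool)))) =
      ⟨some x, Sum.elim (Function.update (Function.update v 0 α) 1 β) fun _ => [], 0, []⟩ := by
    simp [applyAll, apply_ofFin, Mem.set, Mem.reg, Reg.fin, Reg.app, h0, h1, signVal, -Sum.update_elim_inl,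
      -Sum.update_elim_inr]
  rw [answerProg, applyAll_append, e1]
  generalize Function.update (Function.update v 0 α) 1 β = v
  rw [applyAll_append, applyAll_strandsOp, applyAll_append]
  -- The tracked pair of strands is reset before the second word is followed.
  have e2 (s : Strands n) (u : Bool → BraidWord n) (z : ℤ) : applyAll
      [.ofFin (.inl 0) (.inl 1) fun _ _ => (some x, [], [])]
      (⟨s, Sum.elim v u, z, []⟩ : Mem Slot (Strands n) (Fin (n - 1))
      (Option ((Fin (n - 1) × Bool) ⊕ (Fin (n - 1) × Bool)))) =
      ⟨some x, Sum.elim v u, z, []⟩ := by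
    simp [applyAll, apply_ofFin, Mem.set, Mem.reg, Reg.fin, Reg.app, signVal]
  rw [e2, applyAll_append, applyAll_strandsOp, applyAll_append]
  -- The two exponent sums are subtracted on the counter. If the counter is not zero, the state
  -- becomes `none`, in which every answer token is empty and the output is the code of `none`.
  have e3 (s : Strands n) (u : Bool → BraidWord n) : applyAll
      [countOp true true, countOp false false,
      .ofFin (.inl 0) (.inl 1) fun s b => (if b then s else none, [], [])]
      (⟨s, Sum.elim v u, 0, []⟩ : Mem Slot (Strands n) (Fin (n - 1))
      (Option ((Fin (n - 1) × Bool) ⊕ (Fin (n - 1) × Bool)))) =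
      ⟨if expSum (u true) = expSum (u false) then s else none, Sum.elim v u,
        expSum (u true) - expSum (u false), []⟩ := by
    simp [applyAll, apply_ofFin, apply_countOp, Mem.set, Mem.reg, Reg.fin, Reg.app, signVal,
      ← sub_eq_add_neg, sub_eq_zero]
  rw [e3, applyAll_tokens]
  generalize hu : Function.update (Function.update _ true _) false _ = u
  have ht : u true = crossings (some x) (seqWord v l) := by rw [← hu]; rfl
  have hf : u false = crossings (some x) (seqWord v l') := by rw [← hu]; rfl
  obtain ⟨p', q', hs, -⟩ := strands_some x.1 x.2 (seqWord v l')
  have h4 {α β : Type} (f : α → β) (l : List α) : (l.flatMap fun x => [f x]) = l.map f :=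
    List.map_eq_flatMap.symm
  rw [answer, hs, ← ht, ← hf]
  split_ifs
  · simp [answerTokens, optionEncoding, wordPairEncoding, wordEncoding, powWord,
      Computability.encodingProd, Computability.encodingList, List.map_flatMap, h4,
      Function.comp_def]
  · simp [answerTokens, optionEncoding]

theorem polyTime_answer (h2 : 2 ≤ n) (δ α β : BraidWord n) (l l' : List (Fin 5 × Bool))
    (x : Fin n × Fin n) : Nonempty (Turing.TM2ComputableInPolyTime
      (Computability.encodingProd (wordPairEncoding n) (wordEncoding n)).encode
      (optionEncoding (wordPairEncoding n)).encode
      fun y => answer δ l l' (some x) ![α, β, y.1.1, y.1.2, y.2]) := by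
  refine polyTime_of_applyAll (J := Slot) (S := Strands n) (ι := Fin (n - 1)) ⟨0, by omega⟩ _ _ _
    (answerProg δ α β l l' (some x)) ?_
    (fun | .inl (.inl d) => (.inl 2, d) | .inl (.inr d) => (.inl 3, d) | .inr d => (.inl 4, d))
    (some x) fun y => ?_
  · intro o ho
    simp only [answerProg, answerTokens, List.mem_append, List.mem_cons, List.not_mem_nil,
      or_false, List.mem_map, List.mem_reverse] at ho
    rcases ho with (rfl | rfl) | ⟨_, _, rfl⟩ | rfl | ⟨_, _, rfl⟩ | (rfl | rfl | rfl) |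
      ⟨k, rfl | rfl | rfl | rfl | rfl | rfl | rfl, rfl⟩ <;>
      simp [Op.ofFin, strandsOp, countOp, Token.op, Token.const, Token.fwd, Token.inv]
  · obtain ⟨⟨g, g'⟩, w⟩ := y
    have h := out_applyAll_answerProg δ α β l l' x ![[], [], g, g', w] rfl rfl
    have e : Function.update (Function.update ![[], [], g, g', w] 0 α) 1 β = ![α, β, g, g', w] := by
      funext i; fin_cases i <;> rfl
    rw [e] at h
    rw [← h]
    congr 3
    funext j
    rcases j with j | j
    · fin_cases j <;> simp [wordPairEncoding, wordEncoding, Computability.encodingProd,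
        Computability.encodingList, List.filterMap_append, List.filterMap_map, Function.comp_def]
    · simp [wordPairEncoding, wordEncoding, Computability.encodingProd,
        Computability.encodingList, List.filterMap_append, List.filterMap_map, Function.comp_def]

end Braid

namespace Braid

/-! ### Solutions of the system -/

section Solutions

variable {n r s : ℕ} {A B : Subgroup (BraidGroup n)} {hr : r ≤ n} {hs : s ≤ n}
  {α β : BraidGroup n}

theorem delta_sq_zpow_comm (k : ℤ) (x : BraidGroup n) :
    (delta n n ^ 2) ^ k * x = x * (delta n n ^ 2) ^ k := ((delta_sq_central x).zpow_left k).eq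

/-- The solutions of the system are characterized by commutation with centralizers. -/
theorem solvesSystem_iff {p q : ℕ} {c : Fin p → BraidGroup n} {d : Fin q → BraidGroup n}
    (hc : Subgroup.closure (Set.range c) = Subgroup.centralizer (A : Set (BraidGroup n)))
    (hd : Subgroup.closure (Set.range d) = Subgroup.centralizer (B : Set (BraidGroup n)))
    {g g' x : BraidGroup n} : SolvesSystem c d g g' x ↔
      (∀ y ∈ Subgroup.centralizer (A : Set (BraidGroup n)), Commute x y) ∧
      ∀ y ∈ Subgroup.centralizer (B : Set (BraidGroup n)), Commute (g'⁻¹ * x * g) y := by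
  have key {p : ℕ} (c : Fin p → BraidGroup n) (x : BraidGroup n) :
      (∀ y ∈ Subgroup.closure (Set.range c), Commute x y) ↔ ∀ i, x * c i * x⁻¹ = c i := by
    constructor
    · intro h i
      rw [(h _ (Subgroup.subset_closure ⟨i, rfl⟩)).eq, mul_inv_cancel_right]
    · intro h
      have : Subgroup.closure (Set.range c) ≤ Subgroup.centralizer {x} := by
        rw [Subgroup.closure_le]
        rintro _ ⟨i, rfl⟩
        rw [SetLike.mem_coe, Subgroup.mem_centralizer_singleton_iff]
        exact (mul_inv_eq_iff_eq_mul.1 (h i)).symm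
      exact fun y hy => (Subgroup.mem_centralizer_singleton_iff.1 (this hy)).symm
  rw [← hc, ← hd, key, key, SolvesSystem]
  refine and_congr_right fun _ => forall_congr' fun j => ?_
  have : g'⁻¹ * x * g * d j * (g'⁻¹ * x * g)⁻¹ = g'⁻¹ * (x * (g * d j * g⁻¹) * x⁻¹) * g' := by
    group
  rw [this]
  constructor
  · intro h; rw [h]; group
  · intro h
    have h1 (z : BraidGroup n) : z = g' * (g'⁻¹ * z * g') * g'⁻¹ := by group
    rw [h1 (x * _ * _), h]

theorem IsConj.exists_of_solvesSystem (hA : IsConj A r hr α) (hB : IsConj B s hs β) (h2 : 2 ≤ r)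
    (h2' : 2 ≤ s) {p q : ℕ} {c : Fin p → BraidGroup n} {d : Fin q → BraidGroup n}
    (hc : Subgroup.closure (Set.range c) = Subgroup.centralizer (A : Set (BraidGroup n)))
    (hd : Subgroup.closure (Set.range d) = Subgroup.centralizer (B : Set (BraidGroup n)))
    {g g' x : BraidGroup n} (h : SolvesSystem c d g g' x) :
    ∃ k l : ℤ, ∃ a ∈ A, ∃ b ∈ B, x = (delta n n ^ 2) ^ k * a ∧
      g'⁻¹ * x * g = (delta n n ^ 2) ^ l * b := by
  rw [solvesSystem_iff hc hd] at h
  obtain ⟨k, a, ha, h1⟩ := hA.exists_of_commute h2 h.1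
  obtain ⟨l, b, hb, h2⟩ := hB.exists_of_commute h2' h.2
  exact ⟨k, l, a, ha, b, hb, h1, h2⟩

/-- Here g'⁻¹ag = Δ^{2k}b⁻¹, and central factors do not affect commutation. Arbitrary `k` is needed
for the solvability criterion; `k = 0` is the case of an actual double coset equation. -/
theorem solvesSystem_of_eq {p q : ℕ} {c : Fin p → BraidGroup n} {d : Fin q → BraidGroup n}
    (hc : Subgroup.closure (Set.range c) = Subgroup.centralizer (A : Set (BraidGroup n)))
    (hd : Subgroup.closure (Set.range d) = Subgroup.centralizer (B : Set (BraidGroup n)))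
    {g g' a b : BraidGroup n} (ha : a ∈ A) (hb : b ∈ B) {k : ℤ}
    (h : (delta n n ^ 2) ^ k * g' = a * g * b) : SolvesSystem c d g g' a := by
  rw [solvesSystem_iff hc hd]
  refine ⟨fun y hy => Subgroup.mem_centralizer_iff.1 hy a ha, fun y hy => ?_⟩
  have h1 : g'⁻¹ * a * g = (delta n n ^ 2) ^ k * b⁻¹ := by
    rw [mul_assoc, eq_mul_inv_of_mul_eq h.symm, delta_sq_zpow_comm k g', mul_assoc,
      inv_mul_cancel_left]
  rw [h1]
  exact ((delta_sq_central y).zpow_left k).mul_left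
    (Subgroup.mem_centralizer_iff.1 hy _ (B.inv_mem hb))

variable {g g' x a b : BraidGroup n} {k l e : ℤ}

/-- Powers of the central element by which a solution has to be corrected. -/
theorem mem_of_eq (ha : a ∈ A) (hb : b ∈ B) (hx : x = (delta n n ^ 2) ^ k * a)
    (hy : g'⁻¹ * x * g = (delta n n ^ 2) ^ l * b) (h : e = k ∨ A = ⊤) (h' : e = l ∨ B = ⊤) :
    (delta n n ^ 2) ^ (-e) * x ∈ A ∧ g⁻¹ * (x⁻¹ * ((delta n n ^ 2) ^ e * g')) ∈ B := by
  constructor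
  · rcases h with rfl | rfl
    · rwa [hx, ← mul_assoc, ← zpow_add, neg_add_cancel, zpow_zero, one_mul]
    · exact Subgroup.mem_top _
  · rcases h' with rfl | rfl
    · have : g⁻¹ * (x⁻¹ * ((delta n n ^ 2) ^ e * g')) =
          (g'⁻¹ * x * g)⁻¹ * (delta n n ^ 2) ^ e := by
        rw [delta_sq_zpow_comm]; group
      rw [this, hy, mul_inv_rev, mul_assoc, inv_mul_cancel, mul_one]
      exact B.inv_mem hb
    · exact Subgroup.mem_top _

/-- Comparing the two expressions for `g'` gives g⁻¹(a'⁻¹a)g = Δ^{2(l-k)}b'b, a relation between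
elements of proper parabolic subgroups that forces the exponent to be zero. -/
theorem IsConj.eq_of_mul (hA : IsConj A r hr α) (hB : IsConj B s hs β) (h2 : 2 ≤ r)
    (hrn : r < n) (hsn : s < n) (ha : a ∈ A) (hb : b ∈ B) (hx : x = (delta n n ^ 2) ^ k * a)
    (hy : g'⁻¹ * x * g = (delta n n ^ 2) ^ l * b) {a' b' : BraidGroup n} (ha' : a' ∈ A)
    (hb' : b' ∈ B) (h : g' = a' * g * b') : k = l := by
  have h1 : g⁻¹ * (a'⁻¹ * a) * g⁻¹⁻¹ = (delta n n ^ 2) ^ (l - k) * (b' * b) := by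
    have e : (a' * g * b')⁻¹ * ((delta n n ^ 2) ^ k * a) * g =
        (delta n n ^ 2) ^ k * ((a' * g * b')⁻¹ * a * g) := by
      simp only [mul_assoc, delta_sq_zpow_comm k]
    rw [h, hx, e, ← eq_inv_mul_iff_mul_eq, ← mul_assoc, ← zpow_neg, ← zpow_add] at hy
    have e' : (delta n n ^ 2) ^ (l - k) * (b' * b) = b' * ((delta n n ^ 2) ^ (-k + l) * b) := by
      rw [sub_eq_neg_add, ← mul_assoc, delta_sq_zpow_comm, mul_assoc]
    rw [e', ← hy]
    group
  have := hA.eq_zero hB h2 hrn hsn (A.mul_mem (A.inv_mem ha') ha) (B.mul_mem hb' hb) h1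
  omega

/-- The braid α⁻¹xα is Δ^{2k} times an element of B_r, and for r < n the latter does not involve the
last strand. So the exponent can be counted from a word for `x` without knowing a decomposition. -/
theorem IsConj.lk_eq (hA : IsConj A r hr α) (h2 : 2 ≤ r) (hrn : r < n) (ha : a ∈ A)
    (hx : x = (delta n n ^ 2) ^ k * a) : lk (α⁻¹ * (x * α)) 0 (n - 1) = 2 * k := by
  obtain ⟨m, rfl⟩ : ∃ m, n = m + 1 := ⟨n - 1, by omega⟩
  obtain ⟨a', rfl⟩ := (hA a).1 ha
  have h1 : α⁻¹ * (x * α) = (delta (m + 1) (m + 1) ^ 2) ^ k * incl hr a' := by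
    rw [hx, delta_sq_zpow_comm, delta_sq_zpow_comm]
    have := delta_sq_zpow_comm k α
    rw [mul_assoc _ _ α, this]
    group
  obtain ⟨h3, h4⟩ := lk_incl_last (show r ≤ m by omega) a'
  change lk _ 0 m = _
  rw [h1, lk_mul, (h4 0).1, h3, lk_delta_sq_zpow le_rfl, if_pos,
    zero_add]
  refine ⟨perm_lt _ (by omega), by omega, fun h => ?_⟩
  have := (perm (m + 1) (incl hr a')).injective (h.trans h3.symm)
  omega

end Solutions

end Braid

/-! ### From crossing numbers to the polynomial-time reduction -/

namespace Braid

theorem garsideElement_zpow {n : ℕ} (hn : 1 ≤ n) (k : ℤ) :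
    garsideElement n ^ (2 * k) = (delta n n ^ 2) ^ k := by
  rw [garsideElement_eq hn, zpow_mul, zpow_ofNat]

/-- A word sequence determined by a list of slots, evaluated for the given words. -/
theorem eval_seqWord {n : ℕ} (v : Fin 5 → BraidWord n) (l : List (Fin 5 × Bool)) :
    (seqWord v l).eval = (l.map fun x => if x.2 then (v x.1).eval else (v x.1).eval⁻¹).prod := by
  induction l with
  | nil => rfl
  | cons x l ih =>
    have h : seqWord v (x :: l) =
        (if x.2 then v x.1 else FreeGroup.invRev (v x.1)) ++ seqWord v l := by simp [seqWord]
    rw [h, eval_append, ih, List.map_cons, List.prod_cons]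
    split_ifs
    · rfl
    · rw [eval_invRev]

section Answer

variable {n r s : ℕ} {A B : Subgroup (BraidGroup n)} {hr : r ≤ n} {hs : s ≤ n}
  {α β : BraidGroup n}

/-- The slots for the conjugate of the solution by `α`. -/
def slotsLeft : List (Fin 5 × Bool) := [(0, false), (4, true), (0, true)]

/-- The slots for the conjugate of `g'⁻¹ x g` by `β`. -/
def slotsRight : List (Fin 5 × Bool) := [(1, false), (3, false), (4, true), (2, true), (1, true)]

/-- The crossing numbers that the machine compares decide the double coset problem. -/
theorem IsConj.exists_slots (hA : IsConj A r hr α) (hB : IsConj B s hs β) (h2 : 2 ≤ r)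
    (h2' : 2 ≤ s) {αw βw : BraidWord n} (hα : αw.eval = α) (hβ : βw.eval = β) :
    ∃ L L' : List (Fin 5 × Bool), ∀ (g g' x : BraidWord n) (k l : ℤ), ∀ a ∈ A, ∀ b ∈ B,
      x.eval = (delta n n ^ 2) ^ k * a → g'.eval⁻¹ * x.eval * g.eval = (delta n n ^ 2) ^ l * b →
      ∃ e e' : ℤ, lk (seqWord ![αw, βw, g, g', x] L).eval 0 (n - 1) = 2 * e ∧
        lk (seqWord ![αw, βw, g, g', x] L').eval 0 (n - 1) = 2 * e' ∧
        (e = e' → (e = k ∨ A = ⊤) ∧ (e = l ∨ B = ⊤)) ∧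
        (e ≠ e' → ∀ a' ∈ A, ∀ b' ∈ B, g'.eval ≠ a' * g.eval * b') := by
  have hX (g g' x : BraidWord n) : (seqWord ![αw, βw, g, g', x] slotsLeft).eval =
      α⁻¹ * (x.eval * α) := by
    rw [eval_seqWord]; simp [slotsLeft, hα]
  have hY (g g' x : BraidWord n) : (seqWord ![αw, βw, g, g', x] slotsRight).eval =
      β⁻¹ * ((g'.eval⁻¹ * x.eval * g.eval) * β) := by
    rw [eval_seqWord]; simp [slotsRight, hβ, mul_assoc]
  rcases hr.lt_or_eq with hrn | rfl
  · rcases hs.lt_or_eq with hsn | rfl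
    -- Both subgroups are proper: the counts give `k` and `l`, and the instance is solvable exactly
    -- if they agree.
    · refine ⟨slotsLeft, slotsRight, fun g g' x k l a ha b hb hx hy => ⟨k, l, ?_, ?_,
        fun h => ⟨.inl rfl, .inl h⟩, fun h a' ha' b' hb' h' =>
          h (hA.eq_of_mul hB h2 hrn hsn ha hb hx hy ha' hb' h')⟩⟩
      · rw [hX]; exact hA.lk_eq h2 hrn ha hx
      · rw [hY]; exact hB.lk_eq h2' hsn hb hy
    -- If B is the whole group, only the exponent for A matters; comparing the count with itself
    -- makes the answer always positive.
    · refine ⟨slotsLeft, slotsLeft, fun g g' x k l a ha b hb hx hy => ⟨k, k, ?_, ?_,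
        fun _ => ⟨.inl rfl, .inr hB.eq_top⟩, fun h => (h rfl).elim⟩⟩ <;>
      · rw [hX]; exact hA.lk_eq h2 hrn ha hx
  · rcases hs.lt_or_eq with hsn | rfl
    · refine ⟨slotsRight, slotsRight, fun g g' x k l a ha b hb hx hy => ⟨l, l, ?_, ?_,
        fun _ => ⟨.inr hA.eq_top, .inl rfl⟩, fun h => (h rfl).elim⟩⟩ <;>
      · rw [hY]; exact hB.lk_eq h2' hsn hb hy
    -- Both subgroups are the whole group, so the exponent 0, counted from the empty word, always
    -- works.
    · refine ⟨[], [], fun g g' x k l a ha b hb hx hy => ⟨0, 0, ?_, ?_,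
        fun _ => ⟨.inr hA.eq_top, .inr hB.eq_top⟩, fun h => (h rfl).elim⟩⟩ <;>
      · rw [eval_seqWord]; exact lk_one ..

theorem isSol_systemInstance {p q : ℕ} {c : Fin p → BraidGroup n} {d : Fin q → BraidGroup n}
    {cw : Fin p → BraidWord n} {dw : Fin q → BraidWord n} (hc : ∀ i, (cw i).eval = c i)
    (hd : ∀ j, (dw j).eval = d j) (g g' x : BraidWord n) :
    (simultaneousConjugacyProblem n).IsSol (systemInstance cw dw (g, g')) x ↔
      SolvesSystem c d g.eval g'.eval x.eval := by
  have h (u w : BraidWord n) : BraidWord.eval (u ++ w ++ FreeGroup.invRev u) =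
      u.eval * w.eval * u.eval⁻¹ := by
    rw [eval_append, eval_append, eval_invRev]
  change (∀ u ∈ systemInstance cw dw (g, g'), u.2.eval = x.eval * u.1.eval * x.eval⁻¹) ↔ _
  simp only [systemInstance, List.mem_append, List.mem_ofFn, or_imp, forall_and,
    forall_exists_index, forall_apply_eq_imp_iff, h, hc, hd, SolvesSystem]
  exact and_congr (forall_congr' fun _ => eq_comm) (forall_congr' fun _ => eq_comm)

/-- The reduction of the double coset problem to the simultaneous conjugacy problem. -/
theorem IsConj.exists_reduction (hA : IsConj A r hr α) (hB : IsConj B s hs β) (h2 : 2 ≤ r)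
    (h2' : 2 ≤ s) {p q : ℕ} {c : Fin p → BraidGroup n} {d : Fin q → BraidGroup n}
    (hc : Subgroup.closure (Set.range c) = Subgroup.centralizer (A : Set (BraidGroup n)))
    (hd : Subgroup.closure (Set.range d) = Subgroup.centralizer (B : Set (BraidGroup n)))
    {cw : Fin p → BraidWord n} {dw : Fin q → BraidWord n} (hcw : ∀ i, (cw i).eval = c i)
    (hdw : ∀ j, (dw j).eval = d j) :
    ∃ h : (BraidWord n × BraidWord n) × BraidWord n → Option (BraidWord n × BraidWord n),
      IsPolyTimeReduction (doubleCosetProblem A B) (simultaneousConjugacyProblem n)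
        (systemInstance cw dw) h ∧
      ∀ (g g' x a b : BraidWord n),
        (simultaneousConjugacyProblem n).IsSol (systemInstance cw dw (g, g')) x →
        h ((g, g'), x) = some (a, b) →
        ∃ k : ℤ, x.eval = garsideElement n ^ (2 * k) * a.eval := by
  obtain ⟨αw, hα⟩ := exists_eval α
  obtain ⟨βw, hβ⟩ := exists_eval β
  obtain ⟨δw, hδ⟩ := exists_eval (delta n n)
  obtain ⟨L, L', hL⟩ := hA.exists_slots hB h2 h2' hα hβ
  have hn : 2 ≤ n := h2.trans hr
  set P : Fin n × Fin n := (⟨0, by omega⟩, ⟨n - 1, by omega⟩)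
  -- Everything the machine prints is obtained from `x` by removing a power of Δ² that puts both
  -- factors into A and B; correctness of the pair and the decomposition of `x` both follow from
  -- this.
  have hsome (g g' x a b : BraidWord n)
      (hs : (simultaneousConjugacyProblem n).IsSol (systemInstance cw dw (g, g')) x)
      (h : answer δw L L' (some P) ![αw, βw, g, g', x] = some (a, b)) : ∃ e : ℤ,
        a.eval = (delta n n ^ 2) ^ (-e) * x.eval ∧
        b.eval = g.eval⁻¹ * (x.eval⁻¹ * ((delta n n ^ 2) ^ e * g'.eval)) ∧
        a.eval ∈ A ∧ b.eval ∈ B := by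
    rw [isSol_systemInstance hcw hdw] at hs
    obtain ⟨k, l, a', ha, b', hb, hx, hy⟩ := hA.exists_of_solvesSystem hB h2 h2' hc hd hs
    obtain ⟨e, e', h1, h1', h3, -⟩ := hL g g' x k l a' ha b' hb hx hy
    rw [answer, expSum_crossings, expSum_crossings] at h
    rw [h1, h1'] at h
    split_ifs at h with he
    obtain ⟨h4, h5⟩ := h3 (by omega)
    obtain ⟨h6, h7⟩ := mem_of_eq ha hb hx hy h4 h5
    simp only [Option.some.injEq, Prod.mk.injEq] at h
    have e1 : a.eval = (delta n n ^ 2) ^ (-e) * x.eval := by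
      rw [← h.1, eval_append, eval_powWord, expSum_crossings, eval_invRev, hδ, h1, inv_zpow,
        ← zpow_neg, ← mul_neg, zpow_mul, zpow_ofNat]
      rfl
    have e2 : b.eval = g.eval⁻¹ * (x.eval⁻¹ * ((delta n n ^ 2) ^ e * g'.eval)) := by
      rw [← h.2, eval_append, eval_append, eval_append, eval_powWord, expSum_crossings,
        eval_invRev, eval_invRev, hδ, h1, zpow_mul, zpow_ofNat]
      rfl
    exact ⟨e, e1, e2, e1 ▸ h6, e2 ▸ h7⟩
  refine ⟨fun y => answer δw L L' (some P) ![αw, βw, y.1.1, y.1.2, y.2], ⟨?_, ?_, ?_, ?_, ?_⟩,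
    fun g g' x a b hs h => ?_⟩
  · exact polyTime_systemInstance hn cw dw
  · exact polyTime_answer hn δw αw βw L L' P
  · rintro ⟨g, g'⟩ ⟨⟨a, b⟩, ha, hb, h⟩
    refine ⟨a, (isSol_systemInstance hcw hdw g g' a).2
      (solvesSystem_of_eq (k := 0) hc hd ha hb ?_)⟩
    rw [zpow_zero, one_mul]
    exact h
  · rintro ⟨g, g'⟩ x hs ⟨a, b⟩ h
    obtain ⟨e, e1, e2, ha, hb⟩ := hsome g g' x a b hs h
    refine ⟨ha, hb, ?_⟩
    change g'.eval = a.eval * g.eval * b.eval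
    rw [e1, e2]
    group
  · rintro ⟨g, g'⟩ x hs h ⟨⟨a, b⟩, ha, hb, hab⟩
    replace hs := (isSol_systemInstance hcw hdw g g' x).1 hs
    obtain ⟨k, l, a', ha', b', hb', hx, hy⟩ := hA.exists_of_solvesSystem hB h2 h2' hc hd hs
    obtain ⟨e, e', h1, h1', -, h3⟩ := hL g g' x k l a' ha' b' hb' hx hy
    dsimp only at h
    rw [answer, expSum_crossings, expSum_crossings] at h
    rw [h1, h1'] at h
    split_ifs at h with he
    exact h3 (fun h => he (by rw [h])) _ ha _ hb hab
  · obtain ⟨e, e1, -⟩ := hsome g g' x a b hs h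
    refine ⟨e, ?_⟩
    rw [e1, garsideElement_zpow (by omega), ← mul_assoc, ← zpow_add, add_neg_cancel, zpow_zero,
      one_mul]

end Answer

end Braid

/-! ### The main theorem -/

theorem mainTheorem2 (n : ℕ) (A B : Subgroup (BraidGroup n))
    (hA : IsConnectedParabolic A) (hB : IsConnectedParabolic B) :
    (Subgroup.centralizer (A : Set (BraidGroup n))).FG ∧
    (Subgroup.centralizer (B : Set (BraidGroup n))).FG ∧
    ∀ (p q : ℕ) (c : Fin p → BraidGroup n) (d : Fin q → BraidGroup n),
      Subgroup.closure (Set.range c) = Subgroup.centralizer (A : Set (BraidGroup n)) →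
      Subgroup.closure (Set.range d) = Subgroup.centralizer (B : Set (BraidGroup n)) →
      (∀ g g' : BraidGroup n,
        (∀ a ∈ A, ∀ b ∈ B, g' = a * g * b → SolvesSystem c d g g' a) ∧
        ((∃ x, SolvesSystem c d g g' x) ↔
          ∃ k : ℤ, garsideElement n ^ (2 * k) * g' ∈ DoubleCoset.doubleCoset g (A : Set _) B) ∧
        ∀ x, SolvesSystem c d g g' x →
          (∃ k : ℤ, ∃ a ∈ A, x = garsideElement n ^ (2 * k) * a) ∧
          (A ≠ ⊤ → ∃! k : ℤ, ∃ a ∈ A, x = garsideElement n ^ (2 * k) * a) ∧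
          (g' ∈ DoubleCoset.doubleCoset g (A : Set _) B ↔
            ∃ k : ℤ, ∃ a ∈ A, x = garsideElement n ^ (2 * k) * a ∧ g⁻¹ * a⁻¹ * g' ∈ B)) ∧
      ∀ (cw : Fin p → BraidWord n) (dw : Fin q → BraidWord n),
        (∀ i, (cw i).eval = c i) → (∀ j, (dw j).eval = d j) →
        ∃ h : (BraidWord n × BraidWord n) × BraidWord n → Option (BraidWord n × BraidWord n),
          IsPolyTimeReduction (doubleCosetProblem A B) (simultaneousConjugacyProblem n)
            (systemInstance cw dw) h ∧
          ∀ (g g' x a b : BraidWord n),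
            (simultaneousConjugacyProblem n).IsSol (systemInstance cw dw (g, g')) x →
            h ((g, g'), x) = some (a, b) →
            ∃ k : ℤ, x.eval = garsideElement n ^ (2 * k) * a.eval := by
  obtain ⟨r, h2, hr, α, hA⟩ := Braid.exists_isConj hA
  obtain ⟨s, h2', hs, β, hB⟩ := Braid.exists_isConj hB
  refine ⟨hA.centralizer_fg h2, hB.centralizer_fg h2', fun p q c d hc hd => ⟨fun g g' => ?_,
    fun cw dw hcw hdw => hA.exists_reduction hB h2 h2' hc hd hcw hdw⟩⟩
  simp only [Braid.garsideElement_zpow (show 1 ≤ n by omega), DoubleCoset.mem_doubleCoset]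
  refine ⟨fun a ha b hb h => Braid.solvesSystem_of_eq (k := 0) hc hd ha hb
    (by rw [zpow_zero, one_mul, h]), ⟨?_, ?_⟩, fun x hx => ?_⟩
  · rintro ⟨x, hx⟩
    obtain ⟨k, l, a, ha, b, hb, h1, h3⟩ := hA.exists_of_solvesSystem hB h2 h2' hc hd hx
    -- From x = Δ^{2k}a and xg = g'Δ^{2l}b it follows that a g b⁻¹ = Δ^{2(l-k)}g'.
    refine ⟨l - k, a, ha, b⁻¹, B.inv_mem hb, ?_⟩
    have h4 : a * g = (Braid.delta n n ^ 2) ^ (-k) * (x * g) := by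
      rw [h1, zpow_neg]; group
    have h5 : x * g = g' * ((Braid.delta n n ^ 2) ^ l * b) := by rw [← h3]; group
    rw [h4, h5, ← mul_assoc g', ← Braid.delta_sq_zpow_comm, sub_eq_neg_add, zpow_add]
    group
  · rintro ⟨k, a, ha, b, hb, h⟩
    exact ⟨a, Braid.solvesSystem_of_eq hc hd ha hb h⟩
  · obtain ⟨k, l, a, ha, b, hb, h1, h3⟩ := hA.exists_of_solvesSystem hB h2 h2' hc hd hx
    refine ⟨⟨k, a, ha, h1⟩, fun htop => ⟨k, ⟨a, ha, h1⟩, ?_⟩, ?_, ?_⟩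
    · rintro k' ⟨a', ha', h1'⟩
      have hrn : r < n := lt_of_le_of_ne hr (by rintro rfl; exact htop hA.eq_top)
      -- Uniqueness of the exponent is the conjugation lemma for the trivial conjugation with both
      -- subgroups equal to A.
      have h4 : 1 * a' * 1⁻¹ = (Braid.delta n n ^ 2) ^ (k - k') * a := by
        rw [sub_eq_neg_add, zpow_add, mul_assoc _ _ a, ← h1, h1', zpow_neg]
        group
      have := hA.eq_zero hA h2 hrn hrn ha' ha h4
      omega
    · rintro ⟨a', ha', b', hb', h⟩
      -- A common exponent for both sides: k = l if both subgroups are proper, and otherwise the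
      -- exponent of a proper one, since the whole group absorbs any power of Δ².
      obtain ⟨e, he, he'⟩ : ∃ e, (e = k ∨ A = ⊤) ∧ (e = l ∨ B = ⊤) := by
        rcases hr.lt_or_eq with hrn | rfl
        · rcases hs.lt_or_eq with hsn | rfl
          · exact ⟨k, .inl rfl, .inl (hA.eq_of_mul hB h2 hrn hsn ha hb h1 h3 ha' hb' h)⟩
          · exact ⟨k, .inl rfl, .inr hB.eq_top⟩
        · exact ⟨l, .inr hA.eq_top, .inl rfl⟩
      obtain ⟨h4, h5⟩ := Braid.mem_of_eq ha hb h1 h3 he he'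
      refine ⟨e, _, h4, ?_, ?_⟩
      · rw [zpow_neg, mul_inv_cancel_left]
      · convert h5 using 1
        rw [zpow_neg]
        group
    · rintro ⟨k', a', ha', -, hb'⟩
      exact ⟨a', ha', _, hb', by group⟩
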